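/- Let $r\ge 0$ and take indices modulo $r+1$. For each $j$ let $(M_j,\sigma_j)$ be a symplectic manifold (finite-dimensional, Hausdorff, without boundary, possibly non-compact), let $L_{j(j+1)}\subset M_j^-\times M_{j+1}$ be a compact Lagrangian submanifold (with respect to $(-\sigma_j)\oplus\sigma_{j+1}$), and let $\delta_j>0$. Write $\underline L=(L_{j(j+1)})_j$ and let $\underline H=(H_j)_j$ with $H_j\in C^\infty([0,\delta_j]\times M_j)$. Let $X_{H_j}$ be the time-dependent Hamiltonian vector field and $\phi_j:=\phi^{H_j}_{\delta_j}$ its time-$\delta_j$ flow. *Conventions.* A pair of indices $j<j'$ means $j<j'\le j+r+1$. For a proper subset $I\subset\{0,\dots,r\}$ a consecutive pair $j<j'\in I^C$ is such a pair with $j,j'\in I^C$ and $\{j+1,\dots,j'-1\}\subset I$. For $j<j'$ put $$L_{j(j+1)}\times_{H_{j+1}}\cdots\times_{H_{j'-1}}L_{(j'-1)j'}:=(L_{j(j+1)}\times\cdots\times L_{(j'-1)j'})\cap(M_j\times\mathrm{graph}(\phi_{j+1})\times\cdots\times\mathrm{graph}(\phi_{j'-1})\times M_{j'}),$$ and let $\times_{I,\underline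 H}\underline L$ be the product of these sets over the consecutive pairs $j<j'\in I^C$; equivalently, the set of points of $L_{01}\times\cdots\times L_{r(r+1)}$ satisfying the graph conditions at all $i\in I$. For $I=\{0,\dots,r\}$ let $\times_{I,\underline H}\underline L:=(L_{01}\times\cdots\times L_{r(r+1)})\cap(\mathrm{graph}(\phi_1)\times\cdots\times\mathrm{graph}(\phi_r)\times\mathrm{graph}(\phi_0))^T$, where $T$ is the evident reordering of factors. Let $\mathcal I(\underline L,\underline H)$ be the set of tuples of Hamiltonian chords $x_j:[0,\delta_j]\to M_j$, $\dot x_j=X_{H_j}(x_j)$, with $(x_j(\delta_j),x_{j+1}(0))\in L_{j(j+1)}$ for all $j$. Replacing the graphs by the diagonals $\Delta_i=\Delta_{M_i}$ gives the notation $\times_{\Delta_i}$ and $\times_{I,0}$. Let $\mathrm{Ham}^*(\underline L)$ be the set of those $\underline H$ for which the defining equations of $\times_{I,\underline H}\underline L$ are transversal for every $I\subset\{0,\dots,r\}$: the full intersection above is transverse and, for every proper $I$, so is the intersection defining each of the factors of $\times_{I,\underline H}\underline L$. **Statement.** Let $\underline H\in\mathrm{Ham}^*(\underline L)$, and suppose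 that for every $k$ the Hamiltonian flow of $H_{k+1}$ starting at any point of the projection of $L_{k(k+1)}$ to $M_{k+1}$ exists up to time $\delta_{k+1}$ (this is automatic if the $M_j$ are compact). Let $L'_{j(j+1)}:=(\mathrm{Id}_{M_j}\times\phi_{j+1})L_{j(j+1)}$. Then each $L'_{j(j+1)}\subset M_j^-\times M_{j+1}$ is again a compact Lagrangian submanifold, and the following hold. 1. The intersection $\mathcal I(\underline L',0)=(L'_{01}\times\cdots\times L'_{r(r+1)})\cap(\Delta_{M_1}\times\cdots\times\Delta_{M_0})^T$ is transverse. The map $\underline x\mapsto (x_j(\delta_j),x_{j+1}(\delta_{j+1}))_j$ is a bijection from $\mathcal I(\underline L,\underline H)$ onto it, and $\prod_k(\mathrm{Id}\times\phi_{k+1})$ identifies $\times_{\{0,\dots,r\},\underline H}\underline L$ with it. 2. For any proper $I\subset\{0,\dots,r\}$, the fiber product $\times_{I,0}\underline L'$, viewed as the subset of $\prod_kL'_{k(k+1)}$ cut out by the diagonal conditions at all $i\in I$, is cut out transversally and is identified with $\times_{I,\underline H}\underline L$ by $\prod_k(\mathrm{Id}\times\phi_{k+1})$. Grouping the factors, it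 is the product over the consecutive pairs $j<j'\in I^C$ of the sets $L'_{j(j+1)}\times_{\Delta_{j+1}}\cdots\times_{\Delta_{j'-1}}L'_{(j'-1)j'}$. Each of these is a transverse intersection, is equal to the image of $L_{j(j+1)}\times_{H_{j+1}}\cdots\times_{H_{j'-1}}L_{(j'-1)j'}$ under $\mathrm{Id}_{M_j}\times\phi_{j+1}\times\mathrm{Id}_{M_{j+1}}\times\cdots\times\mathrm{Id}_{M_{j'-1}}\times\phi_{j'}$, and is identified with it by this map. 3. For such $j<j'$, the set $L'_{j(j+1)}\times_{\Delta_{j+1}}\cdots\times_{\Delta_{j'-1}}L'_{(j'-1)j'}$ is a smooth submanifold of dimension $\tfrac12(\dim M_j+\dim M_{j'})$, and its projection to $M_j\times M_{j'}$ is an immersion whose image is the geometric composition $L'_{j(j+1)}\circ\cdots\circ L'_{(j'-1)j'}$ (composition of relations). Here "identifies" means that the map is smooth along the source, is bijective from the source onto the target, and has a differential that maps the tangent space of the source at each point bijectively onto that of the target. -/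

import Mathlib

open scoped Manifold ContDiff Topology
open Set

noncomputable section

namespace Quilt

/-! ### Submanifolds and tangent spaces

Smooth manifolds are modelled on finite-dimensional real normed spaces, without boundary. The first
two definitions concern subsets of one manifold, the next ones subsets of a finite product of
manifolds `∀ i, N i`; there smoothness of a map into the product is smoothness of its components,
and a tangent vector of the product is a tuple of tangent vectors. -/

section Single

variable {F B N : Type*} [NormedAddCommGroup F] [NormedSpace ℝ F] [TopologicalSpace B]
  [TopologicalSpace N] [ChartedSpace B N]

/-- The tangent space of a subset `S` at `p`: velocities of smooth curves in `S` through `p`. -/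
def tangentSet (I : ModelWithCorners ℝ F B) (S : Set N) (p : N) : Set (TangentSpace I p) :=
  {v | ∃ γ : ℝ → N, γ 0 = p ∧ ContMDiffAt 𝓘(ℝ, ℝ) I ∞ γ 0 ∧
    (mfderiv 𝓘(ℝ, ℝ) I γ 0 (1 : ℝ) : F) = v ∧ ∀ᶠ t in 𝓝 (0 : ℝ), γ t ∈ S}

/-- `S` is an embedded smooth submanifold of dimension `d`: near each of its points it is the
homeomorphic image of an open subset of `ℝ^d` under a smooth map with injective differential. -/
def IsSubmanifold (I : ModelWithCorners ℝ F B) (d : ℕ) (S : Set N) : Prop :=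
  ∀ p ∈ S, ∃ (U : Set (EuclideanSpace ℝ (Fin d))) (V : Set N)
    (g : EuclideanSpace ℝ (Fin d) → N) (h : N → EuclideanSpace ℝ (Fin d)),
    IsOpen U ∧ IsOpen V ∧ p ∈ V ∧ g '' U = S ∩ V ∧
    ContMDiffOn 𝓘(ℝ, EuclideanSpace ℝ (Fin d)) I ∞ g U ∧
    (∀ u ∈ U, Function.Injective (mfderiv 𝓘(ℝ, EuclideanSpace ℝ (Fin d)) I g u)) ∧
    ContinuousOn h (S ∩ V) ∧ LeftInvOn h g U

end Single

section Family

variable {ι : Type*} {F B N : ι → Type*} [∀ i, NormedAddCommGroup (F i)]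
  [∀ i, NormedSpace ℝ (F i)] [∀ i, TopologicalSpace (B i)] [∀ i, TopologicalSpace (N i)]
  [∀ i, ChartedSpace (B i) (N i)]

/-- The tangent space at `q` of a subset `S` of the product manifold `∀ i, N i`: velocities of
smooth curves in `S` through `q`. -/
def piTangentSet (I : ∀ i, ModelWithCorners ℝ (F i) (B i)) (S : Set (∀ i, N i)) (q : ∀ i, N i) :
    Set (∀ i, TangentSpace (I i) (q i)) :=
  {v | ∃ γ : ℝ → ∀ i, N i, γ 0 = q ∧
    (∀ i, ContMDiffAt 𝓘(ℝ, ℝ) (I i) ∞ (fun t => γ t i) 0) ∧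
    (∀ i, (mfderiv 𝓘(ℝ, ℝ) (I i) (fun t => γ t i) 0 (1 : ℝ) : F i) = v i) ∧
    ∀ᶠ t in 𝓝 (0 : ℝ), γ t ∈ S}

/-- Embedded smooth submanifolds of dimension `d` of the product manifold `∀ i, N i`. -/
def IsPiSubmanifold (I : ∀ i, ModelWithCorners ℝ (F i) (B i)) (d : ℕ) (S : Set (∀ i, N i)) :
    Prop :=
  ∀ p ∈ S, ∃ (U : Set (EuclideanSpace ℝ (Fin d))) (V : Set (∀ i, N i))
    (g : EuclideanSpace ℝ (Fin d) → ∀ i, N i) (h : (∀ i, N i) → EuclideanSpace ℝ (Fin d)),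
    IsOpen U ∧ IsOpen V ∧ p ∈ V ∧ g '' U = S ∩ V ∧
    (∀ i, ContMDiffOn 𝓘(ℝ, EuclideanSpace ℝ (Fin d)) (I i) ∞ (fun u => g u i) U) ∧
    (∀ u ∈ U, Function.Injective fun w : EuclideanSpace ℝ (Fin d) =>
      fun i => (mfderiv 𝓘(ℝ, EuclideanSpace ℝ (Fin d)) (I i) (fun u' => g u' i) u w : F i)) ∧
    ContinuousOn h (S ∩ V) ∧ LeftInvOn h g U

/-- Two subsets of the product manifold intersect transversely: at every common point `q` their
tangent spaces span the tangent space of the product. -/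
def PiTransverse (I : ∀ i, ModelWithCorners ℝ (F i) (B i)) (S T : Set (∀ i, N i)) : Prop :=
  ∀ q ∈ S ∩ T, ∀ w : ∀ i, TangentSpace (I i) (q i),
    ∃ a ∈ piTangentSet I S q, ∃ b ∈ piTangentSet I T q, a + b = w

end Family

/-! ### Symplectic manifolds, Lagrangian correspondences, Hamiltonian flows -/

section Symplectic

variable {E M : Type*} [NormedAddCommGroup E] [NormedSpace ℝ E] [TopologicalSpace M]
  [ChartedSpace E M]

/-- The expression of a 2-form in the chart around `x₀`: its pullback under the inverse chart. -/
def chartForm (σ : ∀ x : M, (TangentSpace 𝓘(ℝ, E) x) [⋀^Fin 2]→L[ℝ] ℝ) (x₀ : M) (y : E) :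
    E [⋀^Fin 2]→L[ℝ] ℝ :=
  (σ ((extChartAt 𝓘(ℝ, E) x₀).symm y)).compContinuousLinearMap
    (mfderiv 𝓘(ℝ, E) 𝓘(ℝ, E) (extChartAt 𝓘(ℝ, E) x₀).symm y :
      E →L[ℝ] TangentSpace 𝓘(ℝ, E) ((extChartAt 𝓘(ℝ, E) x₀).symm y))

variable (E M) in
/-- A symplectic form: a smooth, closed, nondegenerate 2-form. -/
structure SymplecticForm where
  form : ∀ x : M, (TangentSpace 𝓘(ℝ, E) x) [⋀^Fin 2]→L[ℝ] ℝ
  smooth : ∀ x₀ : M, ContDiffOn ℝ ∞ (chartForm form x₀) (extChartAt 𝓘(ℝ, E) x₀).target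
  closed : ∀ x₀ : M, ∀ y ∈ (extChartAt 𝓘(ℝ, E) x₀).target, extDeriv (chartForm form x₀) y = 0
  nondegenerate : ∀ (x : M) (v : TangentSpace 𝓘(ℝ, E) x), (∀ w, form x ![v, w] = 0) → v = 0

/-- `x` is a trajectory on `[0,δ]` of the Hamiltonian vector field of the time-dependent function
`H`, that is, `ẋ(t) = X_{H_t}(x(t))`, where `σ(X_{H_t}, ·) = dH_t`. Only the values of `x` on
`[0,δ]` matter. -/
def IsHamChord (σ : SymplecticForm E M) (H : ℝ → M → ℝ) (δ : ℝ) (x : ℝ → M) : Prop :=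
  ∀ t ∈ Icc 0 δ, ∃ v : TangentSpace 𝓘(ℝ, E) (x t),
    HasMFDerivWithinAt 𝓘(ℝ, ℝ) 𝓘(ℝ, E) x (Icc 0 δ) t
      ((1 : ℝ →L[ℝ] ℝ).smulRight v : ℝ →L[ℝ] TangentSpace 𝓘(ℝ, E) (x t)) ∧
    ∀ w : TangentSpace 𝓘(ℝ, E) (x t),
      σ.form (x t) ![v, w] = (mfderiv 𝓘(ℝ, E) 𝓘(ℝ, ℝ) (H t) (x t) w : ℝ)

/-- The Hamiltonian flow starting at `m` exists up to time `δ`. -/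
def FlowDefinedAt (σ : SymplecticForm E M) (H : ℝ → M → ℝ) (δ : ℝ) (m : M) : Prop :=
  ∃ x : ℝ → M, IsHamChord σ H δ x ∧ x 0 = m

open scoped Classical in
/-- The time-`δ` Hamiltonian flow `φ_δ^H` (the identity, by convention, where the flow does not
exist up to time `δ`). -/
def flowMap (σ : SymplecticForm E M) (H : ℝ → M → ℝ) (δ : ℝ) (m : M) : M :=
  if h : FlowDefinedAt σ H δ m then h.choose δ else m

/-- The graph of the time-`δ` Hamiltonian flow. -/
def flowGraph (σ : SymplecticForm E M) (H : ℝ → M → ℝ) (δ : ℝ) : Set (M × M) :=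
  {p | ∃ x : ℝ → M, IsHamChord σ H δ x ∧ x 0 = p.1 ∧ x δ = p.2}

variable {E' M' : Type*} [NormedAddCommGroup E'] [NormedSpace ℝ E'] [TopologicalSpace M']
  [ChartedSpace E' M']

/-- `L` is a Lagrangian submanifold of `M⁻ × M'`, the product with the symplectic form
`(-σ) ⊕ σ'`: a submanifold of half the dimension on which this form vanishes. -/
def IsLagrangianCorrespondence (σ : SymplecticForm E M) (σ' : SymplecticForm E' M')
    (L : Set (M × M')) : Prop :=
  (∃ d : ℕ, 2 * d = Module.finrank ℝ E + Module.finrank ℝ E' ∧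
    IsSubmanifold (𝓘(ℝ, E).prod 𝓘(ℝ, E')) d L) ∧
  ∀ p ∈ L, ∀ v ∈ tangentSet (𝓘(ℝ, E).prod 𝓘(ℝ, E')) L p,
    ∀ w ∈ tangentSet (𝓘(ℝ, E).prod 𝓘(ℝ, E')) L p,
      -σ.form p.1 ![v.1, w.1] + σ'.form p.2 ![v.2, w.2] = 0

end Symplectic

/-! ### Cyclic correspondences and their fiber products

Indices are taken modulo `r + 1`. A cyclic correspondence consists of sets
`Λ k = Λ_{k(k+1)} ⊂ M k × M (k+1)`. A pair of indices `j < j' ≤ j + r + 1` is encoded by `j` and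
the last factor `ℓ = j' - 1`, where `j, ℓ` are arbitrary residues. -/

section Cyclic

variable {r : ℕ}

/-- The residues `j, j+1, …, ℓ`, the labels of the factors `Λ_{j(j+1)}, …, Λ_{ℓ(ℓ+1)}`. -/
def arc (j ℓ : ZMod (r + 1)) : Set (ZMod (r + 1)) :=
  {k | (k - j).val ≤ (ℓ - j).val}

/-- `j < ℓ + 1` is a consecutive pair of indices in the complement of `I`. -/
def IsConsecutive (I : Set (ZMod (r + 1))) (j ℓ : ZMod (r + 1)) : Prop :=
  j ∉ I ∧ ℓ + 1 ∉ I ∧ ∀ k ∈ arc j ℓ, k ≠ ℓ → k + 1 ∈ I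

section Sets

variable {M : ZMod (r + 1) → Type*}

/-- The product of the factors `Λ k` with `k ∈ K`. -/
def prodSet (K : Set (ZMod (r + 1))) (Λ : ∀ k, Set (M k × M (k + 1))) :
    Set (∀ k : K, M k × M (k + 1)) :=
  {q | ∀ k : K, q k ∈ Λ k}

/-- For `Γ i ⊂ M i × M i`, the product of the `Γ i` over those `i ∈ I` for which both adjacent
factors `i - 1` and `i` occur in `K`, and of one `M i` for each remaining slot, with the slots
reordered to form a subset of the product of the `M k × M (k + 1)`, `k ∈ K`. -/
def seamSet (K I : Set (ZMod (r + 1))) (Γ : ∀ i, Set (M i × M i)) :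
    Set (∀ k : K, M k × M (k + 1)) :=
  {q | ∀ (k : ZMod (r + 1)) (hk : k ∈ K) (hk' : k + 1 ∈ K), k + 1 ∈ I →
    ((q ⟨k, hk⟩).2, (q ⟨k + 1, hk'⟩).1) ∈ Γ (k + 1)}

/-- The fiber product of the factors `Λ k`, `k ∈ K`, over the relations `Γ i`, `i ∈ I`. -/
def fiberProduct (K I : Set (ZMod (r + 1))) (Λ : ∀ k, Set (M k × M (k + 1)))
    (Γ : ∀ i, Set (M i × M i)) : Set (∀ k : K, M k × M (k + 1)) :=
  prodSet K Λ ∩ seamSet K I Γ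

/-- The diagonals `Δ_{M i}`. -/
def diagonals (i : ZMod (r + 1)) : Set (M i × M i) := {p | p.1 = p.2}

/-- `n`-fold composition of relations: `a` and `c` are related if `a ∈ M j` and `c ∈ M (j + n + 1)`
are joined through the `n + 1` relations `Λ_{j(j+1)}, …, Λ_{(j+n)(j+n+1)}`. -/
inductive ChainRel (Λ : ∀ k, Set (M k × M (k + 1))) (j : ZMod (r + 1)) :
    ℕ → ∀ ℓ : ZMod (r + 1), M j → M (ℓ + 1) → Prop
  | single {a : M j} {b : M (j + 1)} (h : (a, b) ∈ Λ j) : ChainRel Λ j 0 j a b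
  | step {n : ℕ} {ℓ : ZMod (r + 1)} {a : M j} {b : M (ℓ + 1)} {c : M (ℓ + 1 + 1)}
      (hab : ChainRel Λ j n ℓ a b) (hbc : (b, c) ∈ Λ (ℓ + 1)) : ChainRel Λ j (n + 1) (ℓ + 1) a c

/-- The geometric composition `Λ_{j(j+1)} ∘ … ∘ Λ_{ℓ(ℓ+1)}`. -/
def geometricComposition (Λ : ∀ k, Set (M k × M (k + 1))) (j ℓ : ZMod (r + 1)) :
    Set (M j × M (ℓ + 1)) :=
  {p | ChainRel Λ j (ℓ - j).val ℓ p.1 p.2}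

theorem left_mem_arc (j ℓ : ZMod (r + 1)) : j ∈ arc j ℓ := by simp [arc]

theorem right_mem_arc (j ℓ : ZMod (r + 1)) : ℓ ∈ arc j ℓ := by simp [arc]

/-- The projection to the outer components in `M j × M (ℓ + 1)`. It is used for points and, with
`M` replaced by the tangent spaces, for tangent vectors, as it is its own differential. -/
def outerProj (j ℓ : ZMod (r + 1)) (q : ∀ k : arc j ℓ, M k × M (k + 1)) : M j × M (ℓ + 1) :=
  ((q ⟨j, left_mem_arc j ℓ⟩).1, (q ⟨ℓ, right_mem_arc j ℓ⟩).2)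

/-- The regrouping of a tuple into its parts over the consecutive pairs of the complement of `I`. -/
def splitArcs (I : Set (ZMod (r + 1))) (q : ∀ k : (univ : Set (ZMod (r + 1))), M k × M (k + 1)) :
    ∀ c : {c : ZMod (r + 1) × ZMod (r + 1) // IsConsecutive I c.1 c.2},
      ∀ k : arc c.1.1 c.1.2, M k × M (k + 1) :=
  fun _ k => q ⟨k, mem_univ _⟩

end Sets

variable {E M : ZMod (r + 1) → Type*} [∀ j, NormedAddCommGroup (E j)] [∀ j, NormedSpace ℝ (E j)]
  [∀ j, TopologicalSpace (M j)] [∀ j, ChartedSpace (E j) (M j)]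

variable (E) in
/-- The models of the manifolds `M k × M (k + 1)`, `k ∈ K`. -/
abbrev slotModel (K : Set (ZMod (r + 1))) (k : K) :
    ModelWithCorners ℝ (E k × E (k + 1)) (ModelProd (E k) (E (k + 1))) :=
  𝓘(ℝ, E k).prod 𝓘(ℝ, E (k + 1))

variable (E) in
/-- The defining equations of the fiber product are transversal: the product of the `Λ k` and the
product of the relations `Γ i` intersect transversely. -/
def IsTransversalFiberProduct (K I : Set (ZMod (r + 1))) (Λ : ∀ k, Set (M k × M (k + 1)))
    (Γ : ∀ i, Set (M i × M i)) : Prop :=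
  PiTransverse (slotModel E K) (prodSet K Λ) (seamSet K I Γ)

variable (σ : ∀ j, SymplecticForm (E j) (M j)) (δ : ZMod (r + 1) → ℝ)
  (L : ∀ k, Set (M k × M (k + 1))) (H : ∀ j, ℝ → M j → ℝ)

/-- The graphs of the Hamiltonian flows `φ_{δ_i}^{H_i}`. -/
def flowGraphs (i : ZMod (r + 1)) : Set (M i × M i) := flowGraph (σ i) (H i) (δ i)

/-- The tuples of Hamiltonian chords `x_j : [0,δ_j] → M_j` with
`(x_j(δ_j), x_{j+1}(0)) ∈ L_{j(j+1)}`. -/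
def generators (hδ : ∀ j, 0 < δ j) : Set (∀ j, Icc (0 : ℝ) (δ j) → M j) :=
  {x | (∀ j, IsHamChord (σ j) (H j) (δ j) (IccExtend (hδ j).le (x j))) ∧
    ∀ j, (x j ⟨δ j, right_mem_Icc.2 (hδ j).le⟩,
      x (j + 1) ⟨0, left_mem_Icc.2 (hδ (j + 1)).le⟩) ∈ L j}

/-- The regular tuples of Hamiltonian functions in `⊕_j C^∞([0,δ_j] × M_j)`: for every set `I` of
indices the defining equations of the partial fiber product of `L` over `I` and `H` are
transversal. For `I` the set of all indices this is the full intersection, for a proper subset it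
is the product of one fiber product for each consecutive pair in the complement of `I`. -/
def HamStar : Set (∀ j, ℝ → M j → ℝ) :=
  {H | (∀ j, ContMDiffOn (𝓘(ℝ, ℝ).prod 𝓘(ℝ, E j)) 𝓘(ℝ, ℝ) ∞ (fun p : ℝ × M j => H j p.1 p.2)
      (Icc 0 (δ j) ×ˢ univ)) ∧
    IsTransversalFiberProduct E univ univ L (flowGraphs σ δ H) ∧
    ∀ I : Set (ZMod (r + 1)), I ≠ univ → ∀ j ℓ, IsConsecutive I j ℓ →
      IsTransversalFiberProduct E (arc j ℓ) I L (flowGraphs σ δ H)}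

/-- `L'_{k(k+1)} = (Id × φ_{δ_{k+1}}^{H_{k+1}}) L_{k(k+1)}`. -/
def perturbed (k : ZMod (r + 1)) : Set (M k × M (k + 1)) :=
  Prod.map id (flowMap (σ (k + 1)) (H (k + 1)) (δ (k + 1))) '' L k

/-- The product of the maps `Id × φ_{δ_{k+1}}^{H_{k+1}}` over `k ∈ K`. -/
def perturbMap (K : Set (ZMod (r + 1))) (q : ∀ k : K, M k × M (k + 1)) :
    ∀ k : K, M k × M (k + 1) :=
  fun k => Prod.map id (flowMap (σ (k + 1)) (H (k + 1)) (δ (k + 1))) (q k)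

/-- The differential of `perturbMap` at `q`. -/
def perturbDeriv (K : Set (ZMod (r + 1))) (q : ∀ k : K, M k × M (k + 1))
    (v : ∀ k : K, TangentSpace (slotModel E K k) (q k)) :
    ∀ k : K, TangentSpace (slotModel E K k) (perturbMap σ δ H K q k) :=
  fun k => mfderiv (slotModel E K k) (slotModel E K k)
    (Prod.map id (flowMap (σ (k + 1)) (H (k + 1)) (δ (k + 1)))) (q k) (v k)

/-- `perturbMap` identifies the fiber product of `L` over the flow graphs with the fiber product of
`L'` over the diagonals: it is smooth along the former, and bijective between the two together
with its differentials. -/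
def PerturbIdentifies (K I : Set (ZMod (r + 1))) : Prop :=
  BijOn (perturbMap σ δ H K) (fiberProduct K I L (flowGraphs σ δ H))
    (fiberProduct K I (perturbed σ δ L H) diagonals) ∧
  ∀ q ∈ fiberProduct K I L (flowGraphs σ δ H),
    (∀ k : K, ContMDiffAt (slotModel E K k) (slotModel E K k) ∞
      (Prod.map id (flowMap (σ (k + 1)) (H (k + 1)) (δ (k + 1)))) (q k)) ∧
    BijOn (perturbDeriv σ δ H K q)
      (piTangentSet (slotModel E K) (fiberProduct K I L (flowGraphs σ δ H)) q)
      (piTangentSet (slotModel E K) (fiberProduct K I (perturbed σ δ L H) diagonals)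
        (perturbMap σ δ H K q))

end Cyclic

end Quilt

end

/-! At a seam `i = k + 1`, the graph condition says that the first component `m'` of slot `k + 1` is
the flow image `φ_i m` of the second component `m` of slot `k`. The map `Id × φ_i` on slot `k`
replaces `m` by `φ_i m` and touches no first component, so the product of these maps turns every
graph condition into a diagonal condition (`slotMap_mem_seamSet`). Once `φ_i` is known to be a
diffeomorphism between open sets, fiber products, their tangent spaces and transversality are
carried over slot by slot (`bijOn_slotMap`, `bijOn_piTangentSet_slotMap`,
`isTransversalFiberProduct_slotImage`). As `φ_i` is also symplectic, the perturbed correspondences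
remain Lagrangian.

The analytic half proves these properties of `φ_i` on the open set where the flow exists
(`FlowDefinedAt.local`). In a chart, Hamilton's equation is an integral equation in a Banach space
of continuous curves. Superposition operators are smooth there, and the inverse function theorem
yields smooth dependence on the initial value together with the linearized equation
(`exists_smooth_solutions`). Closedness of the form and symmetry of the second derivative of the
Hamiltonian keep the form constant on linearized solutions (`bilin_eq_of_linearized`). Short-time
flows are composed along a chord (`HasLocalFlow.trans`), uniqueness of chords removes the dependence
on choices, and time reversal supplies the inverse.

For a proper index set `I`, the consecutive pairs cut the cycle into arcs, and every seam in `I`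
lies inside one arc; gluing the arcs gives the statements over the whole cycle. Over one arc,
transversality makes the seam equations a submersion on the product of local parametrizations
(`exists_param_fiberProduct`), and the dimensions telescope to half the sum of the outer ones. The
outer projection is an immersion for a symplectic reason (`injOn_outerProj`): a difference of
tangent vectors with equal outer components is orthogonal to the tangent spaces of the factors by
isotropy, and to the linearized diagonals because the contributions cancel at each seam. By
transversality these spaces span, so the difference vanishes by nondegeneracy. -/

set_option linter.unusedSectionVars false

noncomputable section


namespace Quilt

/-! ### Superposition operators on spaces of continuous curves -/

section Superposition

variable {K : Type*} [TopologicalSpace K] [CompactSpace K]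

section Continuity

variable {E F : Type*} [NormedAddCommGroup E] [NormedSpace ℝ E] [NormedAddCommGroup F]
  [NormedSpace ℝ F]

/-- The superposition operator `γ ↦ (t ↦ f (t, γ t))`. -/
def superpose (f : C(K × E, F)) (γ : C(K, E)) : C(K, F) := ⟨fun t => f (t, γ t), by fun_prop⟩

@[simp] theorem superpose_apply (f : C(K × E, F)) (γ : C(K, E)) (t : K) :
    superpose f γ t = f (t, γ t) := rfl

theorem continuous_superpose [LocallyCompactSpace K] (f : C(K × E, F)) :
    Continuous (superpose f) := by
  apply ContinuousMap.continuous_of_continuous_uncurry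
  change Continuous fun p : C(K, E) × K => f (p.2, p.1 p.2)
  fun_prop

/-- Pointwise application of a curve of operators. -/
def pointwiseApply : C(K, E →L[ℝ] F) →L[ℝ] C(K, E) →L[ℝ] C(K, F) :=
  LinearMap.mkContinuous₂
    (LinearMap.mk₂ ℝ (fun (A : C(K, E →L[ℝ] F)) (γ : C(K, E)) =>
        (⟨fun t => A t (γ t), by fun_prop⟩ : C(K, F)))
      (fun _ _ _ => by ext; simp) (fun _ _ _ => by ext; simp) (fun _ _ _ => by ext; simp)
      (fun _ _ _ => by ext; simp)) 1 (fun A γ => by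
      rw [ContinuousMap.norm_le _ (by positivity)]
      intro t
      simp only [LinearMap.mk₂_apply, ContinuousMap.coe_mk, one_mul]
      exact (A t).le_of_opNorm_le_of_le (A.norm_coe_le_norm t) (γ.norm_coe_le_norm t))

@[simp] theorem pointwiseApply_apply (A : C(K, E →L[ℝ] F)) (γ : C(K, E)) (t : K) :
    pointwiseApply A γ t = A t (γ t) := rfl

theorem contDiff_pointwiseApply (n : ℕ) :
    ContDiff ℝ n fun A : C(K, E →L[ℝ] F) => pointwiseApply A :=
  ContinuousLinearMap.contDiff (𝕜 := ℝ) (E := C(K, E →L[ℝ] F))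
    (F := C(K, E) →L[ℝ] C(K, F)) pointwiseApply

theorem norm_pointwiseApply_le (A : C(K, E →L[ℝ] F)) : ‖pointwiseApply A‖ ≤ ‖A‖ := by
  refine ContinuousLinearMap.opNorm_le_bound _ (norm_nonneg A) fun γ => ?_
  rw [ContinuousMap.norm_le _ (by positivity)]
  intro t
  exact (A t).le_of_opNorm_le_of_le (A.norm_coe_le_norm t) (γ.norm_coe_le_norm t)

/-- The mean value inequality is applied at each time separately; continuity of `superpose f'` at
`γ` makes the radius independent of the time, which gives a remainder estimate in the sup norm. -/
theorem hasFDerivAt_superpose [LocallyCompactSpace K] {f : C(K × E, F)}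
    {f' : C(K × E, E →L[ℝ] F)} (hf : ∀ t x, HasFDerivAt (fun y => f (t, y)) (f' (t, x)) x)
    (γ : C(K, E)) :
    HasFDerivAt (superpose f) (pointwiseApply (superpose f' γ)) γ := by
  rw [hasFDerivAt_iff_isLittleO_nhds_zero, Asymptotics.isLittleO_iff]
  intro c hc
  obtain ⟨ε, hε, hball⟩ := Metric.continuousAt_iff.1
    ((continuous_superpose f').continuousAt (x := γ)) c hc
  filter_upwards [Metric.ball_mem_nhds (0 : C(K, E)) hε] with h hh
  rw [ContinuousMap.norm_le _ (by positivity)]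
  intro t
  have hbound : ∀ x ∈ Metric.ball (γ t) ε, ‖f' (t, x) - f' (t, γ t)‖ ≤ c := by
    intro x hx
    -- The constant shift of `γ` by `x - γ t` passes through `x` at time `t` and stays `ε`-close to
    -- `γ`, so the estimate on curves yields the pointwise one.
    have h1 : dist (γ + ContinuousMap.const K (x - γ t)) γ < ε := by
      rw [dist_eq_norm, add_sub_cancel_left, ContinuousMap.norm_lt_iff _ hε]
      intro s
      simpa [dist_eq_norm] using hx
    have h2 := (hball h1).le
    rw [dist_eq_norm] at h2
    have h3 := ((superpose f' (γ + ContinuousMap.const K (x - γ t)) -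
      superpose f' γ).norm_coe_le_norm t).trans h2
    simpa using h3
  have hmem : γ t + h t ∈ Metric.ball (γ t) ε := by
    rw [mem_ball_zero_iff] at hh
    simpa [dist_eq_norm] using (h.norm_coe_le_norm t).trans_lt hh
  have := (convex_ball (γ t) ε).norm_image_sub_le_of_norm_hasFDerivWithin_le'
    (f := fun y => f (t, y)) (fun x _ => (hf t x).hasFDerivWithinAt) hbound
    (Metric.mem_ball_self hε) hmem
  simp only [add_sub_cancel_left] at this
  simp only [ContinuousMap.sub_apply, superpose_apply, ContinuousMap.add_apply,
    pointwiseApply_apply]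
  exact this.trans (mul_le_mul_of_nonneg_left (h.norm_coe_le_norm t) hc.le)

end Continuity

universe u

/-- The partial derivative in the space variable of a function of time and space. -/
def spaceDeriv {E F : Type*} [NormedAddCommGroup E] [NormedSpace ℝ E] [NormedAddCommGroup F]
    [NormedSpace ℝ F] (f : ℝ × E → F) (p : ℝ × E) : E →L[ℝ] F :=
  fderiv ℝ (fun y => f (p.1, y)) p.2

/-! ### Partial derivatives in the space variable. -/

section SpaceDeriv

variable {E F : Type*} [NormedAddCommGroup E] [NormedSpace ℝ E] [NormedAddCommGroup F]
  [NormedSpace ℝ F] {T : Set ℝ} {U : Set E} {f : ℝ × E → F}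

theorem hasFDerivAt_comp_inr (hU : IsOpen U) (hf : ContDiffOn ℝ ∞ f (T ×ˢ U)) {t : ℝ}
    (ht : t ∈ T) {x : E} (hx : x ∈ U) :
    HasFDerivAt (fun y => f (t, y))
      ((fderivWithin ℝ f (T ×ˢ U) (t, x)).comp (ContinuousLinearMap.inr ℝ ℝ E)) x := by
  have h1 : HasFDerivWithinAt f (fderivWithin ℝ f (T ×ˢ U) (t, x)) (T ×ˢ U) (t, x) :=
    ((hf.differentiableOn (by simp)) (t, x) ⟨ht, hx⟩).hasFDerivWithinAt
  have h2 : HasFDerivAt (fun y : E => (t, y)) (ContinuousLinearMap.inr ℝ ℝ E) x :=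
    hasFDerivAt_prodMk_right t x
  exact (h1.comp x (h2.hasFDerivWithinAt (s := U)) fun y hy => ⟨ht, hy⟩).hasFDerivAt
    (hU.mem_nhds hx)

theorem hasFDerivAt_spaceDeriv (hU : IsOpen U) (hf : ContDiffOn ℝ ∞ f (T ×ˢ U)) {t : ℝ}
    (ht : t ∈ T) {x : E} (hx : x ∈ U) :
    HasFDerivAt (fun y => f (t, y)) (spaceDeriv f (t, x)) x :=
  (hasFDerivAt_comp_inr hU hf ht hx).differentiableAt.hasFDerivAt

/-- The time set need not be open, so smoothness is read off from the derivative within the product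
set; in the open space direction it restricts to the ordinary partial derivative. -/
theorem contDiffOn_spaceDeriv (hT : UniqueDiffOn ℝ T) (hU : IsOpen U)
    (hf : ContDiffOn ℝ ∞ f (T ×ˢ U)) : ContDiffOn ℝ ∞ (spaceDeriv f) (T ×ˢ U) :=
  ((hf.fderivWithin (hT.prod hU.uniqueDiffOn) (m := ∞) (by simp)).clm_comp
    contDiffOn_const).congr fun _ hp => (hasFDerivAt_comp_inr hU hf hp.1 hp.2).fderiv

end SpaceDeriv

/-- A function continuous on `T × E` as a bundled continuous map on `[a,b] × E ⊂ T × E`. -/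
def restrictTime {E F : Type*} [NormedAddCommGroup E] [NormedAddCommGroup F] {T : Set ℝ}
    {a b : ℝ} (hab : Icc a b ⊆ T) (f : ℝ × E → F) (hf : ContinuousOn f (T ×ˢ univ)) :
    C(Icc a b × E, F) :=
  ⟨fun p => f (p.1, p.2), hf.comp_continuous (by fun_prop) fun p => ⟨hab p.1.2, mem_univ _⟩⟩

@[simp] theorem restrictTime_apply {E F : Type*} [NormedAddCommGroup E] [NormedAddCommGroup F]
    {T : Set ℝ} {a b : ℝ} (hab : Icc a b ⊆ T) (f : ℝ × E → F)
    (hf : ContinuousOn f (T ×ˢ univ)) (p : Icc a b × E) :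
    restrictTime hab f hf p = f (p.1, p.2) := rfl

/-- Induction on `n`: the derivative of a superposition operator is again one, built from
`spaceDeriv f`, followed by a continuous linear map. The target `F` varies in the induction because
it becomes `E →L[ℝ] F`; hence the common universe. -/
theorem contDiff_superpose {E : Type u} [NormedAddCommGroup E] [NormedSpace ℝ E] {T : Set ℝ}
    (hT : UniqueDiffOn ℝ T) {a b : ℝ} (hab : Icc a b ⊆ T) (n : ℕ) :
    ∀ {F : Type u} [NormedAddCommGroup F] [NormedSpace ℝ F] {f : ℝ × E → F}
      (hf : ContDiffOn ℝ ∞ f (T ×ˢ univ)),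
      ContDiff ℝ n (superpose (restrictTime hab f hf.continuousOn)) := by
  induction n with
  | zero =>
    intro F _ _ f hf
    exact contDiff_zero.2 (continuous_superpose _)
  | succ n ih =>
    intro F _ _ f hf
    have hf' := contDiffOn_spaceDeriv hT isOpen_univ hf
    push_cast
    rw [contDiff_succ_iff_hasFDerivAt]
    refine ⟨fun γ => pointwiseApply
      (superpose (restrictTime hab (spaceDeriv f) hf'.continuousOn) γ),
      (contDiff_pointwiseApply n).comp (ih hf'), fun γ => hasFDerivAt_superpose ?_ γ⟩
    intro t x
    exact hasFDerivAt_spaceDeriv isOpen_univ hf (hab t.2) (mem_univ x)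

end Superposition

/-! ### Smooth dependence of solutions on the initial value -/

section Volterra

variable {E : Type*} [NormedAddCommGroup E] [NormedSpace ℝ E] {a b : ℝ}

/-- The primitive `t ↦ ∫ₐᵗ γ`. -/
def primitiveAux (hab : a ≤ b) (γ : C(Icc a b, E)) : C(Icc a b, E) :=
  ⟨fun t => ∫ s in a..t, IccExtend hab γ s,
    (intervalIntegral.continuous_primitive
      (fun _ _ => (γ.continuous.Icc_extend' (h := hab)).intervalIntegrable _ _) a).comp
      continuous_subtype_val⟩

theorem norm_primitiveAux_le (hab : a ≤ b) (γ : C(Icc a b, E)) :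
    ‖primitiveAux hab γ‖ ≤ (b - a) * ‖γ‖ := by
  rw [ContinuousMap.norm_le _ (mul_nonneg (sub_nonneg.2 hab) (norm_nonneg _))]
  intro t
  have := intervalIntegral.norm_integral_le_of_norm_le_const (a := a) (b := t) (C := ‖γ‖)
    (f := IccExtend hab γ) fun s _ => γ.norm_coe_le_norm _
  refine this.trans ?_
  rw [abs_of_nonneg (sub_nonneg.2 t.2.1), mul_comm]
  gcongr
  exact t.2.2

/-- The Volterra operator `γ ↦ (t ↦ ∫ₐᵗ γ)`. -/
def primitive (hab : a ≤ b) : C(Icc a b, E) →L[ℝ] C(Icc a b, E) :=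
  LinearMap.mkContinuous
    { toFun := primitiveAux hab
      map_add' := fun γ η => by
        ext t
        have := intervalIntegral.integral_add (a := a) (b := t) (μ := MeasureTheory.volume)
          ((γ.continuous.Icc_extend' (h := hab)).intervalIntegrable _ _)
          ((η.continuous.Icc_extend' (h := hab)).intervalIntegrable _ _)
        exact this
      map_smul' := fun c γ => by
        ext t
        exact intervalIntegral.integral_smul c (IccExtend hab γ) }
    (b - a) (norm_primitiveAux_le hab)

theorem primitive_apply (hab : a ≤ b) (γ : C(Icc a b, E)) (t : Icc a b) :
    primitive hab γ t = ∫ s in a..t, IccExtend hab γ s := rfl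

theorem norm_primitive_le (hab : a ≤ b) : ‖(primitive hab : C(Icc a b, E) →L[ℝ] _)‖ ≤ b - a :=
  LinearMap.mkContinuous_norm_le _ (sub_nonneg.2 hab) _

/-- A curve satisfying an integral equation is differentiable. -/
theorem hasDerivWithinAt_of_eq_primitive [CompleteSpace E] (hab : a ≤ b) {x : E}
    {γ η : C(Icc a b, E)} (h : γ = ContinuousMap.const _ x + primitive hab η) (t : Icc a b) :
    HasDerivWithinAt (IccExtend hab γ) (η t) (Icc a b) t := by
  have h1 : HasDerivAt (fun u => x + ∫ s in a..u, IccExtend hab η s) (IccExtend hab η t) t :=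
    (intervalIntegral.integral_hasDerivAt_right
      ((η.continuous.Icc_extend' (h := hab)).intervalIntegrable _ _)
      ((η.continuous.Icc_extend' (h := hab)).stronglyMeasurableAtFilter _ _)
      (η.continuous.Icc_extend' (h := hab)).continuousAt).const_add x
  rw [IccExtend_val] at h1
  refine h1.hasDerivWithinAt.congr (fun u hu => ?_) ?_
  · rw [IccExtend_of_mem hab _ hu, h]; rfl
  · rw [IccExtend_val, h]; rfl

theorem eq_primitive_of_hasDerivWithinAt [CompleteSpace E] (hab : a ≤ b) {γ η : C(Icc a b, E)}
    (h : ∀ t : Icc a b, HasDerivWithinAt (IccExtend hab γ) (η t) (Icc a b) t) :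
    γ = ContinuousMap.const _ (γ ⟨a, left_mem_Icc.2 hab⟩) + primitive hab η := by
  ext t
  have hc : Continuous (IccExtend hab η) := η.continuous.Icc_extend' (h := hab)
  have := intervalIntegral.integral_eq_sub_of_hasDeriv_right_of_le (a := a) (b := t)
    (f := IccExtend hab γ) (f' := IccExtend hab η) t.2.1
    (γ.continuous.Icc_extend' (h := hab)).continuousOn (fun s hs => ?_)
    (hc.intervalIntegrable _ _)
  · simp only [ContinuousMap.add_apply, ContinuousMap.const_apply, primitive_apply, this]
    rw [IccExtend_val, IccExtend_left]
    abel
  · have hs' : s ∈ Icc a b := ⟨hs.1.le, hs.2.le.trans t.2.2⟩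
    have := h ⟨s, hs'⟩
    rw [← IccExtend_of_mem hab η hs'] at this
    exact (this.mono_of_mem_nhdsWithin (Icc_mem_nhdsGT_of_mem ⟨hs.1.le, hs.2.trans_le t.2.2⟩))

end Volterra

/-! ### Local solutions from the inverse function theorem. -/

section LocalFlow

universe u

variable {E : Type u} [NormedAddCommGroup E] [NormedSpace ℝ E] [CompleteSpace E] {a b : ℝ}
  {T : Set ℝ}

/-- Solutions of `γ' = Y(t,γ)` near a given solution on a short interval depend smoothly on the
initial value, and their variations solve the linearized equation. -/
theorem exists_smooth_solutions (hT : UniqueDiffOn ℝ T) (hab : a ≤ b) (habT : Icc a b ⊆ T)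
    {Y : ℝ × E → E} (hY : ContDiffOn ℝ ∞ Y (T ×ˢ univ)) {γ₀ : C(Icc a b, E)}
    (hγ₀ : ∀ t : Icc a b, HasDerivWithinAt (IccExtend hab γ₀) (Y (t, γ₀ t)) (Icc a b) t)
    {C : ℝ} (hC : ∀ t : Icc a b, ‖spaceDeriv Y (t, γ₀ t)‖ ≤ C) (hsmall : (b - a) * C < 1) :
    ∃ Γ : E → C(Icc a b, E), Γ (γ₀ ⟨a, left_mem_Icc.2 hab⟩) = γ₀ ∧
      ContDiffAt ℝ ∞ Γ (γ₀ ⟨a, left_mem_Icc.2 hab⟩) ∧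
      (∀ᶠ x in 𝓝 (γ₀ ⟨a, left_mem_Icc.2 hab⟩), Γ x ⟨a, left_mem_Icc.2 hab⟩ = x ∧
        ∀ t : Icc a b, HasDerivWithinAt (IccExtend hab (Γ x)) (Y (t, Γ x t)) (Icc a b) t) ∧
      ∀ v, fderiv ℝ Γ (γ₀ ⟨a, left_mem_Icc.2 hab⟩) v ⟨a, left_mem_Icc.2 hab⟩ = v ∧
        ∀ t : Icc a b, HasDerivWithinAt
          (IccExtend hab (fderiv ℝ Γ (γ₀ ⟨a, left_mem_Icc.2 hab⟩) v))
          (spaceDeriv Y (t, γ₀ t) (fderiv ℝ Γ (γ₀ ⟨a, left_mem_Icc.2 hab⟩) v t))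
          (Icc a b) t := by
  have hY' := contDiffOn_spaceDeriv hT isOpen_univ hY
  set x₀ := γ₀ ⟨a, left_mem_Icc.2 hab⟩ with hx₀
  let N : C(Icc a b, E) → C(Icc a b, E) := superpose (restrictTime habT Y hY.continuousOn)
  let A : C(Icc a b, E →L[ℝ] E) :=
    superpose (restrictTime habT (spaceDeriv Y) hY'.continuousOn) γ₀
  let V : C(Icc a b, E) →L[ℝ] C(Icc a b, E) := primitive hab
  let c : E →L[ℝ] C(Icc a b, E) := ContinuousLinearMap.const ℝ (Icc a b)
  have hc_apply : ∀ x, c x = ContinuousMap.const _ x := fun _ => rfl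
  have hN : ContDiff ℝ ∞ N := contDiff_infty.2 fun n => contDiff_superpose hT habT n hY
  have hN' : HasFDerivAt N (pointwiseApply A) γ₀ :=
    hasFDerivAt_superpose (fun t x => hasFDerivAt_spaceDeriv isOpen_univ hY (habT t.2) (mem_univ x)) γ₀
  let R : C(Icc a b, E) →L[ℝ] C(Icc a b, E) := V.comp (pointwiseApply A)
  have hAC : ‖A‖ ≤ C := by
    have : Nonempty (Icc a b) := ⟨⟨a, left_mem_Icc.2 hab⟩⟩
    exact (ContinuousMap.norm_le_of_nonempty _).2 hC
  -- The short interval makes the linearized Volterra operator a contraction, so `1 - R` is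
  -- invertible by a Neumann series.
  have hR : ‖R‖ < 1 := by
    refine lt_of_le_of_lt ?_ hsmall
    refine (ContinuousLinearMap.opNorm_comp_le _ _).trans ?_
    exact mul_le_mul (norm_primitive_le hab) ((norm_pointwiseApply_le A).trans hAC)
      (norm_nonneg _) (sub_nonneg.2 hab)
  let e : C(Icc a b, E) ≃L[ℝ] C(Icc a b, E) :=
    ContinuousLinearEquiv.ofUnit (Units.oneSub R hR)
  -- Solutions with initial value `x` are the curves that `G` sends to the constant curve `x`; `Γ`
  -- is the local inverse of `G` restricted to constants.
  let G : C(Icc a b, E) → C(Icc a b, E) := fun γ => γ - V (N γ)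
  have hG : ContDiff ℝ ∞ G := contDiff_id.sub (V.contDiff.comp hN)
  have hG' : HasFDerivAt G (e : C(Icc a b, E) →L[ℝ] C(Icc a b, E)) γ₀ :=
    (hasFDerivAt_id γ₀).sub (V.hasFDerivAt.comp γ₀ hN')
  have hGγ₀ : G γ₀ = c x₀ := by
    have := eq_primitive_of_hasDerivWithinAt hab (γ := γ₀) (η := N γ₀) hγ₀
    rw [sub_eq_iff_eq_add]
    exact this
  have hne : (∞ : WithTop ℕ∞) ≠ 0 := by simp
  let φ := hG.contDiffAt.toOpenPartialHomeomorph G hG' hne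
  have hφ : ∀ γ, φ γ = G γ := fun _ => rfl
  have hsrc : γ₀ ∈ φ.source := hG.contDiffAt.mem_toOpenPartialHomeomorph_source hG' hne
  have htgt : c x₀ ∈ φ.target := hGγ₀ ▸ φ.map_source hsrc
  have hinv : ContDiffAt ℝ ∞ φ.symm (c x₀) := hGγ₀ ▸ hG.contDiffAt.to_localInverse hG' hne
  let Γ : E → C(Icc a b, E) := fun x => φ.symm (c x)
  have hΓ₀ : Γ x₀ = γ₀ := by
    change φ.symm (c x₀) = γ₀
    rw [← hGγ₀, ← hφ, φ.left_inv hsrc]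
  have hΓ : ContDiffAt ℝ ∞ Γ x₀ := hinv.comp x₀ c.contDiff.contDiffAt
  have hev : ∀ᶠ x in 𝓝 x₀, Γ x = c x + V (N (Γ x)) := by
    filter_upwards [c.continuous.continuousAt.preimage_mem_nhds
      (φ.open_target.mem_nhds htgt)] with x hx
    rw [← sub_eq_iff_eq_add]
    exact φ.right_inv hx
  have hleft : ∀ η : C(Icc a b, E), V η ⟨a, left_mem_Icc.2 hab⟩ = 0 := fun η => by
    change primitive hab η _ = 0
    simp [primitive_apply]
  refine ⟨Γ, hΓ₀, hΓ, ?_, fun v => ?_⟩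
  · filter_upwards [hev] with x hx
    refine ⟨?_, fun t => hasDerivWithinAt_of_eq_primitive hab (x := x) (η := N (Γ x)) hx t⟩
    rw [hx, ContinuousMap.add_apply, hleft, add_zero]
    rfl
  -- Differentiating the integral equation in the initial value gives the linear integral equation
  -- `h3`, which is the linearized equation with initial value `v`.
  · have hΓ' : HasFDerivAt Γ (fderiv ℝ Γ x₀) x₀ := (hΓ.differentiableAt hne).hasFDerivAt
    have h1 : HasFDerivAt (fun x => c x + V (N (Γ x)))
        (c + V.comp ((pointwiseApply A).comp (fderiv ℝ Γ x₀))) x₀ := by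
      have h0 : HasFDerivAt N (pointwiseApply A) (Γ x₀) := by rw [hΓ₀]; exact hN'
      exact c.hasFDerivAt.add (V.hasFDerivAt.comp x₀ (h0.comp x₀ hΓ'))
    have h2 := (h1.congr_of_eventuallyEq hev).unique hΓ'
    have h3 : fderiv ℝ Γ x₀ v = c v + V (pointwiseApply A (fderiv ℝ Γ x₀ v)) := by
      conv_lhs => rw [← h2]
      rfl
    refine ⟨?_, fun t => hasDerivWithinAt_of_eq_primitive hab (x := v) h3 t⟩
    rw [h3, ContinuousMap.add_apply, hleft, add_zero]
    rfl

end LocalFlow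

end Quilt

end

noncomputable section


namespace Quilt

/-! ### Invariance of a closed form under the flow, in a vector space -/

section Bilinear

variable {E : Type*} [NormedAddCommGroup E] [NormedSpace ℝ E]

/-- The bilinear map of a 2-form. -/
def bilin : (E [⋀^Fin 2]→L[ℝ] ℝ) →L[ℝ] (E →L[ℝ] E →L[ℝ] ℝ) :=
  (ContinuousLinearMap.compL ℝ E (E [×1]→L[ℝ] ℝ) (E →L[ℝ] ℝ)
      ((continuousMultilinearCurryFin1 ℝ E ℝ).toContinuousLinearEquiv :
        (E [×1]→L[ℝ] ℝ) →L[ℝ] (E →L[ℝ] ℝ))).comp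
    (((continuousMultilinearCurryLeftEquiv ℝ (fun _ : Fin 2 => E) ℝ).toContinuousLinearEquiv :
        (E [×2]→L[ℝ] ℝ) →L[ℝ] (E →L[ℝ] E [×1]→L[ℝ] ℝ)).comp
      (ContinuousAlternatingMap.toContinuousMultilinearMapCLM ℝ))

theorem bilin_apply (η : E [⋀^Fin 2]→L[ℝ] ℝ) (v w : E) : bilin η v w = η ![v, w] := by
  change η (Fin.cons v (Fin.snoc 0 w)) = _
  congr 1
  ext i
  fin_cases i <;> rfl

theorem bilin_swap (η : E [⋀^Fin 2]→L[ℝ] ℝ) (v w : E) : bilin η v w = -bilin η w v := by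
  have h := η.toAlternatingMap.map_swap ![w, v] (i := 0) (j := 1) (by decide)
  rw [bilin_apply, bilin_apply]
  refine Eq.trans ?_ h
  change η _ = η _
  congr 1
  ext i
  fin_cases i <;> rfl

theorem contDiff_bilin :
    ContDiff ℝ ∞ fun η : E [⋀^Fin 2]→L[ℝ] ℝ => bilin η :=
  ContinuousLinearMap.contDiff (𝕜 := ℝ) (E := E [⋀^Fin 2]→L[ℝ] ℝ) (F := E →L[ℝ] E →L[ℝ] ℝ) bilin

theorem differentiableAt_bilin_comp {η : E → E [⋀^Fin 2]→L[ℝ] ℝ} {x : E}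
    (hη : DifferentiableAt ℝ η x) : DifferentiableAt ℝ (fun y => bilin (η y)) x :=
  ((contDiff_bilin.differentiable (by simp)) (η x)).comp x hη

/-- The alternating sum defining `extDeriv` on three vectors, moved from the form to its bilinear
map so that it can be combined with the product rule. -/
theorem fderiv_bilin_cyclic {η : E → E [⋀^Fin 2]→L[ℝ] ℝ} {x : E}
    (hη : DifferentiableAt ℝ η x) (hcl : extDeriv η x = 0) (a b c : E) :
    fderiv ℝ (fun y => bilin (η y)) x a b c - fderiv ℝ (fun y => bilin (η y)) x b a c +
      fderiv ℝ (fun y => bilin (η y)) x c a b = 0 := by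
  have hB : DifferentiableAt ℝ (fun y => bilin (η y)) x :=
    differentiableAt_bilin_comp hη
  have key : ∀ u v w : E, fderiv ℝ (fun y => η y ![v, w]) x u =
      fderiv ℝ (fun y => bilin (η y)) x u v w := by
    intro u v w
    have h1 : HasFDerivAt (fun y => bilin (η y) v w)
        (((fderiv ℝ (fun y => bilin (η y)) x).flip v).flip w) x := by
      have := (hB.hasFDerivAt.clm_apply (hasFDerivAt_const v x)).clm_apply (hasFDerivAt_const w x)
      exact this.congr_fderiv (by ext u; simp)
    simp only [← bilin_apply]
    rw [h1.fderiv]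
    rfl
  have h := extDeriv_apply hη ![a, b, c]
  rw [hcl, Fin.sum_univ_three] at h
  have e0 : (0 : Fin 3).removeNth ![a, b, c] = ![b, c] := by ext i; fin_cases i <;> rfl
  have e1 : (1 : Fin 3).removeNth ![a, b, c] = ![a, c] := by ext i; fin_cases i <;> rfl
  have e2 : (2 : Fin 3).removeNth ![a, b, c] = ![a, b] := by ext i; fin_cases i <;> rfl
  simp only [e0, e1, e2, key] at h
  simp at h
  linarith

/-- A Hamiltonian vector field preserves the symplectic form, infinitesimally. -/
theorem hamiltonian_infinitesimal {η : E → E [⋀^Fin 2]→L[ℝ] ℝ} {x : E}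
    (hη : DifferentiableAt ℝ η x) (hcl : extDeriv η x = 0) {ξ : E → E} {A : E →L[ℝ] E}
    (hξ : HasFDerivAt ξ A x) {h : E → ℝ} (hh : ContDiffAt ℝ ∞ h x)
    (hham : ∀ᶠ y in 𝓝 x, bilin (η y) (ξ y) = fderiv ℝ h y) (v w : E) :
    fderiv ℝ (fun y => bilin (η y)) x (ξ x) v w + bilin (η x) (A v) w + bilin (η x) v (A w)
      = 0 := by
  have hB : DifferentiableAt ℝ (fun y => bilin (η y)) x :=
    differentiableAt_bilin_comp hη
  -- The derivative of `η(ξ, ·) = dh` computes the second derivative of `h`. Its symmetry, the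
  -- cyclic identity and antisymmetry of `η` add up to the claim.
  have h1 := (hB.hasFDerivAt.clm_apply hξ).congr_of_eventuallyEq
    (hham.mono fun y hy => hy.symm)
  have hsym : IsSymmSndFDerivAt ℝ h x := hh.isSymmSndFDerivAt (by
    rw [minSmoothness_of_isRCLikeNormedField]; exact WithTop.coe_le_coe.2 le_top)
  have h2 := hsym v w
  rw [h1.fderiv] at h2
  simp only [add_apply, ContinuousLinearMap.comp_apply,
    ContinuousLinearMap.flip_apply] at h2
  have h3 := fderiv_bilin_cyclic hη hcl (ξ x) v w
  have h4 := bilin_swap (η x) v (A w)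
  linarith

end Bilinear

section Conservation

variable {E : Type*} [NormedAddCommGroup E] [NormedSpace ℝ E] {a b : ℝ}

theorem hasDerivWithinAt_bilin {B : E → E →L[ℝ] E →L[ℝ] ℝ} {B' : E →L[ℝ] E →L[ℝ] E →L[ℝ] ℝ}
    {c u v : ℝ → E} {c' u' v' : E} {s : Set ℝ} {t : ℝ} (hB : HasFDerivAt B B' (c t))
    (hc : HasDerivWithinAt c c' s t) (hu : HasDerivWithinAt u u' s t)
    (hv : HasDerivWithinAt v v' s t) :
    HasDerivWithinAt (fun τ => B (c τ) (u τ) (v τ))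
      (B' c' (u t) (v t) + B (c t) u' (v t) + B (c t) (u t) v') s t := by
  have h1 : HasDerivWithinAt (fun τ => B (c τ)) (B' c') s t :=
    HasFDerivAt.comp_hasDerivWithinAt (E := E →L[ℝ] E →L[ℝ] ℝ) (F := E) (f := c) (l := B) t hB hc
  have h2 := h1.clm_apply hu
  have h3 := h2.clm_apply hv
  exact h3.congr_deriv (by simp)

theorem eq_of_hasDerivWithinAt_zero (hab : a ≤ b) {f : ℝ → ℝ}
    (hf : ∀ t ∈ Icc a b, HasDerivWithinAt f 0 (Icc a b) t) : f b = f a :=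
  constant_of_has_deriv_right_zero (fun t ht => (hf t ht).continuousWithinAt)
    (fun t ht => (hf t (Ico_subset_Icc_self ht)).mono_of_mem_nhdsWithin
      (Icc_mem_nhdsGE_of_mem ht)) b (right_mem_Icc.2 hab)

end Conservation

/-! ### The Hamiltonian vector field in a chart -/

section Chart

variable {E M : Type*} [NormedAddCommGroup E] [NormedSpace ℝ E] [FiniteDimensional ℝ E]
  [TopologicalSpace M] [ChartedSpace E M] [IsManifold 𝓘(ℝ, E) ∞ M]

theorem isManifold_one : IsManifold 𝓘(ℝ, E) 1 M :=
  IsManifold.of_le (n := ∞) (by simp)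

theorem hasMFDerivAt_chart_symm (x₀ : M) {y : E} (hy : y ∈ (extChartAt 𝓘(ℝ, E) x₀).target) :
    HasMFDerivAt 𝓘(ℝ, E) 𝓘(ℝ, E) (extChartAt 𝓘(ℝ, E) x₀).symm y
      (mfderiv 𝓘(ℝ, E) 𝓘(ℝ, E) (extChartAt 𝓘(ℝ, E) x₀).symm y) :=
  (((contMDiffOn_extChartAt_symm (n := ∞) x₀).contMDiffAt
    ((isOpen_extChartAt_target x₀).mem_nhds hy)).mdifferentiableAt (by simp)).hasMFDerivAt

theorem hasMFDerivAt_chart (x₀ : M) {x : M} (hx : x ∈ (extChartAt 𝓘(ℝ, E) x₀).source) :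
    HasMFDerivAt 𝓘(ℝ, E) 𝓘(ℝ, E) (extChartAt 𝓘(ℝ, E) x₀) x
      (mfderiv 𝓘(ℝ, E) 𝓘(ℝ, E) (extChartAt 𝓘(ℝ, E) x₀) x) :=
  ((contMDiffAt_extChartAt' (n := ∞) (by rwa [← extChartAt_source 𝓘(ℝ, E)])).mdifferentiableAt
    (by simp)).hasMFDerivAt

theorem mfderiv_chart_symm_apply (x₀ : M) {y : E} (hy : y ∈ (extChartAt 𝓘(ℝ, E) x₀).target)
    (v : E) :
    (mfderiv 𝓘(ℝ, E) 𝓘(ℝ, E) (extChartAt 𝓘(ℝ, E) x₀) ((extChartAt 𝓘(ℝ, E) x₀).symm y)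
      (mfderiv 𝓘(ℝ, E) 𝓘(ℝ, E) (extChartAt 𝓘(ℝ, E) x₀).symm y v) : E) = v := by
  have : IsManifold 𝓘(ℝ, E) 1 M := isManifold_one
  have := mfderiv_extChartAt_comp_mfderivWithin_extChartAt_symm (I := 𝓘(ℝ, E)) (x := x₀) hy
  simp only [modelWithCornersSelf_coe, range_id, mfderivWithin_univ] at this
  exact DFunLike.congr_fun this v

theorem mfderiv_symm_chart_apply (x₀ : M) {y : E} (hy : y ∈ (extChartAt 𝓘(ℝ, E) x₀).target)
    (v : TangentSpace 𝓘(ℝ, E) ((extChartAt 𝓘(ℝ, E) x₀).symm y)) :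
    (mfderiv 𝓘(ℝ, E) 𝓘(ℝ, E) (extChartAt 𝓘(ℝ, E) x₀).symm y
      (mfderiv 𝓘(ℝ, E) 𝓘(ℝ, E) (extChartAt 𝓘(ℝ, E) x₀) ((extChartAt 𝓘(ℝ, E) x₀).symm y)
        v)) = v := by
  have : IsManifold 𝓘(ℝ, E) 1 M := isManifold_one
  have := mfderivWithin_extChartAt_symm_comp_mfderiv_extChartAt (I := 𝓘(ℝ, E)) (x := x₀) hy
  simp only [modelWithCornersSelf_coe, range_id, mfderivWithin_univ] at this
  exact DFunLike.congr_fun this v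

theorem chartForm_apply (σ : SymplecticForm E M) (x₀ : M) (y v w : E) :
    chartForm σ.form x₀ y ![v, w] = σ.form ((extChartAt 𝓘(ℝ, E) x₀).symm y)
      ![mfderiv 𝓘(ℝ, E) 𝓘(ℝ, E) (extChartAt 𝓘(ℝ, E) x₀).symm y v,
        mfderiv 𝓘(ℝ, E) 𝓘(ℝ, E) (extChartAt 𝓘(ℝ, E) x₀).symm y w] := by
  change σ.form ((extChartAt 𝓘(ℝ, E) x₀).symm y) _ = _
  congr 1
  ext i
  fin_cases i <;> rfl

/-- Every tangent vector is the image of its chart coordinates, so nondegeneracy on the manifold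
passes to the chart. -/
theorem chartForm_injective (σ : SymplecticForm E M) (x₀ : M) {y : E}
    (hy : y ∈ (extChartAt 𝓘(ℝ, E) x₀).target) :
    Function.Injective (bilin (chartForm σ.form x₀ y)) := by
  rw [injective_iff_map_eq_zero]
  intro v hv
  have h0 : mfderiv 𝓘(ℝ, E) 𝓘(ℝ, E) (extChartAt 𝓘(ℝ, E) x₀).symm y v = 0 := by
    apply σ.nondegenerate
    intro w
    let u : E := mfderiv 𝓘(ℝ, E) 𝓘(ℝ, E) (extChartAt 𝓘(ℝ, E) x₀)
      ((extChartAt 𝓘(ℝ, E) x₀).symm y) w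
    have h1 : bilin (chartForm σ.form x₀ y) v u = 0 := by rw [hv]; rfl
    have h2 : mfderiv 𝓘(ℝ, E) 𝓘(ℝ, E) (extChartAt 𝓘(ℝ, E) x₀).symm y u = w :=
      mfderiv_symm_chart_apply x₀ hy w
    rw [bilin_apply, chartForm_apply, h2] at h1
    exact h1
  have := mfderiv_chart_symm_apply x₀ hy v
  rw [h0, map_zero] at this
  exact this.symm

/-- The isomorphism `E ≃ E*` of the symplectic form in a chart. -/
def chartFormEquiv (σ : SymplecticForm E M) (x₀ : M) {y : E}
    (hy : y ∈ (extChartAt 𝓘(ℝ, E) x₀).target) : E ≃L[ℝ] (E →L[ℝ] ℝ) :=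
  (LinearEquiv.ofInjectiveOfFinrankEq
    ((bilin (chartForm σ.form x₀ y) : E →L[ℝ] E →L[ℝ] ℝ) : E →ₗ[ℝ] E →L[ℝ] ℝ)
    (chartForm_injective σ x₀ hy) (by
      rw [← (LinearMap.toContinuousLinearMap : (E →ₗ[ℝ] ℝ) ≃ₗ[ℝ] (E →L[ℝ] ℝ)).finrank_eq]
      exact Subspace.dual_finrank_eq.symm)).toContinuousLinearEquiv

theorem coe_chartFormEquiv (σ : SymplecticForm E M) (x₀ : M) {y : E}
    (hy : y ∈ (extChartAt 𝓘(ℝ, E) x₀).target) :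
    (chartFormEquiv σ x₀ hy : E →L[ℝ] (E →L[ℝ] ℝ)) = bilin (chartForm σ.form x₀ y) := by
  ext v; rfl

/-- The function `H` in the chart around `x₀`. -/
def chartFunction (H : ℝ → M → ℝ) (x₀ : M) (p : ℝ × E) : ℝ :=
  H p.1 ((extChartAt 𝓘(ℝ, E) x₀).symm p.2)

/-- The Hamiltonian vector field in the chart around `x₀`. -/
def chartField (σ : SymplecticForm E M) (H : ℝ → M → ℝ) (x₀ : M) (p : ℝ × E) : E :=
  (bilin (chartForm σ.form x₀ p.2)).inverse (spaceDeriv (chartFunction H x₀) p)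

theorem bilin_chartField (σ : SymplecticForm E M) (H : ℝ → M → ℝ) (x₀ : M) (t : ℝ) {y : E}
    (hy : y ∈ (extChartAt 𝓘(ℝ, E) x₀).target) :
    bilin (chartForm σ.form x₀ y) (chartField σ H x₀ (t, y)) =
      spaceDeriv (chartFunction H x₀) (t, y) := by
  rw [chartField, ← coe_chartFormEquiv σ x₀ hy, ContinuousLinearMap.inverse_equiv]
  exact (chartFormEquiv σ x₀ hy).apply_symm_apply _

variable {T : Set ℝ} {H : ℝ → M → ℝ}

theorem contDiffOn_chartFunction
    (hH : ContMDiffOn (𝓘(ℝ, ℝ).prod 𝓘(ℝ, E)) 𝓘(ℝ, ℝ) ∞ (fun p : ℝ × M => H p.1 p.2)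
      (T ×ˢ univ)) (x₀ : M) :
    ContDiffOn ℝ ∞ (chartFunction H x₀) (T ×ˢ (extChartAt 𝓘(ℝ, E) x₀).target) := by
  have key : ContMDiffOn (𝓘(ℝ, ℝ).prod 𝓘(ℝ, E)) 𝓘(ℝ, ℝ) ∞ (chartFunction H x₀)
      (T ×ˢ (extChartAt 𝓘(ℝ, E) x₀).target) :=
    ContMDiffOn.comp (t := T ×ˢ univ)
      (f := fun p : ℝ × E => (p.1, (extChartAt 𝓘(ℝ, E) x₀).symm p.2)) hH
      (contMDiffOn_fst.prodMk ((contMDiffOn_extChartAt_symm x₀).comp contMDiffOn_snd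
        fun p hp => hp.2)) fun p hp => ⟨hp.1, mem_univ _⟩
  rw [← contMDiffOn_iff_contDiffOn, modelWithCornersSelf_prod, ← chartedSpaceSelf_prod]
  exact key

/-- Operator inversion is smooth at isomorphisms, and in finite dimension the nondegenerate form is
an isomorphism at every point of the chart. -/
theorem contDiffOn_chartField (σ : SymplecticForm E M) (hT : UniqueDiffOn ℝ T)
    (hH : ContMDiffOn (𝓘(ℝ, ℝ).prod 𝓘(ℝ, E)) 𝓘(ℝ, ℝ) ∞ (fun p : ℝ × M => H p.1 p.2)
      (T ×ˢ univ)) (x₀ : M) :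
    ContDiffOn ℝ ∞ (chartField σ H x₀) (T ×ˢ (extChartAt 𝓘(ℝ, E) x₀).target) := by
  have h1 := contDiffOn_spaceDeriv hT (isOpen_extChartAt_target x₀)
    (contDiffOn_chartFunction hH x₀)
  have h2 : ContDiffOn ℝ ∞ (fun p : ℝ × E => bilin (chartForm σ.form x₀ p.2))
      (T ×ˢ (extChartAt 𝓘(ℝ, E) x₀).target) :=
    contDiff_bilin.comp_contDiffOn
      (ContDiffOn.comp (σ.smooth x₀) contDiffOn_snd fun p (hp : p ∈ T ×ˢ _) => hp.2)
  have h3 : ContDiffOn ℝ ∞ (fun p : ℝ × E => (bilin (chartForm σ.form x₀ p.2)).inverse)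
      (T ×ˢ (extChartAt 𝓘(ℝ, E) x₀).target) := by
    intro p hp
    have h4 : ContDiffAt ℝ ∞ ContinuousLinearMap.inverse (bilin (chartForm σ.form x₀ p.2)) := by
      rw [← coe_chartFormEquiv σ x₀ hp.2]
      exact contDiffAt_map_inverse _
    exact h4.comp_contDiffWithinAt p (h2 p hp)
  exact h3.clm_apply h1

/-- The equation `ẋ(t) = X_{H_t}(x(t))`, with the derivative taken within `S`. -/
def IsHamAt (σ : SymplecticForm E M) (H : ℝ → M → ℝ) (S : Set ℝ) (x : ℝ → M) (t : ℝ) : Prop :=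
  ∃ v : TangentSpace 𝓘(ℝ, E) (x t),
    HasMFDerivWithinAt 𝓘(ℝ, ℝ) 𝓘(ℝ, E) x S t
      ((1 : ℝ →L[ℝ] ℝ).smulRight v : ℝ →L[ℝ] TangentSpace 𝓘(ℝ, E) (x t)) ∧
    ∀ w : TangentSpace 𝓘(ℝ, E) (x t),
      σ.form (x t) ![v, w] = (mfderiv 𝓘(ℝ, E) 𝓘(ℝ, ℝ) (H t) (x t) w : ℝ)

theorem isHamChord_iff {σ : SymplecticForm E M} {δ : ℝ} {x : ℝ → M} :
    IsHamChord σ H δ x ↔ ∀ t ∈ Icc 0 δ, IsHamAt σ H (Icc 0 δ) x t := Iff.rfl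

theorem IsHamAt.mono {σ : SymplecticForm E M} {S S' : Set ℝ} {x : ℝ → M} {t : ℝ}
    (h : IsHamAt σ H S x t) (hS : S' ⊆ S) : IsHamAt σ H S' x t := by
  obtain ⟨v, hv, hw⟩ := h
  exact ⟨v, hv.mono hS, hw⟩

theorem IsHamAt.continuousWithinAt {σ : SymplecticForm E M} {S : Set ℝ} {x : ℝ → M} {t : ℝ}
    (h : IsHamAt σ H S x t) : ContinuousWithinAt x S t := by
  obtain ⟨v, hv, -⟩ := h
  exact hv.continuousWithinAt

theorem IsHamAt.congr {σ : SymplecticForm E M} {S : Set ℝ} {x y : ℝ → M} {t : ℝ}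
    (h : IsHamAt σ H S x t) (hy : ∀ s ∈ S, y s = x s) (ht : t ∈ S) : IsHamAt σ H S y t := by
  obtain ⟨v, hv, hw⟩ := h
  have e : y t = x t := hy t ht
  rw [IsHamAt, e]
  refine ⟨v, ?_, hw⟩
  have := hv.congr_of_eventuallyEq (f₁ := y) (eventually_nhdsWithin_of_forall hy) e
  exact this

theorem spaceDeriv_chartFunction {t : ℝ} (x₀ : M) {y : E}
    (hH : MDifferentiableAt 𝓘(ℝ, E) 𝓘(ℝ, ℝ) (H t) ((extChartAt 𝓘(ℝ, E) x₀).symm y))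
    (hy : y ∈ (extChartAt 𝓘(ℝ, E) x₀).target) (w : E) :
    spaceDeriv (chartFunction H x₀) (t, y) w =
      mfderiv 𝓘(ℝ, E) 𝓘(ℝ, ℝ) (H t) ((extChartAt 𝓘(ℝ, E) x₀).symm y)
        (mfderiv 𝓘(ℝ, E) 𝓘(ℝ, E) (extChartAt 𝓘(ℝ, E) x₀).symm y w) := by
  have h := hH.hasMFDerivAt.comp y (hasMFDerivAt_chart_symm x₀ hy)
  have h' := h.mfderiv
  rw [mfderiv_eq_fderiv] at h'
  exact congrArg (fun A : E →L[ℝ] ℝ => A w) h'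

end Chart

end Quilt

end

/-! ### Conservation of the form, and Hamilton's equation in a chart. -/

noncomputable section


namespace Quilt

/-- A closed form is preserved by the linearized Hamiltonian flow along a trajectory. -/
theorem bilin_eq_of_linearized {E : Type*} [NormedAddCommGroup E] [NormedSpace ℝ E] {a b : ℝ}
    (hab : a ≤ b) {η : E → E [⋀^Fin 2]→L[ℝ] ℝ} {Y : ℝ → E → E} {h : ℝ → E → ℝ}
    {A : ℝ → E →L[ℝ] E} {γ u w : ℝ → E}
    (hη : ∀ t ∈ Icc a b, DifferentiableAt ℝ η (γ t))
    (hcl : ∀ t ∈ Icc a b, extDeriv η (γ t) = 0)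
    (hY : ∀ t ∈ Icc a b, HasFDerivAt (Y t) (A t) (γ t))
    (hh : ∀ t ∈ Icc a b, ContDiffAt ℝ ∞ (h t) (γ t))
    (hham : ∀ t ∈ Icc a b, ∀ᶠ y in 𝓝 (γ t), bilin (η y) (Y t y) = fderiv ℝ (h t) y)
    (hγ : ∀ t ∈ Icc a b, HasDerivWithinAt γ (Y t (γ t)) (Icc a b) t)
    (hu : ∀ t ∈ Icc a b, HasDerivWithinAt u (A t (u t)) (Icc a b) t)
    (hw : ∀ t ∈ Icc a b, HasDerivWithinAt w (A t (w t)) (Icc a b) t) :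
    bilin (η (γ b)) (u b) (w b) = bilin (η (γ a)) (u a) (w a) := by
  refine eq_of_hasDerivWithinAt_zero hab (f := fun t => bilin (η (γ t)) (u t) (w t))
    fun t ht => ?_
  have h1 := hasDerivWithinAt_bilin (B := fun y => bilin (η y))
    (differentiableAt_bilin_comp (hη t ht)).hasFDerivAt (hγ t ht) (hu t ht) (hw t ht)
  exact h1.congr_deriv
    (hamiltonian_infinitesimal (hη t ht) (hcl t ht) (hY t ht) (hh t ht) (hham t ht) _ _)

section Chart

variable {E M : Type*} [NormedAddCommGroup E] [NormedSpace ℝ E] [FiniteDimensional ℝ E]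
  [TopologicalSpace M] [ChartedSpace E M] [IsManifold 𝓘(ℝ, E) ∞ M]
  {T : Set ℝ} {H : ℝ → M → ℝ} {σ : SymplecticForm E M}

theorem mdifferentiableAt_slice
    (hH : ContMDiffOn (𝓘(ℝ, ℝ).prod 𝓘(ℝ, E)) 𝓘(ℝ, ℝ) ∞ (fun p : ℝ × M => H p.1 p.2)
      (T ×ˢ univ)) {t : ℝ} (ht : t ∈ T) (m : M) :
    MDifferentiableAt 𝓘(ℝ, E) 𝓘(ℝ, ℝ) (H t) m := by
  have h1 : ContMDiff 𝓘(ℝ, E) 𝓘(ℝ, ℝ) ∞ (H t) := by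
    rw [← contMDiffOn_univ]
    exact hH.comp (f := fun m : M => (t, m)) (contMDiffOn_const.prodMk contMDiffOn_id)
      fun _ _ => ⟨ht, mem_univ _⟩
  exact h1.mdifferentiableAt (by simp)

/-- The chart differential is bijective, so the equation may be tested on chart vectors, where
injectivity of the form singles out `chartField`. -/
theorem form_eq_mfderiv_iff
    (hH : ContMDiffOn (𝓘(ℝ, ℝ).prod 𝓘(ℝ, E)) 𝓘(ℝ, ℝ) ∞ (fun p : ℝ × M => H p.1 p.2)
      (T ×ˢ univ)) {t : ℝ} (ht : t ∈ T) (x₀ : M) {p : M}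
    (hp : p ∈ (extChartAt 𝓘(ℝ, E) x₀).source) (v : TangentSpace 𝓘(ℝ, E) p) :
    (∀ w : TangentSpace 𝓘(ℝ, E) p,
      σ.form p ![v, w] = (mfderiv 𝓘(ℝ, E) 𝓘(ℝ, ℝ) (H t) p w : ℝ)) ↔
    (mfderiv 𝓘(ℝ, E) 𝓘(ℝ, E) (extChartAt 𝓘(ℝ, E) x₀) p v : E) =
      chartField σ H x₀ (t, extChartAt 𝓘(ℝ, E) x₀ p) := by
  obtain ⟨y, hy, rfl⟩ : ∃ y ∈ (extChartAt 𝓘(ℝ, E) x₀).target,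
      p = (extChartAt 𝓘(ℝ, E) x₀).symm y :=
    ⟨_, (extChartAt 𝓘(ℝ, E) x₀).map_source hp, ((extChartAt 𝓘(ℝ, E) x₀).left_inv hp).symm⟩
  rw [(extChartAt 𝓘(ℝ, E) x₀).right_inv hy]
  have hd := mdifferentiableAt_slice hH ht ((extChartAt 𝓘(ℝ, E) x₀).symm y)
  have hinv := mfderiv_symm_chart_apply x₀ hy
  let D : TangentSpace 𝓘(ℝ, E) ((extChartAt 𝓘(ℝ, E) x₀).symm y) → E := fun v =>
    mfderiv 𝓘(ℝ, E) 𝓘(ℝ, E) (extChartAt 𝓘(ℝ, E) x₀) ((extChartAt 𝓘(ℝ, E) x₀).symm y) v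
  have hD : ∀ v, mfderiv 𝓘(ℝ, E) 𝓘(ℝ, E) (extChartAt 𝓘(ℝ, E) x₀).symm y (D v) = v := hinv
  constructor
  · intro h
    apply chartForm_injective σ x₀ hy
    rw [bilin_chartField σ H x₀ t hy]
    ext w
    change bilin (chartForm σ.form x₀ y) (D v) w = _
    rw [bilin_apply, chartForm_apply, hD, h, spaceDeriv_chartFunction x₀ hd hy]
  · intro h w
    have h1 : bilin (chartForm σ.form x₀ y) (D v) (D w) =
        spaceDeriv (chartFunction H x₀) (t, y) (D w) := by
      rw [← bilin_chartField σ H x₀ t hy, ← h]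
      rfl
    rwa [bilin_apply, chartForm_apply, hD, hD, spaceDeriv_chartFunction x₀ hd hy, hD] at h1

theorem hasDerivWithinAt_of_hasMFDerivWithinAt {f : ℝ → E} {f' : ℝ →L[ℝ] E} {S : Set ℝ} {t : ℝ}
    (h : HasMFDerivWithinAt 𝓘(ℝ, ℝ) 𝓘(ℝ, E) f S t f') : HasDerivWithinAt f (f' 1) S t := by
  have h' : HasFDerivWithinAt f f' S t := hasMFDerivWithinAt_iff_hasFDerivWithinAt.1 h
  exact h'.hasDerivWithinAt

/-- Continuity stands as a separate clause because the derivative of the chart expression alone does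
not force `x` to stay in the chart domain, where the inverse chart recovers it. -/
theorem isHamAt_iff_chart
    (hH : ContMDiffOn (𝓘(ℝ, ℝ).prod 𝓘(ℝ, E)) 𝓘(ℝ, ℝ) ∞ (fun p : ℝ × M => H p.1 p.2)
      (T ×ˢ univ)) {t : ℝ} (ht : t ∈ T) (x₀ : M) {x : ℝ → M} {S : Set ℝ}
    (hx : x t ∈ (extChartAt 𝓘(ℝ, E) x₀).source) :
    IsHamAt σ H S x t ↔ ContinuousWithinAt x S t ∧
      HasDerivWithinAt (fun s => extChartAt 𝓘(ℝ, E) x₀ (x s))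
        (chartField σ H x₀ (t, extChartAt 𝓘(ℝ, E) x₀ (x t))) S t := by
  constructor
  · rintro ⟨v, hv, hw⟩
    refine ⟨hv.continuousWithinAt, ?_⟩
    rw [form_eq_mfderiv_iff hH ht x₀ hx] at hw
    have h1 := (hasMFDerivAt_chart x₀ hx).comp_hasMFDerivWithinAt t hv
    have h2 := hasDerivWithinAt_of_hasMFDerivWithinAt h1
    rw [← hw]
    refine h2.congr_deriv ?_
    change (mfderiv 𝓘(ℝ, E) 𝓘(ℝ, E) (extChartAt 𝓘(ℝ, E) x₀) (x t) ((1 : ℝ) • v) : E) = _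
    rw [one_smul]
  · rintro ⟨hc, hd⟩
    have hy := (extChartAt 𝓘(ℝ, E) x₀).map_source hx
    have e := (extChartAt 𝓘(ℝ, E) x₀).left_inv hx
    set ξ := chartField σ H x₀ (t, extChartAt 𝓘(ℝ, E) x₀ (x t)) with hξ
    have h1 : HasMFDerivWithinAt 𝓘(ℝ, ℝ) 𝓘(ℝ, E) (fun s => extChartAt 𝓘(ℝ, E) x₀ (x s)) S t
        ((1 : ℝ →L[ℝ] ℝ).smulRight ξ) :=
      hasMFDerivWithinAt_iff_hasFDerivWithinAt.2 hd.hasFDerivWithinAt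
    have h2 := (hasMFDerivAt_chart_symm x₀ hy).comp_hasMFDerivWithinAt t h1
    have hev : x =ᶠ[𝓝[S] t] (extChartAt 𝓘(ℝ, E) x₀).symm ∘ fun s => extChartAt 𝓘(ℝ, E) x₀ (x s) := by
      filter_upwards [hc ((isOpen_extChartAt_source x₀).mem_nhds hx)] with s hs
      exact ((extChartAt 𝓘(ℝ, E) x₀).left_inv hs).symm
    have h3 := h2.congr_of_eventuallyEq hev e.symm
    refine ⟨(mfderiv 𝓘(ℝ, E) 𝓘(ℝ, E) (extChartAt 𝓘(ℝ, E) x₀).symm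
      (extChartAt 𝓘(ℝ, E) x₀ (x t)) ξ : E), ?_, ?_⟩
    · refine h3.congr_mfderiv (ContinuousLinearMap.ext fun s => ?_)
      symm
      change (id s : ℝ) • (mfderiv 𝓘(ℝ, E) 𝓘(ℝ, E) (extChartAt 𝓘(ℝ, E) x₀).symm
        (extChartAt 𝓘(ℝ, E) x₀ (x t)) ξ : E) = mfderiv 𝓘(ℝ, E) 𝓘(ℝ, E)
          (extChartAt 𝓘(ℝ, E) x₀).symm (extChartAt 𝓘(ℝ, E) x₀ (x t)) ((id s : ℝ) • ξ)
      exact (map_smul _ (id s : ℝ) _).symm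
    · refine (form_eq_mfderiv_iff hH ht x₀ hx _).2 ?_
      have := mfderiv_chart_symm_apply x₀ hy ξ
      rwa [e] at this

/-! ### Uniqueness of Hamiltonian chords -/

/-- In the chart around the common point both curves solve an ODE with a locally Lipschitz field, so
uniqueness for ODEs applies as long as both stay in the Lipschitz region. -/
theorem eventually_eq_of_isHamAt {δ : ℝ} (hδ : 0 < δ)
    (hH : ContMDiffOn (𝓘(ℝ, ℝ).prod 𝓘(ℝ, E)) 𝓘(ℝ, ℝ) ∞ (fun p : ℝ × M => H p.1 p.2)
      (Icc 0 δ ×ˢ univ)) {x y : ℝ → M} (hx : ∀ t ∈ Icc 0 δ, IsHamAt σ H (Icc 0 δ) x t)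
    (hy : ∀ t ∈ Icc 0 δ, IsHamAt σ H (Icc 0 δ) y t) {s : ℝ} (hs : s ∈ Icc 0 δ)
    (hxy : x s = y s) : ∀ᶠ t in 𝓝[Icc 0 δ] s, x t = y t := by
  set φ := extChartAt 𝓘(ℝ, E) (x s) with hφ
  have hsrc : x s ∈ φ.source := mem_extChartAt_source (x s)
  have hX := contDiffOn_chartField σ (uniqueDiffOn_Icc hδ) hH (x s)
  obtain ⟨r, hr, hball⟩ := Metric.isOpen_iff.1 (isOpen_extChartAt_target (I := 𝓘(ℝ, E)) (x s))
    (φ (x s)) (φ.map_source hsrc)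
  have hX' : ContDiffWithinAt ℝ 1 (chartField σ H (x s)) (Icc 0 δ ×ˢ Metric.ball (φ (x s)) r)
      (s, φ (x s)) :=
    ((hX.mono (prod_mono subset_rfl hball)) _ ⟨hs, Metric.mem_ball_self hr⟩).of_le (by simp)
  -- The chart target was replaced by a ball because the Lipschitz bound needs a convex set.
  obtain ⟨K, W, hW, hK⟩ := hX'.exists_lipschitzOnWith
    ((convex_Icc 0 δ).prod (convex_ball _ _))
  rw [nhdsWithin_prod_eq, (Metric.isOpen_ball.nhdsWithin_eq (Metric.mem_ball_self hr))] at hW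
  obtain ⟨P, hP, Q, hQ, hPQ⟩ := Filter.mem_prod_iff.1 hW
  have hcont : ∀ z : ℝ → M, z s = x s → (∀ t ∈ Icc 0 δ, IsHamAt σ H (Icc 0 δ) z t) →
      ∀ᶠ t in 𝓝[Icc 0 δ] s, z t ∈ φ.source ∧ φ (z t) ∈ Q := by
    intro z hz hzH
    have h1 := (hzH s hs).continuousWithinAt
    refine h1.eventually (p := fun m => m ∈ φ.source ∧ φ m ∈ Q) ?_
    rw [hz]
    exact Filter.Eventually.and ((isOpen_extChartAt_source (x s)).mem_nhds hsrc)
      ((continuousAt_extChartAt (I := 𝓘(ℝ, E)) (x s)).preimage_mem_nhds hQ)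
  have hall : ∀ᶠ t in 𝓝[Icc 0 δ] s, (x t ∈ φ.source ∧ φ (x t) ∈ Q) ∧
      (y t ∈ φ.source ∧ φ (y t) ∈ Q) ∧ t ∈ P :=
    (hcont x rfl hx).and ((hcont y hxy.symm hy).and hP)
  obtain ⟨ε, hε, hgood⟩ := Metric.mem_nhdsWithin_iff.1 hall
  have hgood' : ∀ t ∈ Icc 0 δ, dist t s < ε → (x t ∈ φ.source ∧ φ (x t) ∈ Q) ∧
      (y t ∈ φ.source ∧ φ (y t) ∈ Q) ∧ t ∈ P := fun t ht hts => hgood ⟨hts, ht⟩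
  have hlip : ∀ t ∈ P, LipschitzOnWith K (fun z => chartField σ H (x s) (t, z)) Q := by
    intro t ht z hz w hw
    have := hK (hPQ (show (t, z) ∈ P ×ˢ Q from ⟨ht, hz⟩))
      (hPQ (show (t, w) ∈ P ×ˢ Q from ⟨ht, hw⟩))
    rwa [Prod.edist_eq, edist_self, max_eq_right zero_le] at this
  rw [Filter.eventually_iff, Metric.mem_nhdsWithin_iff]
  refine ⟨ε, hε, fun t ⟨hts, ht⟩ => ?_⟩
  rw [Metric.mem_ball, Real.dist_eq] at hts
  suffices φ (x t) = φ (y t) from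
    φ.injOn (hgood' t ht hts).1.1 (hgood' t ht hts).2.1.1 this
  have hder : ∀ z : ℝ → M, (∀ t ∈ Icc 0 δ, IsHamAt σ H (Icc 0 δ) z t) → ∀ t ∈ Icc 0 δ,
      z t ∈ φ.source → HasDerivWithinAt (fun u => φ (z u))
        (chartField σ H (x s) (t, φ (z t))) (Icc 0 δ) t := fun z hz t ht hzt =>
    ((isHamAt_iff_chart hH ht (x s) hzt).1 (hz t ht)).2
  -- Since `s` may be an end of the time interval, uniqueness is applied separately forward and
  -- backward from `s`.
  rcases le_total s t with hst | hst
  · have hsub : ∀ u ∈ Icc s t, u ∈ Icc 0 δ ∧ dist u s < ε := fun u hu => by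
      refine ⟨⟨hs.1.trans hu.1, hu.2.trans ht.2⟩, ?_⟩
      rw [Real.dist_eq, abs_of_nonneg (by linarith [hu.1])]
      rw [abs_of_nonneg (by linarith)] at hts
      linarith [hu.2]
    have hnhds : ∀ u ∈ Ico s t, Icc 0 δ ∈ 𝓝[Ici u] u := fun u hu =>
      Icc_mem_nhdsGE_of_mem ⟨hs.1.trans hu.1, hu.2.trans_le ht.2⟩
    refine ODE_solution_unique_of_mem_Icc_right (K := K) (s := fun _ => Q)
      (v := fun t z => chartField σ H (x s) (t, z)) (f := fun u => φ (x u))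
      (g := fun u => φ (y u)) (a := s) (b := t) (fun u hu => ?_) (fun u hu => ?_)
      (fun u hu => ?_) (fun u hu => ?_) (fun u hu => ?_) (fun u hu => ?_) (fun u hu => ?_)
      (by rw [hxy]) (right_mem_Icc.2 hst)
    · have := hsub u (Ico_subset_Icc_self hu)
      exact hlip u (hgood' u this.1 this.2).2.2
    · have := hsub u hu
      exact ((hder x hx u this.1 (hgood' u this.1 this.2).1.1).continuousWithinAt).mono
        fun w hw => (hsub w hw).1
    · have := hsub u (Ico_subset_Icc_self hu)
      exact (hder x hx u this.1 (hgood' u this.1 this.2).1.1).mono_of_mem_nhdsWithin (hnhds u hu)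
    · have := hsub u (Ico_subset_Icc_self hu)
      exact (hgood' u this.1 this.2).1.2
    · have := hsub u hu
      exact ((hder y hy u this.1 (hgood' u this.1 this.2).2.1.1).continuousWithinAt).mono
        fun w hw => (hsub w hw).1
    · have := hsub u (Ico_subset_Icc_self hu)
      exact (hder y hy u this.1 (hgood' u this.1 this.2).2.1.1).mono_of_mem_nhdsWithin (hnhds u hu)
    · have := hsub u (Ico_subset_Icc_self hu)
      exact (hgood' u this.1 this.2).2.1.2
  · have hsub : ∀ u ∈ Icc t s, u ∈ Icc 0 δ ∧ dist u s < ε := fun u hu => by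
      refine ⟨⟨ht.1.trans hu.1, hu.2.trans hs.2⟩, ?_⟩
      rw [Real.dist_eq, abs_of_nonpos (by linarith [hu.2])]
      rw [abs_of_nonpos (by linarith)] at hts
      linarith [hu.1]
    have hnhds : ∀ u ∈ Ioc t s, Icc 0 δ ∈ 𝓝[Iic u] u := fun u hu =>
      Icc_mem_nhdsLE_of_mem ⟨ht.1.trans_lt hu.1, hu.2.trans hs.2⟩
    refine ODE_solution_unique_of_mem_Icc_left (K := K) (s := fun _ => Q)
      (v := fun t z => chartField σ H (x s) (t, z)) (f := fun u => φ (x u))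
      (g := fun u => φ (y u)) (a := t) (b := s) (fun u hu => ?_) (fun u hu => ?_)
      (fun u hu => ?_) (fun u hu => ?_) (fun u hu => ?_) (fun u hu => ?_) (fun u hu => ?_)
      (by rw [hxy]) (left_mem_Icc.2 hst)
    · have := hsub u (Ioc_subset_Icc_self hu)
      exact hlip u (hgood' u this.1 this.2).2.2
    · have := hsub u hu
      exact ((hder x hx u this.1 (hgood' u this.1 this.2).1.1).continuousWithinAt).mono
        fun w hw => (hsub w hw).1
    · have := hsub u (Ioc_subset_Icc_self hu)
      exact (hder x hx u this.1 (hgood' u this.1 this.2).1.1).mono_of_mem_nhdsWithin (hnhds u hu)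
    · have := hsub u (Ioc_subset_Icc_self hu)
      exact (hgood' u this.1 this.2).1.2
    · have := hsub u hu
      exact ((hder y hy u this.1 (hgood' u this.1 this.2).2.1.1).continuousWithinAt).mono
        fun w hw => (hsub w hw).1
    · have := hsub u (Ioc_subset_Icc_self hu)
      exact (hder y hy u this.1 (hgood' u this.1 this.2).2.1.1).mono_of_mem_nhdsWithin (hnhds u hu)
    · have := hsub u (Ioc_subset_Icc_self hu)
      exact (hgood' u this.1 this.2).2.1.2

/-- Hamiltonian chords which agree at one time agree at all times. -/
theorem IsHamChord.eqOn [T2Space M] {δ : ℝ} (hδ : 0 < δ)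
    (hH : ContMDiffOn (𝓘(ℝ, ℝ).prod 𝓘(ℝ, E)) 𝓘(ℝ, ℝ) ∞ (fun p : ℝ × M => H p.1 p.2)
      (Icc 0 δ ×ˢ univ)) {x y : ℝ → M} (hx : IsHamChord σ H δ x) (hy : IsHamChord σ H δ y)
    {s : ℝ} (hs : s ∈ Icc 0 δ) (hxy : x s = y s) : EqOn x y (Icc 0 δ) := by
  have hcont : ∀ z : ℝ → M, IsHamChord σ H δ z → Continuous fun t : Icc 0 δ => z t := by
    intro z hz
    exact continuousOn_iff_continuous_domRestrict.1
      fun t ht => IsHamAt.continuousWithinAt (isHamChord_iff.1 hz t ht)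
  have hpre : PreconnectedSpace (Icc 0 δ) := Subtype.preconnectedSpace isPreconnected_Icc
  -- The agreement set is closed by the Hausdorff property, open by local uniqueness, and contains
  -- `s`; connectedness of the interval finishes.
  have hclosed : IsClosed {t : Icc 0 δ | x t = y t} := isClosed_eq (hcont x hx) (hcont y hy)
  have hopen : IsOpen {t : Icc 0 δ | x t = y t} := by
    rw [isOpen_iff_mem_nhds]
    intro t ht
    have h1 := eventually_eq_of_isHamAt hδ hH hx hy t.2 ht
    rw [nhdsWithin_eq_map_subtype_coe t.2] at h1
    exact h1
  have := IsClopen.eq_univ ⟨hclosed, hopen⟩ ⟨⟨s, hs⟩, hxy⟩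
  intro t ht
  have h : (⟨t, ht⟩ : Icc 0 δ) ∈ {t : Icc 0 δ | x t = y t} := this ▸ mem_univ _
  exact h

end Chart

end Quilt

end

noncomputable section


namespace Quilt

section LocalFlow

variable {E M : Type*} [NormedAddCommGroup E] [NormedSpace ℝ E] [FiniteDimensional ℝ E]
  [TopologicalSpace M] [ChartedSpace E M] [IsManifold 𝓘(ℝ, E) ∞ M]
  {H : ℝ → M → ℝ} {σ : SymplecticForm E M}

/-! ### Flows near a given Hamiltonian chord -/

/-- Near `x a` the Hamiltonian flow exists on `[a,b]`, with time-`b` map smooth and symplectic at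
`x a`, and `x` as the trajectory of `x a`. -/
def HasLocalFlow (σ : SymplecticForm E M) (H : ℝ → M → ℝ) (x : ℝ → M) (a b : ℝ) : Prop :=
  ∃ Φ : M → ℝ → M,
    (∀ᶠ m in 𝓝 (x a), Φ m a = m ∧ ∀ t ∈ Icc a b, IsHamAt σ H (Icc a b) (Φ m) t) ∧
    Φ (x a) b = x b ∧ ContMDiffAt 𝓘(ℝ, E) 𝓘(ℝ, E) ∞ (fun m => Φ m b) (x a) ∧
    ∀ v w : TangentSpace 𝓘(ℝ, E) (x a), σ.form (Φ (x a) b)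
      ![mfderiv 𝓘(ℝ, E) 𝓘(ℝ, E) (fun m => Φ m b) (x a) v,
        mfderiv 𝓘(ℝ, E) 𝓘(ℝ, E) (fun m => Φ m b) (x a) w] = σ.form (x a) ![v, w]

/-- A smooth time-dependent vector field on an open subset of `E` agrees near a given point with a
global one. -/
theorem exists_global_field {T : Set ℝ} {U : Set E} (hU : IsOpen U) {X : ℝ × E → E}
    (hX : ContDiffOn ℝ ∞ X (T ×ˢ U)) {y : E} (hy : y ∈ U) :
    ∃ (Y : ℝ × E → E) (r : ℝ), 0 < r ∧ Metric.ball y r ⊆ U ∧ ContDiffOn ℝ ∞ Y (T ×ˢ univ) ∧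
      ∀ t, ∀ z ∈ Metric.ball y r, Y (t, z) = X (t, z) := by
  obtain ⟨R, hR, hball⟩ := Metric.nhds_basis_closedBall.mem_iff.1 (hU.mem_nhds hy)
  -- The cutoff is one on the ball of radius `R / 2` and zero off the closed ball of radius `R`
  -- inside `U`, so values of `X` outside `U` do not matter.
  let f : ContDiffBump y := ⟨R / 2, R, half_pos hR, half_lt_self hR⟩
  refine ⟨fun p => f p.2 • X p, R / 2, half_pos hR,
    (Metric.ball_subset_ball (half_le_self hR.le)).trans (Metric.ball_subset_closedBall.trans hball),
    ?_, fun t z hz => ?_⟩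
  · rintro p ⟨hp, -⟩
    by_cases hpU : p.2 ∈ U
    · have h1 : ContDiffWithinAt ℝ ∞ (fun p : ℝ × E => f p.2 • X p) (T ×ˢ U) p :=
        ((f.contDiff.comp contDiff_snd).contDiffWithinAt).smul (hX p ⟨hp, hpU⟩)
      refine h1.mono_of_mem_nhdsWithin ?_
      filter_upwards [self_mem_nhdsWithin, mem_nhdsWithin_of_mem_nhds
        ((hU.preimage continuous_snd).mem_nhds hpU)] with q hq hq'
      exact ⟨hq.1, hq'⟩
    · have h1 : (fun p : ℝ × E => f p.2 • X p) =ᶠ[𝓝 p] fun _ => 0 := by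
        have hc : p.2 ∉ Metric.closedBall y R := fun h => hpU (hball h)
        filter_upwards [(Metric.isClosed_closedBall.isOpen_compl.preimage
          continuous_snd).mem_nhds hc] with q hq
        have : f q.2 = 0 := f.zero_of_le_dist (by
          have : ¬ dist q.2 y ≤ R := hq
          exact (not_le.1 this).le)
        simp [this]
      exact (contDiffAt_const.congr_of_eventuallyEq h1).contDiffWithinAt
  · have : f z = 1 := f.one_of_mem_closedBall (Metric.ball_subset_closedBall hz)
    simp [this]

theorem mfderiv_symm_chart_apply' (x₀ : M) {p : M}
    (hp : p ∈ (extChartAt 𝓘(ℝ, E) x₀).source) (v : TangentSpace 𝓘(ℝ, E) p) :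
    (mfderiv 𝓘(ℝ, E) 𝓘(ℝ, E) (extChartAt 𝓘(ℝ, E) x₀).symm (extChartAt 𝓘(ℝ, E) x₀ p)
      (mfderiv 𝓘(ℝ, E) 𝓘(ℝ, E) (extChartAt 𝓘(ℝ, E) x₀) p v) : E) = v := by
  obtain ⟨y, hy, rfl⟩ : ∃ y ∈ (extChartAt 𝓘(ℝ, E) x₀).target,
      p = (extChartAt 𝓘(ℝ, E) x₀).symm y :=
    ⟨_, (extChartAt 𝓘(ℝ, E) x₀).map_source hp, ((extChartAt 𝓘(ℝ, E) x₀).left_inv hp).symm⟩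
  rw [(extChartAt 𝓘(ℝ, E) x₀).right_inv hy]
  exact mfderiv_symm_chart_apply x₀ hy v

/-- Near the chord the chart field agrees with a global one, to which `exists_smooth_solutions`
applies on short intervals. The radius depends on `s` only and the interval need not contain `s`, so
that a subdivision of `[0,δ]` can be covered. -/
theorem exists_hasLocalFlow {δ : ℝ} (hδ : 0 < δ)
    (hH : ContMDiffOn (𝓘(ℝ, ℝ).prod 𝓘(ℝ, E)) 𝓘(ℝ, ℝ) ∞ (fun p : ℝ × M => H p.1 p.2)
      (Icc 0 δ ×ˢ univ)) {x : ℝ → M} (hx : IsHamChord σ H δ x) {s : ℝ} (hs : s ∈ Icc 0 δ) :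
    ∃ ε > 0, ∀ a b, a ≤ b → a ∈ Icc 0 δ → b ∈ Icc 0 δ → dist a s < ε → dist b s < ε →
      HasLocalFlow σ H x a b := by
  set φ := extChartAt 𝓘(ℝ, E) (x s) with hφ
  have hsrc : x s ∈ φ.source := mem_extChartAt_source (x s)
  have hU : IsOpen φ.target := isOpen_extChartAt_target (x s)
  have hX := contDiffOn_chartField σ (uniqueDiffOn_Icc hδ) hH (x s)
  obtain ⟨Y, r, hr, hrU, hY, hYX⟩ := exists_global_field hU hX (φ.map_source hsrc)
  have hY' := contDiffOn_spaceDeriv (uniqueDiffOn_Icc hδ) isOpen_univ hY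
  have hxc : ContinuousWithinAt x (Icc 0 δ) s :=
    IsHamAt.continuousWithinAt (isHamChord_iff.1 hx s hs)
  have hφc : ContinuousAt φ (x s) := continuousAt_extChartAt (x s)
  have hφx : ContinuousWithinAt (fun t => φ (x t)) (Icc 0 δ) s :=
    hφc.comp_continuousWithinAt hxc
  -- The summand 1 makes the bound strict at `s`, hence valid nearby, and keeps `C` positive.
  set C := ‖spaceDeriv Y (s, φ (x s))‖ + 1 with hC
  have hCpos : 0 < C := by positivity
  have hA : ContinuousWithinAt (fun t => ‖spaceDeriv Y (t, φ (x t))‖) (Icc 0 δ) s := by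
    have h1 := (hY'.continuousOn (s, φ (x s)) ⟨hs, mem_univ _⟩)
    have h2 : ContinuousWithinAt (fun t => (t, φ (x t))) (Icc 0 δ) s :=
      continuousWithinAt_id.prodMk hφx
    exact (ContinuousWithinAt.comp (f := fun t => (t, φ (x t))) h1 h2
      fun t ht => ⟨ht, mem_univ _⟩).norm
  have hev : ∀ᶠ t in 𝓝[Icc 0 δ] s, x t ∈ φ.source ∧ φ (x t) ∈ Metric.ball (φ (x s)) r ∧
      ‖spaceDeriv Y (t, φ (x t))‖ < C := by
    refine Filter.Eventually.and (hxc ((isOpen_extChartAt_source (x s)).mem_nhds hsrc))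
      (Filter.Eventually.and (hφx (Metric.ball_mem_nhds _ hr)) (hA.eventually_lt_const ?_))
    exact lt_add_one _
  obtain ⟨ε₀, hε₀, hgood⟩ := Metric.mem_nhdsWithin_iff.1 hev
  -- Two points within `1 / (4 * C)` of `s` satisfy `(b - a) * C < 1 / 2`, which leaves room for the
  -- contraction.
  refine ⟨min ε₀ (1 / (4 * C)), by positivity, fun a b hab ha hb has hbs => ?_⟩
  have habT : Icc a b ⊆ Icc 0 δ := Icc_subset_Icc ha.1 hb.2
  have hgood' : ∀ t ∈ Icc a b, x t ∈ φ.source ∧ φ (x t) ∈ Metric.ball (φ (x s)) r ∧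
      ‖spaceDeriv Y (t, φ (x t))‖ < C := by
    intro t ht
    refine hgood ⟨?_, habT ht⟩
    have h1 := has.trans_le (min_le_left _ _)
    have h2 := hbs.trans_le (min_le_left _ _)
    rw [Real.dist_eq, abs_lt] at h1 h2
    rw [Metric.mem_ball, Real.dist_eq, abs_lt]
    constructor <;> linarith [ht.1, ht.2]
  have hsmall : (b - a) * C < 1 := by
    have h1 := has.trans_le (min_le_right _ _)
    have h2 := hbs.trans_le (min_le_right _ _)
    rw [Real.dist_eq, abs_lt] at h1 h2
    have h3 : b - a < 2 * (1 / (4 * C)) := by linarith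
    have h4 : 2 * (1 / (4 * C)) * C = 1 / 2 := by field_simp; norm_num
    nlinarith
  have hchord : ∀ t ∈ Icc a b, ContinuousWithinAt x (Icc a b) t ∧
      HasDerivWithinAt (fun u => φ (x u)) (Y (t, φ (x t))) (Icc a b) t := by
    intro t ht
    have h1 := (isHamAt_iff_chart hH (habT ht) (x s) (hgood' t ht).1).1
      ((isHamChord_iff.1 hx t (habT ht)).mono habT)
    rwa [← hYX t _ (hgood' t ht).2.1] at h1
  let γ₀ : C(Icc a b, E) := ⟨fun t => φ (x t), continuousOn_iff_continuous_domRestrict.1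
    fun t ht => (hchord t ht).2.continuousWithinAt⟩
  have hγ₀ : ∀ t : Icc a b, γ₀ t = φ (x t) := fun _ => rfl
  have hγ₀' : ∀ t : Icc a b, HasDerivWithinAt (IccExtend hab γ₀) (Y (t, γ₀ t)) (Icc a b) t :=
    fun t => (hchord t t.2).2.congr (fun u hu => by rw [IccExtend_of_mem hab _ hu]; rfl)
      (by rw [IccExtend_val]; rfl)
  obtain ⟨Γ, hΓ₀, hΓ, hΓev, hΓlin⟩ := exists_smooth_solutions (uniqueDiffOn_Icc hδ) hab habT hY
    hγ₀' (fun t => (hgood' t t.2).2.2.le) hsmall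
  set pa : Icc a b := ⟨a, left_mem_Icc.2 hab⟩ with hpa
  set pb : Icc a b := ⟨b, right_mem_Icc.2 hab⟩ with hpb
  have haa := hgood' a pa.2
  have hbb := hgood' b pb.2
  have hφca : ContMDiffAt 𝓘(ℝ, E) 𝓘(ℝ, E) ∞ φ (x a) :=
    contMDiffAt_extChartAt' (by rw [← extChartAt_source 𝓘(ℝ, E)]; exact haa.1)
  have hγ₀a : γ₀ pa = φ (x a) := rfl
  rw [hγ₀a] at hΓ₀ hΓ hΓev hΓlin
  refine ⟨fun m t => φ.symm (IccExtend hab (Γ (φ m)) t), ?_, ?_, ?_, ?_⟩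
  -- Nearby solutions stay, uniformly in time, in the ball where the global field is still the
  -- Hamiltonian one.
  · have hin : ∀ᶠ γ in 𝓝 γ₀, ∀ t, γ t ∈ Metric.ball (φ (x s)) r := by
      have := (ContinuousMap.isOpen_setOfPred_mapsTo (X := Icc a b) isCompact_univ
        (Metric.isOpen_ball (x := φ (x s)) (ε := r))).mem_nhds
        (x := γ₀) (fun t _ => (hgood' t t.2).2.1)
      filter_upwards [this] with γ hγ t using hγ (mem_univ t)
    have hin' : ∀ᶠ m in 𝓝 (x a), ∀ t, Γ (φ m) t ∈ Metric.ball (φ (x s)) r := by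
      have h1 : ContinuousAt (fun m => Γ (φ m)) (x a) :=
        ContinuousAt.comp (g := Γ) hΓ.continuousAt hφca.continuousAt
      rw [← hΓ₀] at hin
      exact h1.eventually hin
    filter_upwards [hin', hφca.continuousAt.eventually hΓev,
      (isOpen_extChartAt_source (x s)).mem_nhds haa.1] with m hm hm' hmsrc
    refine ⟨?_, fun t ht => ?_⟩
    · rw [IccExtend_of_mem hab _ pa.2, hm'.1]
      exact φ.left_inv hmsrc
    · have hball : ∀ u, IccExtend hab (Γ (φ m)) u ∈ Metric.ball (φ (x s)) r := fun u => hm _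
      have hinv : ∀ u, φ (φ.symm (IccExtend hab (Γ (φ m)) u)) = IccExtend hab (Γ (φ m)) u :=
        fun u => φ.right_inv (hrU (hball u))
      have hmem : φ.symm (IccExtend hab (Γ (φ m)) t) ∈ φ.source :=
        φ.map_target (hrU (hball t))
      refine (isHamAt_iff_chart hH (habT ht) (x s) hmem).2 ⟨?_, ?_⟩
      · refine ContinuousAt.comp_continuousWithinAt (g := φ.symm) ?_
          ((Γ (φ m)).continuous.Icc_extend' (h := hab)).continuousWithinAt
        exact (continuousOn_extChartAt_symm (x s)).continuousAt (hU.mem_nhds (hrU (hball t)))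
      · have h1 := hm'.2 ⟨t, ht⟩
        simp only [← hφ, hinv]
        rw [← hYX t _ (hball t), IccExtend_of_mem hab _ ht]
        exact h1
  · change φ.symm (IccExtend hab (Γ (φ (x a))) b) = x b
    rw [hΓ₀, IccExtend_of_mem hab _ pb.2]
    exact φ.left_inv hbb.1
  · have h1 : ContMDiffAt 𝓘(ℝ, E) 𝓘(ℝ, E) ∞ (fun y => Γ y pb) (φ (x a)) :=
      ((ContinuousMap.evalCLM ℝ pb).contDiff.contDiffAt.comp _ hΓ).contMDiffAt
    have h2 : ContMDiffAt 𝓘(ℝ, E) 𝓘(ℝ, E) ∞ φ.symm (Γ (φ (x a)) pb) := by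
      rw [hΓ₀]
      exact (contMDiffOn_extChartAt_symm (x s)).contMDiffAt
        (hU.mem_nhds (φ.map_source hbb.1))
    have h3 := h2.comp (x a) (h1.comp (x a) hφca)
    refine h3.congr_of_eventuallyEq (Filter.Eventually.of_forall fun m => ?_)
    change φ.symm (IccExtend hab (Γ (φ m)) b) = φ.symm (Γ (φ m) pb)
    rw [IccExtend_of_mem hab _ pb.2]
  · have e : (fun m => φ.symm (IccExtend hab (Γ (φ m)) b)) =
        φ.symm ∘ (fun y => Γ y pb) ∘ φ := by
      ext m
      change φ.symm (IccExtend hab (Γ (φ m)) b) = φ.symm (Γ (φ m) pb)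
      rw [IccExtend_of_mem hab _ pb.2]
    have eb : Γ (φ (x a)) pb = φ (x b) := by rw [hΓ₀]; rfl
    have htb : Γ (φ (x a)) pb ∈ φ.target := eb ▸ φ.map_source hbb.1
    have hd : HasFDerivAt (fun y => Γ y pb)
        ((ContinuousMap.evalCLM ℝ pb).comp (fderiv ℝ Γ (φ (x a)))) (φ (x a)) :=
      HasFDerivAt.comp (F := C(Icc a b, E)) (g := fun γ => γ pb) _
        (ContinuousLinearMap.hasFDerivAt (𝕜 := ℝ) (E := C(Icc a b, E)) (F := E)
          (f := ContinuousMap.evalCLM ℝ pb)) (hΓ.differentiableAt (by simp)).hasFDerivAt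
    have hcomp := (hasMFDerivAt_chart_symm (x s) htb).comp (x a)
      ((hasMFDerivAt_iff_hasFDerivAt.2 hd).comp (x a) (hasMFDerivAt_chart (x s) haa.1))
    intro v w
    let D : TangentSpace 𝓘(ℝ, E) (x a) → E := fun v =>
      mfderiv 𝓘(ℝ, E) 𝓘(ℝ, E) φ (x a) v
    have hmf : ∀ v, (mfderiv 𝓘(ℝ, E) 𝓘(ℝ, E)
        (fun m => φ.symm (IccExtend hab (Γ (φ m)) b)) (x a) v : E) =
        mfderiv 𝓘(ℝ, E) 𝓘(ℝ, E) φ.symm (Γ (φ (x a)) pb) (fderiv ℝ Γ (φ (x a)) (D v) pb) := by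
      intro v
      rw [e, hcomp.mfderiv]
      rfl
    have hpt : φ.symm (IccExtend hab (Γ (φ (x a))) b) = φ.symm (Γ (φ (x a)) pb) := by
      rw [IccExtend_of_mem hab _ pb.2]
    -- Conservation of the chart form along the two variations `D v` and `D w`; the ends `a` and `b`
    -- are then translated back to the manifold.
    have key : bilin (chartForm σ.form (x s) (IccExtend hab γ₀ b))
        (IccExtend hab (fderiv ℝ Γ (φ (x a)) (D v)) b)
        (IccExtend hab (fderiv ℝ Γ (φ (x a)) (D w)) b) =
        bilin (chartForm σ.form (x s) (IccExtend hab γ₀ a))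
        (IccExtend hab (fderiv ℝ Γ (φ (x a)) (D v)) a)
        (IccExtend hab (fderiv ℝ Γ (φ (x a)) (D w)) a) := by
      have hval : ∀ (γ : C(Icc a b, E)) (t : ℝ) (ht : t ∈ Icc a b),
          IccExtend hab γ t = γ ⟨t, ht⟩ := fun γ t ht => IccExtend_of_mem hab _ ht
      have hmem : ∀ t ∈ Icc a b, IccExtend hab γ₀ t ∈ Metric.ball (φ (x s)) r := fun t ht => by
        rw [hval _ t ht]; exact (hgood' t ht).2.1
      refine bilin_eq_of_linearized hab (η := chartForm σ.form (x s)) (Y := fun t y => Y (t, y))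
        (h := fun t y => chartFunction H (x s) (t, y))
        (A := fun t => spaceDeriv Y (t, IccExtend hab γ₀ t)) (fun t ht => ?_) (fun t ht => ?_)
        (fun t ht => ?_) (fun t ht => ?_) (fun t ht => ?_) (fun t ht => ?_) (fun t ht => ?_)
        (fun t ht => ?_)
      · exact ((σ.smooth (x s)).contDiffAt (hU.mem_nhds (hrU (hmem t ht)))).differentiableAt
          (by simp)
      · exact σ.closed (x s) _ (hrU (hmem t ht))
      · exact hasFDerivAt_spaceDeriv isOpen_univ hY (habT ht) (mem_univ _)
      · have h1 : ContDiffOn ℝ ∞ (fun y => chartFunction H (x s) (t, y)) φ.target :=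
          (contDiffOn_chartFunction hH (x s)).comp (f := fun y => (t, y))
            (contDiff_prodMk_right t).contDiffOn fun y hy => ⟨habT ht, hy⟩
        exact h1.contDiffAt (hU.mem_nhds (hrU (hmem t ht)))
      · filter_upwards [Metric.isOpen_ball.mem_nhds (hmem t ht)] with y hy
        rw [hYX t y hy]
        exact bilin_chartField σ H (x s) t (hrU hy)
      · have := hγ₀' ⟨t, ht⟩
        rwa [← hval γ₀ t ht] at this
      · have := (hΓlin (D v)).2 ⟨t, ht⟩
        rwa [← hval γ₀ t ht, ← hval _ t ht] at this
      · have := (hΓlin (D w)).2 ⟨t, ht⟩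
        rwa [← hval γ₀ t ht, ← hval _ t ht] at this
    have ea : ∀ γ : C(Icc a b, E), IccExtend hab γ a = γ pa := fun γ =>
      IccExtend_of_mem hab _ pa.2
    have eb' : ∀ γ : C(Icc a b, E), IccExtend hab γ b = γ pb := fun γ =>
      IccExtend_of_mem hab _ pb.2
    rw [ea, ea, ea, eb', eb', eb', (hΓlin (D v)).1, (hΓlin (D w)).1, bilin_apply, bilin_apply,
      chartForm_apply, chartForm_apply] at key
    let S : M → E → E → ℝ := fun p v w => σ.form p ![v, w]
    change S (φ.symm (IccExtend hab (Γ (φ (x a))) b)) _ _ = S (x a) v w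
    change S (φ.symm (γ₀ pb)) _ _ = S (φ.symm (φ (x a))) _ _ at key
    rw [hmf, hmf, hpt, hΓ₀, key, φ.left_inv haa.1]
    congr 1
    · exact mfderiv_symm_chart_apply' (x s) haa.1 v
    · exact mfderiv_symm_chart_apply' (x s) haa.1 w

end LocalFlow

end Quilt

end

/-! ### Gluing trajectories and composing local flows along a chord. -/

noncomputable section


namespace Quilt

section Flow

variable {E M : Type*} [NormedAddCommGroup E] [NormedSpace ℝ E] [FiniteDimensional ℝ E]
  [TopologicalSpace M] [ChartedSpace E M] [IsManifold 𝓘(ℝ, E) ∞ M]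
  {H : ℝ → M → ℝ} {σ : SymplecticForm E M} {x : ℝ → M} {a b c δ : ℝ}

theorem form_sub_left (η : E [⋀^Fin 2]→L[ℝ] ℝ) (v v' w : E) :
    η ![v - v', w] = η ![v, w] - η ![v', w] := by
  rw [← bilin_apply, ← bilin_apply, ← bilin_apply, map_sub]
  rfl

theorem form_neg_left (η : E [⋀^Fin 2]→L[ℝ] ℝ) (v w : E) : η ![-v, w] = -η ![v, w] := by
  rw [← bilin_apply, ← bilin_apply, map_neg]
  rfl

theorem IsHamAt.mono_of_mem {S S' : Set ℝ} {t : ℝ} (h : IsHamAt σ H S x t)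
    (hS : S ∈ 𝓝[S'] t) : IsHamAt σ H S' x t := by
  obtain ⟨v, hv, hw⟩ := h
  exact ⟨v, hv.mono_of_mem_nhdsWithin hS, hw⟩

/-- Both velocities solve the same equation `σ(v, ·) = dH`, so nondegeneracy identifies them and the
two derivatives fit together. -/
theorem IsHamAt.union {S S' : Set ℝ} {t : ℝ} (h : IsHamAt σ H S x t)
    (h' : IsHamAt σ H S' x t) : IsHamAt σ H (S ∪ S') x t := by
  obtain ⟨v, hv, hw⟩ := h
  obtain ⟨v', hv', hw'⟩ := h'
  have e : v = v' := by
    rw [← sub_eq_zero]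
    refine σ.nondegenerate _ _ fun w => ?_
    refine (form_sub_left (E := E) (σ.form (x t)) v v' w).trans (sub_eq_zero.2 ?_)
    exact (hw w).trans (hw' w).symm
  subst e
  exact ⟨v, hv.union hv', hw⟩

/-- Trajectories on adjacent intervals are glued. -/
theorem isHamAt_glue (hab : a ≤ b) (hbc : b ≤ c) {y z : ℝ → M}
    (hy : ∀ t ∈ Icc a b, IsHamAt σ H (Icc a b) y t)
    (hz : ∀ t ∈ Icc b c, IsHamAt σ H (Icc b c) z t) (hyz : y b = z b) :
    ∀ t ∈ Icc a c, IsHamAt σ H (Icc a c) (fun t => if t ≤ b then y t else z t) t := by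
  have h1 : ∀ t ∈ Icc a b, IsHamAt σ H (Icc a b) (fun t => if t ≤ b then y t else z t) t :=
    fun t ht => (hy t ht).congr (fun s hs => if_pos hs.2) ht
  have h2 : ∀ t ∈ Icc b c, IsHamAt σ H (Icc b c) (fun t => if t ≤ b then y t else z t) t :=
    fun t ht => (hz t ht).congr (fun s hs => by
      rcases hs.1.eq_or_lt with rfl | h
      · simpa using hyz
      · exact if_neg (not_le.2 h)) ht
  intro t ht
  rcases lt_trichotomy t b with h | rfl | h
  · refine (h1 t ⟨ht.1, h.le⟩).mono_of_mem ?_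
    filter_upwards [self_mem_nhdsWithin, mem_nhdsWithin_of_mem_nhds (Iio_mem_nhds h)]
      with s hs hs' using ⟨hs.1, le_of_lt hs'⟩
  · rw [← Icc_union_Icc_eq_Icc hab hbc]
    exact (h1 t ⟨hab, le_rfl⟩).union (h2 t ⟨le_rfl, hbc⟩)
  · refine (h2 t ⟨h.le, ht.2⟩).mono_of_mem ?_
    filter_upwards [self_mem_nhdsWithin, mem_nhdsWithin_of_mem_nhds (Ioi_mem_nhds h)]
      with s hs hs' using ⟨le_of_lt hs', hs.2⟩

/-- A nearby point follows `Φ` until time `b` and `Ψ` afterwards. The time-`c` map is then, near `x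
a`, a composition of smooth symplectic maps. -/
theorem HasLocalFlow.trans (hab : a ≤ b) (hbc : b ≤ c) (h₁ : HasLocalFlow σ H x a b)
    (h₂ : HasLocalFlow σ H x b c) : HasLocalFlow σ H x a c := by
  obtain ⟨Φ, hΦ, hΦb, hΦs, hΦσ⟩ := h₁
  obtain ⟨Ψ, hΨ, hΨc, hΨs, hΨσ⟩ := h₂
  have hΨ' : ∀ᶠ m in 𝓝 (x a), Ψ (Φ m b) b = Φ m b ∧
      ∀ t ∈ Icc b c, IsHamAt σ H (Icc b c) (Ψ (Φ m b)) t := by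
    rw [← hΦb] at hΨ
    exact hΦs.continuousAt.eventually hΨ
  -- The conditional matters only when `c = b`, where the first branch is taken and `Ψ` starts at `Φ
  -- m b`.
  have hend : ∀ᶠ m in 𝓝 (x a), (if c ≤ b then Φ m c else Ψ (Φ m b) c) = Ψ (Φ m b) c := by
    filter_upwards [hΨ'] with m hm
    split_ifs with h
    · obtain rfl := le_antisymm h hbc
      exact hm.1.symm
    · rfl
  have hΨs' : ContMDiffAt 𝓘(ℝ, E) 𝓘(ℝ, E) ∞ (fun m => Ψ m c) (Φ (x a) b) := by rwa [hΦb]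
  refine ⟨fun m t => if t ≤ b then Φ m t else Ψ (Φ m b) t, ?_, ?_, ?_, ?_⟩
  · filter_upwards [hΦ, hΨ'] with m hm hm'
    refine ⟨by simp only [if_pos hab]; exact hm.1, ?_⟩
    exact isHamAt_glue hab hbc hm.2 hm'.2 hm'.1.symm
  · refine hend.self_of_nhds.trans ?_
    rw [hΦb, hΨc]
  · exact ContMDiffAt.congr_of_eventuallyEq
      (f := (fun m => Ψ m c) ∘ fun m => Φ m b) (hΨs'.comp (x a) hΦs) hend
  · intro (v : E) (w : E)
    let S : M → E → E → ℝ := fun p v w => σ.form p ![v, w]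
    let D : (M → M) → M → E → E := fun f p v => mfderiv 𝓘(ℝ, E) 𝓘(ℝ, E) f p v
    have h1 : ∀ u : E, D (fun m => if c ≤ b then Φ m c else Ψ (Φ m b) c) (x a) u =
        D (fun m => Ψ m c) (Φ (x a) b) (D (fun m => Φ m b) (x a) u) := fun u => by
      have h2 := Filter.EventuallyEq.mfderiv_eq (I := 𝓘(ℝ, E)) (I' := 𝓘(ℝ, E))
        (show (fun m => if c ≤ b then Φ m c else Ψ (Φ m b) c) =ᶠ[𝓝 (x a)]
          (fun m => Ψ m c) ∘ fun m => Φ m b from hend)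
      have h3 := mfderiv_comp (I := 𝓘(ℝ, E)) (I' := 𝓘(ℝ, E)) (I'' := 𝓘(ℝ, E)) (x a)
        (hΨs'.mdifferentiableAt (by simp)) (hΦs.mdifferentiableAt (by simp))
      exact congrArg (fun A : E →L[ℝ] E => A u) (h2.trans h3)
    change S (if c ≤ b then Φ (x a) c else Ψ (Φ (x a) b) c)
      (D (fun m => if c ≤ b then Φ m c else Ψ (Φ m b) c) (x a) v)
      (D (fun m => if c ≤ b then Φ m c else Ψ (Φ m b) c) (x a) w) = S (x a) v w
    rw [hend.self_of_nhds, h1, h1, hΦb]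
    have h5 := hΨσ (mfderiv 𝓘(ℝ, E) 𝓘(ℝ, E) (fun m => Φ m b) (x a) v : E)
      (mfderiv 𝓘(ℝ, E) 𝓘(ℝ, E) (fun m => Φ m b) (x a) w : E)
    refine Eq.trans h5 ?_
    have h6 := hΦσ v w
    rw [hΦb] at h6
    exact h6

/-- The Hamiltonian flow exists near the starting point of a Hamiltonian chord. -/
theorem IsHamChord.hasLocalFlow (hδ : 0 < δ)
    (hH : ContMDiffOn (𝓘(ℝ, ℝ).prod 𝓘(ℝ, E)) 𝓘(ℝ, ℝ) ∞ (fun p : ℝ × M => H p.1 p.2)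
      (Icc 0 δ ×ˢ univ)) (hx : IsHamChord σ H δ x) : HasLocalFlow σ H x 0 δ := by
  choose! ε hε hflow using fun s (hs : s ∈ Icc 0 δ) => exists_hasLocalFlow hδ hH hx hs
  -- Compactness gives a subdivision whose pieces each lie in one of the neighbourhoods with local
  -- flows; these are composed by induction.
  obtain ⟨t, ht0, htm, ⟨n, hn⟩, htc⟩ := exists_monotone_Icc_subset_open_cover_Icc hδ.le
    (c := fun s : Icc 0 δ => {u : Icc 0 δ | dist (u : ℝ) s < ε s})
    (fun s => isOpen_lt (by fun_prop) continuous_const)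
    (fun u _ => mem_iUnion.2 ⟨u, by simpa using hε u u.2⟩)
  have h0 : (0 : ℝ) ∈ Icc 0 δ := left_mem_Icc.2 hδ.le
  have key : ∀ n, HasLocalFlow σ H x 0 (t n) := by
    intro n
    induction n with
    | zero =>
      rw [ht0]
      exact hflow 0 h0 0 0 le_rfl h0 h0 (by simpa using hε 0 h0) (by simpa using hε 0 h0)
    | succ n ih =>
      obtain ⟨s, hs⟩ := htc n
      have hle : t n ≤ t (n + 1) := htm n.le_succ
      exact ih.trans (t n).2.1 hle (hflow s s.2 _ _ hle (t n).2 (t (n + 1)).2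
        (hs (left_mem_Icc.2 hle)) (hs (right_mem_Icc.2 hle)))
  have := key n
  rwa [hn n le_rfl] at this

/-! ### The time-`δ` map -/

section FlowMap

variable [T2Space M]

/-- `flowMap` is evaluated on a chosen chord; uniqueness makes the choice irrelevant. -/
theorem IsHamChord.flowMap_eq (hδ : 0 < δ)
    (hH : ContMDiffOn (𝓘(ℝ, ℝ).prod 𝓘(ℝ, E)) 𝓘(ℝ, ℝ) ∞ (fun p : ℝ × M => H p.1 p.2)
      (Icc 0 δ ×ˢ univ)) (hx : IsHamChord σ H δ x) : flowMap σ H δ (x 0) = x δ := by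
  have h : FlowDefinedAt σ H δ (x 0) := ⟨x, hx, rfl⟩
  rw [flowMap, dif_pos h]
  exact h.choose_spec.1.eqOn hδ hH hx (left_mem_Icc.2 hδ.le) h.choose_spec.2
    (right_mem_Icc.2 hδ.le)

/-- Existence of the flow is a clause of its own because `flowMap` has the identity as default value
elsewhere. -/
theorem mem_flowGraph_iff (hδ : 0 < δ)
    (hH : ContMDiffOn (𝓘(ℝ, ℝ).prod 𝓘(ℝ, E)) 𝓘(ℝ, ℝ) ∞ (fun p : ℝ × M => H p.1 p.2)
      (Icc 0 δ ×ˢ univ)) {p : M × M} :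
    p ∈ flowGraph σ H δ ↔ FlowDefinedAt σ H δ p.1 ∧ flowMap σ H δ p.1 = p.2 := by
  constructor
  · rintro ⟨x, hx, h0, h1⟩
    refine ⟨⟨x, hx, h0⟩, ?_⟩
    rw [← h0, hx.flowMap_eq hδ hH, h1]
  · rintro ⟨⟨x, hx, h0⟩, h1⟩
    exact ⟨x, hx, h0, by rw [← h1, ← h0, hx.flowMap_eq hδ hH]⟩

/-- By uniqueness of chords `flowMap` agrees near `m` with the time-`δ` map of the local flow, and
inherits smoothness and symplecticity from it. -/
theorem FlowDefinedAt.local (hδ : 0 < δ)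
    (hH : ContMDiffOn (𝓘(ℝ, ℝ).prod 𝓘(ℝ, E)) 𝓘(ℝ, ℝ) ∞ (fun p : ℝ × M => H p.1 p.2)
      (Icc 0 δ ×ˢ univ)) {m : M} (hm : FlowDefinedAt σ H δ m) :
    (∀ᶠ m' in 𝓝 m, FlowDefinedAt σ H δ m') ∧
      ContMDiffAt 𝓘(ℝ, E) 𝓘(ℝ, E) ∞ (flowMap σ H δ) m ∧
      ∀ v w : TangentSpace 𝓘(ℝ, E) m, σ.form (flowMap σ H δ m)
        ![mfderiv 𝓘(ℝ, E) 𝓘(ℝ, E) (flowMap σ H δ) m v,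
          mfderiv 𝓘(ℝ, E) 𝓘(ℝ, E) (flowMap σ H δ) m w] = σ.form m ![v, w] := by
  obtain ⟨x, hx, rfl⟩ := hm
  obtain ⟨Φ, hΦ, hΦδ, hΦs, hΦσ⟩ := hx.hasLocalFlow hδ hH
  have hev : flowMap σ H δ =ᶠ[𝓝 (x 0)] fun m => Φ m δ := by
    filter_upwards [hΦ] with m hm
    have := IsHamChord.flowMap_eq hδ hH (isHamChord_iff.2 hm.2)
    rwa [hm.1] at this
  refine ⟨hΦ.mono fun m hm => ⟨Φ m, hm.2, hm.1⟩, hΦs.congr_of_eventuallyEq hev, ?_⟩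
  rw [hev.mfderiv_eq, hev.eq_of_nhds]
  exact hΦσ

theorem isOpen_flowDefinedAt (hδ : 0 < δ)
    (hH : ContMDiffOn (𝓘(ℝ, ℝ).prod 𝓘(ℝ, E)) 𝓘(ℝ, ℝ) ∞ (fun p : ℝ × M => H p.1 p.2)
      (Icc 0 δ ×ˢ univ)) : IsOpen {m | FlowDefinedAt σ H δ m} :=
  isOpen_iff_mem_nhds.2 fun _ hm => (FlowDefinedAt.local hδ hH hm).1

/-! ### Reversal of time -/

/-- The Hamiltonian function generating the time-reversed flow. -/
def reverse (δ : ℝ) (H : ℝ → M → ℝ) (t : ℝ) (m : M) : ℝ := -H (δ - t) m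

theorem contMDiffOn_reverse
    (hH : ContMDiffOn (𝓘(ℝ, ℝ).prod 𝓘(ℝ, E)) 𝓘(ℝ, ℝ) ∞ (fun p : ℝ × M => H p.1 p.2)
      (Icc 0 δ ×ˢ univ)) :
    ContMDiffOn (𝓘(ℝ, ℝ).prod 𝓘(ℝ, E)) 𝓘(ℝ, ℝ) ∞ (fun p : ℝ × M => reverse δ H p.1 p.2)
      (Icc 0 δ ×ˢ univ) := by
  have h1 : ContMDiff 𝓘(ℝ, ℝ) 𝓘(ℝ, ℝ) ∞ (fun t : ℝ => δ - t) :=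
    (contDiff_const.sub contDiff_id).contMDiff
  have h2 : ContMDiffOn (𝓘(ℝ, ℝ).prod 𝓘(ℝ, E)) (𝓘(ℝ, ℝ).prod 𝓘(ℝ, E)) ∞
      (fun p : ℝ × M => (δ - p.1, p.2)) (Icc 0 δ ×ˢ univ) :=
    ((h1.comp contMDiff_fst).prodMk contMDiff_snd).contMDiffOn
  exact (contDiff_neg.contMDiff (n := ∞)).comp_contMDiffOn (hH.comp h2 fun p hp =>
    ⟨⟨by linarith [hp.1.2], by linarith [hp.1.1]⟩, mem_univ _⟩)

/-- Reversing time negates the velocity, which the sign in the reversed Hamiltonian compensates. -/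
theorem IsHamChord.reverse (hx : IsHamChord σ H δ x) :
    IsHamChord σ (reverse δ H) δ fun t => x (δ - t) := by
  intro t ht
  have ht' : δ - t ∈ Icc 0 δ := ⟨by linarith [ht.2], by linarith [ht.1]⟩
  obtain ⟨v, hv, hw⟩ := hx (δ - t) ht'
  refine ⟨-v, ?_, fun w => ?_⟩
  · have h1 : HasMFDerivWithinAt 𝓘(ℝ, ℝ) 𝓘(ℝ, ℝ) (fun t : ℝ => δ - t) (Icc 0 δ) t
        ((1 : ℝ →L[ℝ] ℝ).smulRight (-1 : ℝ)) :=
      hasMFDerivWithinAt_iff_hasFDerivWithinAt.2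
        (((hasDerivAt_id t).const_sub δ).hasDerivWithinAt.hasFDerivWithinAt)
    have h2 := HasMFDerivWithinAt.comp (f := fun t : ℝ => δ - t) (g := x) t hv h1
      (fun s hs => ⟨by linarith [hs.2], by linarith [hs.1]⟩)
    refine h2.congr_mfderiv (ContinuousLinearMap.ext fun s => ?_)
    change ((id s : ℝ) • (-1 : ℝ)) • v = (id s : ℝ) • (-v)
    simp
  · have h1 : (mfderiv 𝓘(ℝ, E) 𝓘(ℝ, ℝ) (Quilt.reverse δ H t) (x (δ - t)) w : ℝ) =
        -(mfderiv 𝓘(ℝ, E) 𝓘(ℝ, ℝ) (H (δ - t)) (x (δ - t)) w : ℝ) := by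
      have : mfderiv 𝓘(ℝ, E) 𝓘(ℝ, ℝ) (-(H (δ - t))) (x (δ - t)) =
        -mfderiv 𝓘(ℝ, E) 𝓘(ℝ, ℝ) (H (δ - t)) (x (δ - t)) := mfderiv_neg
      exact DFunLike.congr_fun this w
    rw [h1, ← hw w]
    exact form_neg_left (E := E) (σ.form (x (δ - t))) v w

theorem reverse_reverse : Quilt.reverse δ (Quilt.reverse δ H) = H := by
  funext t m
  simp [Quilt.reverse]

/-- The reversed flow is defined at the values of the flow and inverts it. -/
theorem FlowDefinedAt.reverse (hδ : 0 < δ)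
    (hH : ContMDiffOn (𝓘(ℝ, ℝ).prod 𝓘(ℝ, E)) 𝓘(ℝ, ℝ) ∞ (fun p : ℝ × M => H p.1 p.2)
      (Icc 0 δ ×ˢ univ)) {m : M} (hm : FlowDefinedAt σ H δ m) :
    FlowDefinedAt σ (Quilt.reverse δ H) δ (flowMap σ H δ m) ∧
      flowMap σ (Quilt.reverse δ H) δ (flowMap σ H δ m) = m := by
  obtain ⟨x, hx, rfl⟩ := hm
  rw [hx.flowMap_eq hδ hH]
  have h1 := hx.reverse
  refine ⟨⟨_, h1, by simp⟩, ?_⟩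
  have h2 := h1.flowMap_eq hδ (contMDiffOn_reverse hH)
  simpa using h2

end FlowMap

end Flow

end Quilt

end

noncomputable section


namespace Quilt

/-! ### Transport of submanifolds and tangent spaces by diffeomorphisms -/

section Transport

variable {F B N F' B' N' : Type*} [NormedAddCommGroup F] [NormedSpace ℝ F] [TopologicalSpace B]
  [TopologicalSpace N] [ChartedSpace B N] [NormedAddCommGroup F'] [NormedSpace ℝ F']
  [TopologicalSpace B'] [TopologicalSpace N'] [ChartedSpace B' N']
  {I : ModelWithCorners ℝ F B} {I' : ModelWithCorners ℝ F' B'}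

/-- `P` is a diffeomorphism of the open set `D` onto the open set `D'`, with inverse `Q`. -/
structure IsDiffeoOn (I : ModelWithCorners ℝ F B) (I' : ModelWithCorners ℝ F' B') (P : N → N')
    (Q : N' → N) (D : Set N) (D' : Set N') : Prop where
  open_source : IsOpen D
  open_target : IsOpen D'
  mapsTo : ∀ p ∈ D, P p ∈ D'
  mapsTo_symm : ∀ p ∈ D', Q p ∈ D
  left_inv : ∀ p ∈ D, Q (P p) = p
  right_inv : ∀ p ∈ D', P (Q p) = p
  smooth : ∀ p ∈ D, ContMDiffAt I I' ∞ P p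
  smooth_symm : ∀ p ∈ D', ContMDiffAt I' I ∞ Q p

namespace IsDiffeoOn

variable {P : N → N'} {Q : N' → N} {D : Set N} {D' : Set N'}

theorem symm (h : IsDiffeoOn I I' P Q D D') : IsDiffeoOn I' I Q P D' D :=
  ⟨h.open_target, h.open_source, h.mapsTo_symm, h.mapsTo, h.right_inv, h.left_inv,
    h.smooth_symm, h.smooth⟩

theorem mdifferentiableAt (h : IsDiffeoOn I I' P Q D D') {p : N} (hp : p ∈ D) :
    MDifferentiableAt I I' P p :=
  (h.smooth p hp).mdifferentiableAt (by simp)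

theorem mfderiv_symm_apply (h : IsDiffeoOn I I' P Q D D') {p : N} (hp : p ∈ D)
    (v : TangentSpace I p) :
    (mfderiv I' I Q (P p) (mfderiv I I' P p v) : F) = v := by
  have h1 := mfderiv_comp p (h.symm.mdifferentiableAt (h.mapsTo p hp)) (h.mdifferentiableAt hp)
  have h2 : Q ∘ P =ᶠ[𝓝 p] id := by
    filter_upwards [h.open_source.mem_nhds hp] with x hx using h.left_inv x hx
  have h3 := (h2.mfderiv_eq (I := I) (I' := I)).symm.trans h1
  rw [mfderiv_id] at h3
  exact (congrArg (fun A : F →L[ℝ] F => A v) h3).symm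

theorem mfderiv_apply_symm (h : IsDiffeoOn I I' P Q D D') {p : N} (hp : p ∈ D)
    (w : TangentSpace I' (P p)) : mfderiv I I' P p (mfderiv I' I Q (P p) w : F) = w := by
  have h1 := h.symm.mfderiv_symm_apply (h.mapsTo p hp) w
  rwa [h.left_inv p hp] at h1

theorem mfderiv_injective (h : IsDiffeoOn I I' P Q D D') {p : N} (hp : p ∈ D) :
    Function.Injective (mfderiv I I' P p) := by
  intro v w hvw
  have h1 := h.mfderiv_symm_apply hp v
  rw [hvw] at h1
  exact h1.symm.trans (h.mfderiv_symm_apply hp w)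

end IsDiffeoOn

theorem mfderiv_comp_curve {P : N → N'} {γ : ℝ → N} {p : N} (hp : γ 0 = p)
    (hP : MDifferentiableAt I I' P p) (hγ : MDifferentiableAt 𝓘(ℝ, ℝ) I γ 0) :
    (mfderiv 𝓘(ℝ, ℝ) I' (P ∘ γ) 0 (1 : ℝ) : F') =
      mfderiv I I' P p (mfderiv 𝓘(ℝ, ℝ) I γ 0 (1 : ℝ) : F) := by
  subst hp
  rw [mfderiv_comp 0 hP hγ]
  rfl

/-- A smooth map carries curves to curves. As only germs of curves matter, it need respect the sets
only near `p`. -/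
theorem mem_tangentSet_map {S : Set N} {S' : Set N'} {U : Set N} {P : N → N'} {p : N}
    (hU : IsOpen U) (hp : p ∈ U) (hP : ContMDiffAt I I' ∞ P p)
    (hmap : ∀ x ∈ S, x ∈ U → P x ∈ S') {v : TangentSpace I p} (hv : v ∈ tangentSet I S p) :
    mfderiv I I' P p v ∈ tangentSet I' S' (P p) := by
  obtain ⟨γ, h0, hγ, hγv, hS⟩ := hv
  have hP' : ContMDiffAt I I' ∞ P (γ 0) := by rwa [h0]
  refine ⟨P ∘ γ, by simp [h0], hP'.comp 0 hγ, ?_, ?_⟩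
  · rw [mfderiv_comp_curve h0 (hP.mdifferentiableAt (by simp))
      (hγ.mdifferentiableAt (by simp)), hγv]
  · have : ∀ᶠ t in 𝓝 (0 : ℝ), γ t ∈ U :=
      hγ.continuousAt.eventually_mem (hU.mem_nhds (by rwa [h0]))
    filter_upwards [hS, this] with t h1 h2 using hmap _ h1 h2

/-- The image of a submanifold under a diffeomorphism. -/
theorem IsDiffeoOn.isSubmanifold_image {P : N → N'} {Q : N' → N} {D : Set N} {D' : Set N'}
    (hPQ : IsDiffeoOn I I' P Q D D') {S : Set N} (hS : S ⊆ D) {d : ℕ}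
    (hSd : IsSubmanifold I d S) : IsSubmanifold I' d (P '' S) := by
  rintro _ ⟨p, hp, rfl⟩
  obtain ⟨U, V, g, h, hU, hV, hpV, hgU, hg, hg', hh, hgh⟩ := hSd p hp
  have hgS : ∀ u ∈ U, g u ∈ S ∩ V := fun u hu => hgU ▸ mem_image_of_mem g hu
  have hQc : ContinuousOn Q D' := fun y hy =>
    (hPQ.smooth_symm y hy).continuousAt.continuousWithinAt
  refine ⟨U, D' ∩ Q ⁻¹' V, P ∘ g, h ∘ Q, hU, hQc.isOpen_inter_preimage hPQ.open_target hV,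
    ⟨hPQ.mapsTo p (hS hp), by rw [mem_preimage, hPQ.left_inv p (hS hp)]; exact hpV⟩, ?_, ?_, ?_,
    ?_, ?_⟩
  · rw [image_comp, hgU]
    ext y
    constructor
    · rintro ⟨x, ⟨hx, hxV⟩, rfl⟩
      exact ⟨⟨x, hx, rfl⟩, hPQ.mapsTo x (hS hx),
        by rw [mem_preimage, hPQ.left_inv x (hS hx)]; exact hxV⟩
    · rintro ⟨⟨x, hx, rfl⟩, -, hxV⟩
      rw [mem_preimage, hPQ.left_inv x (hS hx)] at hxV
      exact ⟨x, ⟨hx, hxV⟩, rfl⟩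
  · intro u hu
    exact ((hPQ.smooth _ (hS (hgS u hu).1)).comp_contMDiffWithinAt u (hg u hu))
  · intro u hu
    have hgu := (hg.contMDiffAt (hU.mem_nhds hu)).mdifferentiableAt (by simp)
    rw [mfderiv_comp u (hPQ.mdifferentiableAt (hS (hgS u hu).1)) hgu]
    exact (hPQ.mfderiv_injective (hS (hgS u hu).1)).comp (hg' u hu)
  · refine hh.comp (hQc.mono fun y hy => hy.2.1) ?_
    rintro y ⟨⟨x, hx, rfl⟩, -, hxV⟩
    rw [mem_preimage, hPQ.left_inv x (hS hx)] at hxV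
    rw [hPQ.left_inv x (hS hx)]
    exact ⟨hx, hxV⟩
  · intro u hu
    simp only [Function.comp_apply]
    rw [hPQ.left_inv _ (hS (hgS u hu).1)]
    exact hgh hu

end Transport

section PiTransport

variable {ι : Type*} [Finite ι] {F B N : ι → Type*} [∀ i, NormedAddCommGroup (F i)]
  [∀ i, NormedSpace ℝ (F i)] [∀ i, TopologicalSpace (B i)] [∀ i, TopologicalSpace (N i)]
  [∀ i, ChartedSpace (B i) (N i)] {I : ∀ i, ModelWithCorners ℝ (F i) (B i)}

theorem mem_piTangentSet_map {S S' : Set (∀ i, N i)} {U : ∀ i, Set (N i)}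
    {P : ∀ i, N i → N i} {q : ∀ i, N i} (hU : ∀ i, IsOpen (U i)) (hq : ∀ i, q i ∈ U i)
    (hP : ∀ i, ContMDiffAt (I i) (I i) ∞ (P i) (q i))
    (hmap : ∀ x ∈ S, (∀ i, x i ∈ U i) → (fun i => P i (x i)) ∈ S')
    {v : ∀ i, TangentSpace (I i) (q i)} (hv : v ∈ piTangentSet I S q) :
    (fun i => mfderiv (I i) (I i) (P i) (q i) (v i)) ∈
      piTangentSet I S' fun i => P i (q i) := by
  obtain ⟨γ, h0, hγ, hγv, hS⟩ := hv
  have h0' : ∀ i, γ 0 i = q i := fun i => congrFun h0 i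
  refine ⟨fun t i => P i (γ t i), by simp [h0], fun i => ?_, fun i => ?_, ?_⟩
  · have hP' : ContMDiffAt (I i) (I i) ∞ (P i) (γ 0 i) := by rw [h0']; exact hP i
    exact hP'.comp (f := fun t => γ t i) 0 (hγ i)
  · have := mfderiv_comp_curve (γ := fun t => γ t i) (h0' i) ((hP i).mdifferentiableAt (by simp))
      ((hγ i).mdifferentiableAt (by simp))
    rw [hγv] at this
    exact this
  · have : ∀ᶠ t in 𝓝 (0 : ℝ), ∀ i, γ t i ∈ U i := Filter.eventually_all.2 fun i =>
      (hγ i).continuousAt.eventually_mem ((hU i).mem_nhds (by rw [h0']; exact hq i))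
    filter_upwards [hS, this] with t h1 h2 using hmap _ h1 h2

end PiTransport

/-! ### Perturbation of fiber products -/

section Perturb

variable {r : ℕ} {E M : ZMod (r + 1) → Type*} [∀ j, NormedAddCommGroup (E j)]
  [∀ j, NormedSpace ℝ (E j)] [∀ j, TopologicalSpace (M j)] [∀ j, ChartedSpace (E j) (M j)]
  [∀ j, IsManifold 𝓘(ℝ, E j) ∞ (M j)]
  {φ ψ : ∀ i, M i → M i} {D D' : ∀ i, Set (M i)}
  {L : ∀ k, Set (M k × M (k + 1))} {Γ : ∀ i, Set (M i × M i)}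

theorem isDiffeoOn_slot (hφ : ∀ i, IsDiffeoOn 𝓘(ℝ, E i) 𝓘(ℝ, E i) (φ i) (ψ i) (D i) (D' i))
    (k : ZMod (r + 1)) :
    IsDiffeoOn (𝓘(ℝ, E k).prod 𝓘(ℝ, E (k + 1))) (𝓘(ℝ, E k).prod 𝓘(ℝ, E (k + 1)))
      (Prod.map (id : M k → M k) (φ (k + 1))) (Prod.map id (ψ (k + 1)))
      (univ ×ˢ D (k + 1)) (univ ×ˢ D' (k + 1)) where
  open_source := isOpen_univ.prod (hφ _).open_source
  open_target := isOpen_univ.prod (hφ _).open_target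
  mapsTo _ hp := ⟨mem_univ _, (hφ _).mapsTo _ hp.2⟩
  mapsTo_symm _ hp := ⟨mem_univ _, (hφ _).mapsTo_symm _ hp.2⟩
  left_inv _ hp := Prod.ext rfl ((hφ _).left_inv _ hp.2)
  right_inv _ hp := Prod.ext rfl ((hφ _).right_inv _ hp.2)
  smooth _ hp := contMDiffAt_id.prodMap ((hφ _).smooth _ hp.2)
  smooth_symm _ hp := contMDiffAt_id.prodMap ((hφ _).smooth_symm _ hp.2)

/-- `q ↦ (Id × φ) q` on tuples. -/
def slotMap (φ : ∀ i, M i → M i) (K : Set (ZMod (r + 1))) (q : ∀ k : K, M k × M (k + 1)) :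
    ∀ k : K, M k × M (k + 1) :=
  fun k => Prod.map id (φ (k + 1)) (q k)

variable (φ L) in
/-- `(Id × φ_{k+1}) L_{k(k+1)}`. -/
def slotImage (k : ZMod (r + 1)) : Set (M k × M (k + 1)) := Prod.map id (φ (k + 1)) '' L k

/-- This is the core of the perturbation argument: only second components move, so the diagonal
condition after the map reads `φ i m = m'`. Membership in the domain supplies the remaining clause
of the graph condition. -/
theorem slotMap_mem_seamSet (hΓ : ∀ i p, p ∈ Γ i ↔ p.1 ∈ D i ∧ φ i p.1 = p.2)
    {K I : Set (ZMod (r + 1))} {q : ∀ k : K, M k × M (k + 1)}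
    (hq : ∀ k : K, q k ∈ (univ : Set (M k)) ×ˢ D (k + 1)) :
    slotMap φ K q ∈ seamSet K I diagonals ↔ q ∈ seamSet K I Γ := by
  refine forall_congr' fun k => forall_congr' fun hk => forall_congr' fun hk' =>
    forall_congr' fun hI => ?_
  rw [hΓ]
  exact ⟨fun h => ⟨(hq ⟨k, hk⟩).2, h⟩, fun h => h.2⟩

theorem slotMap_symm (hφ : ∀ i, IsDiffeoOn 𝓘(ℝ, E i) 𝓘(ℝ, E i) (φ i) (ψ i) (D i) (D' i))
    {K : Set (ZMod (r + 1))} {q : ∀ k : K, M k × M (k + 1)}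
    (hq : ∀ k : K, q k ∈ (univ : Set (M k)) ×ˢ D (k + 1)) : slotMap ψ K (slotMap φ K q) = q :=
  funext fun k => (isDiffeoOn_slot hφ k).left_inv _ (hq k)

theorem fiberProduct_slotImage (hΓ : ∀ i p, p ∈ Γ i ↔ p.1 ∈ D i ∧ φ i p.1 = p.2)
    (hL : ∀ k, L k ⊆ univ ×ˢ D (k + 1)) (K I : Set (ZMod (r + 1))) :
    fiberProduct K I (slotImage φ L) diagonals = slotMap φ K '' fiberProduct K I L Γ := by
  ext q'
  constructor
  · rintro ⟨h1, h2⟩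
    choose q hq hqq' using h1
    obtain rfl : slotMap φ K q = q' := funext hqq'
    exact ⟨q, ⟨hq, (slotMap_mem_seamSet hΓ fun k => hL k (hq k)).1 h2⟩, rfl⟩
  · rintro ⟨q, ⟨h1, h2⟩, rfl⟩
    exact ⟨fun k => mem_image_of_mem _ (h1 k),
      (slotMap_mem_seamSet hΓ fun k => hL k (h1 k)).2 h2⟩

theorem bijOn_slotMap (hφ : ∀ i, IsDiffeoOn 𝓘(ℝ, E i) 𝓘(ℝ, E i) (φ i) (ψ i) (D i) (D' i))
    (hΓ : ∀ i p, p ∈ Γ i ↔ p.1 ∈ D i ∧ φ i p.1 = p.2)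
    (hL : ∀ k, L k ⊆ univ ×ˢ D (k + 1)) (K I : Set (ZMod (r + 1))) :
    BijOn (slotMap φ K) (fiberProduct K I L Γ)
      (fiberProduct K I (slotImage φ L) diagonals) := by
  rw [fiberProduct_slotImage hΓ hL]
  refine InjOn.bijOn_image fun q hq q' hq' h => ?_
  rw [← slotMap_symm hφ fun k => hL k (hq.1 k), h, slotMap_symm hφ fun k => hL k (hq'.1 k)]

/-- A target vector is pulled back by the inverse differential, split there, and both summands are
pushed forward. -/
theorem isTransversalFiberProduct_slotImage
    (hφ : ∀ i, IsDiffeoOn 𝓘(ℝ, E i) 𝓘(ℝ, E i) (φ i) (ψ i) (D i) (D' i))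
    (hΓ : ∀ i p, p ∈ Γ i ↔ p.1 ∈ D i ∧ φ i p.1 = p.2)
    (hL : ∀ k, L k ⊆ univ ×ˢ D (k + 1)) {K I : Set (ZMod (r + 1))}
    (hT : IsTransversalFiberProduct E K I L Γ) :
    IsTransversalFiberProduct E K I (slotImage φ L) diagonals := by
  intro q' hq' w
  change q' ∈ fiberProduct K I _ _ at hq'
  rw [fiberProduct_slotImage hΓ hL] at hq'
  obtain ⟨q, hq, rfl⟩ := hq'
  have hqD : ∀ k : K, q k ∈ (univ : Set (M k)) ×ˢ D (k + 1) := fun k => hL k (hq.1 k)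
  obtain ⟨a, ha, b, hb, hab⟩ := hT q hq fun k =>
    (mfderiv (slotModel E K k) (slotModel E K k) (Prod.map id (ψ (k + 1))) (slotMap φ K q k)
      (w k) : E k × E (k + 1))
  refine ⟨fun k => mfderiv (slotModel E K k) (slotModel E K k)
      (Prod.map id (φ (k + 1))) (q k) (a k), ?_,
    fun k => mfderiv (slotModel E K k) (slotModel E K k)
      (Prod.map id (φ (k + 1))) (q k) (b k), ?_, ?_⟩
  · exact mem_piTangentSet_map (S := prodSet K L) (S' := prodSet K (slotImage φ L))
      (P := fun k : K => Prod.map id (φ (k + 1)))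
      (fun k : K => (isDiffeoOn_slot hφ k).open_source)
      hqD (fun k => (isDiffeoOn_slot hφ k).smooth _ (hqD k))
      (fun x hx _ k => ⟨x k, hx k, rfl⟩) ha
  · exact mem_piTangentSet_map (fun k : K => (isDiffeoOn_slot hφ k).open_source) hqD
      (fun k => (isDiffeoOn_slot hφ k).smooth _ (hqD k))
      (fun x hx hxD => (slotMap_mem_seamSet hΓ hxD).2 hx) hb
  · funext k
    have h1 := congrFun hab k
    refine (map_add (mfderiv (slotModel E K k) (slotModel E K k)
      (Prod.map id (φ (k + 1))) (q k)) (a k) (b k)).symm.trans ?_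
    refine (congrArg (mfderiv (slotModel E K k) (slotModel E K k)
      (Prod.map id (φ (k + 1))) (q k)) h1).trans ?_
    exact (isDiffeoOn_slot hφ k).mfderiv_apply_symm (hqD k) (w k)

theorem bijOn_piTangentSet_slotMap
    (hφ : ∀ i, IsDiffeoOn 𝓘(ℝ, E i) 𝓘(ℝ, E i) (φ i) (ψ i) (D i) (D' i))
    (hΓ : ∀ i p, p ∈ Γ i ↔ p.1 ∈ D i ∧ φ i p.1 = p.2)
    (hL : ∀ k, L k ⊆ univ ×ˢ D (k + 1)) {K I : Set (ZMod (r + 1))}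
    {q : ∀ k : K, M k × M (k + 1)} (hq : q ∈ fiberProduct K I L Γ) :
    BijOn (fun (v : ∀ k : K, TangentSpace (slotModel E K k) (q k)) (k : K) =>
        mfderiv (slotModel E K k) (slotModel E K k) (Prod.map id (φ (k + 1))) (q k) (v k))
      (piTangentSet (slotModel E K) (fiberProduct K I L Γ) q)
      (piTangentSet (slotModel E K) (fiberProduct K I (slotImage φ L) diagonals)
        (slotMap φ K q)) := by
  have hqD : ∀ k : K, q k ∈ (univ : Set (M k)) ×ˢ D (k + 1) := fun k => hL k (hq.1 k)
  have hbij := bijOn_slotMap hφ hΓ hL K I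
  refine ⟨fun v hv => ?_, fun v _ v' _ hvv' => ?_, fun w hw => ?_⟩
  · exact mem_piTangentSet_map (fun k : K => (isDiffeoOn_slot hφ k).open_source) hqD
      (fun k => (isDiffeoOn_slot hφ k).smooth _ (hqD k))
      (fun x hx _ => hbij.mapsTo hx) hv
  · funext k
    exact (isDiffeoOn_slot hφ k).mfderiv_injective (hqD k) (congrFun hvv' k)
  · have h1 := mem_piTangentSet_map (S' := fiberProduct K I L Γ) (P := fun k : K =>
        Prod.map id (ψ (k + 1)))
      (fun k : K => (isDiffeoOn_slot hφ k).open_target)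
      (fun k => (isDiffeoOn_slot hφ k).mapsTo _ (hqD k))
      (fun k => (isDiffeoOn_slot hφ k).smooth_symm _ ((isDiffeoOn_slot hφ k).mapsTo _ (hqD k)))
      (fun x hx _ => by
        obtain ⟨y, hy, rfl⟩ := hbij.surjOn hx
        change slotMap ψ K (slotMap φ K y) ∈ _
        rwa [slotMap_symm hφ fun k => hL k (hy.1 k)]) hw
    -- The pulled-back vector is based at `ψ (φ q)`, equal to `q` only propositionally; generalizing
    -- the base point avoids a cast between tangent spaces.
    have key : ∀ (q' : ∀ k : K, M k × M (k + 1)) (u : ∀ k : K, E k × E (k + 1)), q' = q →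
        (fun k => u k : ∀ k : K, TangentSpace (slotModel E K k) (q' k)) ∈
          piTangentSet (slotModel E K) (fiberProduct K I L Γ) q' →
        (fun k => u k : ∀ k : K, TangentSpace (slotModel E K k) (q k)) ∈
          piTangentSet (slotModel E K) (fiberProduct K I L Γ) q := by
      rintro _ u rfl h
      exact h
    refine ⟨_, key _ _ (slotMap_symm hφ hqD) h1, ?_⟩
    funext k
    exact (isDiffeoOn_slot hφ k).mfderiv_apply_symm (hqD k) (w k)

end Perturb

/-! ### Combinatorics of arcs and regrouping of the fiber product -/

section Arcs

variable {r : ℕ}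

/-- The distance from `j` along the cycle grows by one at each step; the excluded case is the return
to `j`, where it wraps from `r` to 0. -/
theorem val_add_one_sub {j k : ZMod (r + 1)} (h : k + 1 ≠ j) :
    (k + 1 - j).val = (k - j).val + 1 := by
  have h0 : k + 1 - j = (k - j) + 1 := by ring
  rw [h0]
  have hlt : (k - j).val < r + 1 := ZMod.val_lt _
  have hne : (k - j).val ≠ r := by
    intro h1
    apply h
    have h2 : ((k - j).val : ZMod (r + 1)) = r := by rw [h1]
    rw [ZMod.natCast_zmod_val] at h2
    have h3 : ((r + 1 : ℕ) : ZMod (r + 1)) = 0 := ZMod.natCast_self _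
    push_cast at h3
    rw [← sub_eq_zero, h0, h2, h3]
  have h4 : (k - j) + 1 = (((k - j).val + 1 : ℕ) : ZMod (r + 1)) := by
    push_cast
    rw [ZMod.natCast_zmod_val]
  rw [h4, ZMod.val_natCast, Nat.mod_eq_of_lt (by omega)]

theorem sub_val_eq_zero_iff {j k : ZMod (r + 1)} : (k - j).val = 0 ↔ k = j := by
  rw [ZMod.val_eq_zero, sub_eq_zero]

/-- Induction along an arc. -/
theorem arc_induction {j ℓ : ZMod (r + 1)} {p : ZMod (r + 1) → Prop} (h0 : p j)
    (hs : ∀ k ∈ arc j ℓ, k ≠ ℓ → k + 1 ∈ arc j ℓ → p k → p (k + 1)) :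
    ∀ k ∈ arc j ℓ, p k := by
  have key : ∀ (n : ℕ) (k : ZMod (r + 1)), (k - j).val = n → k ∈ arc j ℓ → p k := by
    intro n
    induction n with
    | zero =>
      intro k hk _
      rwa [sub_val_eq_zero_iff.1 hk]
    | succ n ih =>
      intro k hk hka
      have hkj : k - 1 + 1 ≠ j := by
        rw [sub_add_cancel]
        rintro rfl
        simp at hk
      have h1 := val_add_one_sub hkj
      rw [sub_add_cancel] at h1
      have h2 : k - 1 ∈ arc j ℓ := by
        have : (k - j).val ≤ (ℓ - j).val := hka
        change (k - 1 - j).val ≤ (ℓ - j).val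
        omega
      have h3 : k - 1 ≠ ℓ := by
        intro h
        have : (k - j).val ≤ (ℓ - j).val := hka
        rw [h] at h1
        omega
      have := hs (k - 1) h2 h3 (by rwa [sub_add_cancel]) (ih _ (by omega) h2)
      rwa [sub_add_cancel] at this
  exact fun k hk => key _ k rfl hk

theorem add_one_mem_arc {j ℓ k : ZMod (r + 1)} (hk : k ∈ arc j ℓ) (hkℓ : k ≠ ℓ) :
    k + 1 ∈ arc j ℓ ∧ k + 1 ≠ j := by
  have h0 : (k - j).val ≤ (ℓ - j).val := hk
  have hlt : (k - j).val ≠ (ℓ - j).val := by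
    intro h
    exact hkℓ (sub_left_injective (ZMod.val_injective _ h))
  have hne : k + 1 ≠ j := by
    intro h
    have h1 : k - j = -1 := by rw [← h]; ring
    have h2 : (k - j).val = r := by rw [h1]; exact ZMod.val_neg_one r
    have h3 : (ℓ - j).val < r + 1 := ZMod.val_lt _
    omega
  refine ⟨?_, hne⟩
  change (k + 1 - j).val ≤ (ℓ - j).val
  rw [val_add_one_sub hne]
  omega

theorem val_natCast_of_le {n : ℕ} (hn : n ≤ r) : ((n : ZMod (r + 1))).val = n := by
  rw [ZMod.val_natCast, Nat.mod_eq_of_lt (by omega)]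

/-- A run of more than `r` steps would pass through `j`, which is not in `I`; so the run has at most
`r` steps and residues determine positions in it. -/
theorem isConsecutive_of_run {I : Set (ZMod (r + 1))} {j : ZMod (r + 1)} {n : ℕ} (hj : j ∉ I)
    (hn : j + n + 1 ∉ I) (hrun : ∀ i : ℕ, 1 ≤ i → i ≤ n → j + i ∈ I) :
    n ≤ r ∧ IsConsecutive I j (j + n) := by
  have hnr : n ≤ r := by
    by_contra h
    have h1 := hrun (r + 1) (by omega) (by omega)
    rw [ZMod.natCast_self, add_zero] at h1
    exact hj h1
  refine ⟨hnr, hj, hn, fun k hk hkℓ => ?_⟩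
  have hk' : (k - j).val ≤ (j + n - j).val := hk
  rw [add_sub_cancel_left, val_natCast_of_le hnr] at hk'
  have hkj : k = j + (k - j).val := by rw [ZMod.natCast_zmod_val]; ring
  have hne : (k - j).val ≠ n := by
    intro h
    rw [h] at hkj
    exact hkℓ hkj
  have h1 := hrun ((k - j).val + 1) (by omega) (by omega)
  have h2 : k + 1 = j + (((k - j).val + 1 : ℕ) : ZMod (r + 1)) := by
    push_cast
    rw [ZMod.natCast_zmod_val]
    ring
  rwa [h2]

theorem IsConsecutive.add_natCast_mem {I : Set (ZMod (r + 1))} {j ℓ : ZMod (r + 1)}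
    (h : IsConsecutive I j ℓ) {i : ℕ} (h1 : 1 ≤ i) (hi : i ≤ (ℓ - j).val) : j + i ∈ I := by
  have hlt : (ℓ - j).val < r + 1 := ZMod.val_lt _
  obtain ⟨i, rfl⟩ : ∃ i', i = i' + 1 := ⟨i - 1, by omega⟩
  have hv : (j + (i : ZMod (r + 1)) - j).val = i := by
    rw [add_sub_cancel_left, val_natCast_of_le (by omega)]
  have h2 := h.2.2 (j + i) (by change (j + (i : ZMod (r + 1)) - j).val ≤ _; omega) (by
    rintro rfl
    omega)
  push_cast
  rwa [← add_assoc]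

/-- Every index lies in the arc of some consecutive pair. -/
theorem exists_isConsecutive {I : Set (ZMod (r + 1))} (hI : I ≠ univ) (k : ZMod (r + 1)) :
    ∃ c : {c : ZMod (r + 1) × ZMod (r + 1) // IsConsecutive I c.1 c.2}, k ∈ arc c.1.1 c.1.2 := by
  classical
  obtain ⟨i₀, hi₀⟩ := (ne_univ_iff_exists_notMem I).1 hI
  have hback : ∃ n : ℕ, k - n ∉ I := ⟨(k - i₀).val, by
    rw [ZMod.natCast_zmod_val, sub_sub_cancel]; exact hi₀⟩
  have hforw : ∃ n : ℕ, k + n + 1 ∉ I := ⟨(i₀ - k - 1).val, by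
    rw [ZMod.natCast_zmod_val]
    have : k + (i₀ - k - 1) + 1 = i₀ := by ring
    rwa [this]⟩
  -- Minimal steps from `k` back to an index outside `I`, possibly `k` itself; `m` below is the
  -- minimal number of steps forward to a factor whose successor is outside `I`. Minimality puts
  -- everything between into `I`.
  set n := Nat.find hback with hn
  set m := Nat.find hforw with hm
  obtain ⟨hnm, hc⟩ := isConsecutive_of_run (I := I) (j := k - n) (n := n + m)
    (Nat.find_spec hback) (by
      have := Nat.find_spec hforw
      push_cast
      rwa [← add_assoc, sub_add_cancel]) (fun i h1 hi => by
      rcases le_or_gt i n with h | h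
      · have := not_not.1 (Nat.find_min hback (m := n - i) (by omega))
        rw [Nat.cast_sub h] at this
        rwa [sub_add]
      · have := not_not.1 (Nat.find_min hforw (m := i - n - 1) (by omega))
        have e : ((i - n - 1 : ℕ) : ZMod (r + 1)) = i - n - 1 := by
          rw [Nat.cast_sub (by omega), Nat.cast_sub h.le, Nat.cast_one]
        rw [e] at this
        convert this using 1
        ring)
  refine ⟨⟨(_, _), hc⟩, ?_⟩
  change (k - (k - n)).val ≤ (k - n + ((n + m : ℕ) : ZMod (r + 1)) - (k - n)).val
  rw [sub_sub_cancel, add_sub_cancel_left, val_natCast_of_le hnm, val_natCast_of_le (by omega)]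
  omega

/-- If two arcs through `k` started at different places, the later start would be an interior index
of the other arc, hence in `I`; the ends are compared in the same way. -/
theorem IsConsecutive.unique {I : Set (ZMod (r + 1))} {k : ZMod (r + 1)}
    {c c' : {c : ZMod (r + 1) × ZMod (r + 1) // IsConsecutive I c.1 c.2}}
    (hk : k ∈ arc c.1.1 c.1.2) (hk' : k ∈ arc c'.1.1 c'.1.2) : c = c' := by
  have key : ∀ {c c' : {c : ZMod (r + 1) × ZMod (r + 1) // IsConsecutive I c.1 c.2}},
      k ∈ arc c.1.1 c.1.2 → k ∈ arc c'.1.1 c'.1.2 →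
      (k - c.1.1).val ≤ (k - c'.1.1).val := by
    intro c c' hk hk'
    by_contra! hlt
    have hle : (k - c.1.1).val ≤ (c.1.2 - c.1.1).val := hk
    have h1 := c.2.add_natCast_mem (i := (k - c.1.1).val - (k - c'.1.1).val) (by omega) (by omega)
    rw [Nat.cast_sub hlt.le, ZMod.natCast_zmod_val, ZMod.natCast_zmod_val] at h1
    apply c'.2.1
    convert h1 using 1
    ring
  have hj : c.1.1 = c'.1.1 := by
    have := le_antisymm (key hk hk') (key hk' hk)
    exact sub_right_injective (ZMod.val_injective _ this)
  have key2 : ∀ {c c' : {c : ZMod (r + 1) × ZMod (r + 1) // IsConsecutive I c.1 c.2}},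
      c.1.1 = c'.1.1 → (c.1.2 - c.1.1).val ≤ (c'.1.2 - c'.1.1).val := by
    intro c c' hj
    by_contra! hlt
    have h1 := c.2.add_natCast_mem (i := (c'.1.2 - c'.1.1).val + 1) (by omega) (by omega)
    push_cast at h1
    rw [ZMod.natCast_zmod_val, hj] at h1
    apply c'.2.2.1
    convert h1 using 1
    ring
  have hℓ : c.1.2 = c'.1.2 := by
    have := ZMod.val_injective _ (le_antisymm (key2 hj) (key2 hj.symm))
    rw [hj] at this
    exact sub_left_injective this
  exact Subtype.ext (Prod.ext hj hℓ)

/-- Families over the arcs of the consecutive pairs are glued to families over all indices. -/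
def glueArcs {I : Set (ZMod (r + 1))} (hI : I ≠ univ) {Z : ZMod (r + 1) → Type*}
    (Q : ∀ c : {c : ZMod (r + 1) × ZMod (r + 1) // IsConsecutive I c.1 c.2},
      ∀ k : arc c.1.1 c.1.2, Z k) (k : ZMod (r + 1)) : Z k :=
  Q (exists_isConsecutive hI k).choose ⟨k, (exists_isConsecutive hI k).choose_spec⟩

theorem glueArcs_apply {I : Set (ZMod (r + 1))} (hI : I ≠ univ) {Z : ZMod (r + 1) → Type*}
    (Q : ∀ c : {c : ZMod (r + 1) × ZMod (r + 1) // IsConsecutive I c.1 c.2},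
      ∀ k : arc c.1.1 c.1.2, Z k)
    (c : {c : ZMod (r + 1) × ZMod (r + 1) // IsConsecutive I c.1 c.2}) {k : ZMod (r + 1)}
    (hk : k ∈ arc c.1.1 c.1.2) : glueArcs hI Q k = Q c ⟨k, hk⟩ := by
  obtain rfl := IsConsecutive.unique (exists_isConsecutive hI k).choose_spec hk
  rfl

/-! ### Gluing tuples along the arcs. -/

section Sets

variable {M : ZMod (r + 1) → Type*} {Λ : ∀ k, Set (M k × M (k + 1))}
  {Γ : ∀ i, Set (M i × M i)} {I : Set (ZMod (r + 1))}

theorem glueArcs_mem_prodSet (hI : I ≠ univ)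
    {Q : ∀ c : {c : ZMod (r + 1) × ZMod (r + 1) // IsConsecutive I c.1 c.2},
      ∀ k : arc c.1.1 c.1.2, M k × M (k + 1)} (hQ : ∀ c, Q c ∈ prodSet (arc c.1.1 c.1.2) Λ) :
    (fun k : (univ : Set (ZMod (r + 1))) => glueArcs hI (Z := fun k => M k × M (k + 1)) Q k) ∈
      prodSet univ Λ :=
  fun k => hQ _ ⟨k, _⟩

/-- No condition crosses between arcs: an arc ends at a factor `ℓ` with `ℓ + 1 ∉ I`, so a seam in
`I` has both adjacent factors in one arc. -/
theorem glueArcs_mem_seamSet (hI : I ≠ univ)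
    {Q : ∀ c : {c : ZMod (r + 1) × ZMod (r + 1) // IsConsecutive I c.1 c.2},
      ∀ k : arc c.1.1 c.1.2, M k × M (k + 1)} (hQ : ∀ c, Q c ∈ seamSet (arc c.1.1 c.1.2) I Γ) :
    (fun k : (univ : Set (ZMod (r + 1))) => glueArcs hI (Z := fun k => M k × M (k + 1)) Q k) ∈
      seamSet univ I Γ := by
  intro k _ _ hkI
  obtain ⟨c, hk⟩ := exists_isConsecutive hI k
  have hk1 : k + 1 ∈ arc c.1.1 c.1.2 := (add_one_mem_arc hk (by
    rintro rfl
    exact c.2.2.1 hkI)).1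
  have := hQ c k hk hk1 hkI
  rwa [← glueArcs_apply hI (Z := fun k => M k × M (k + 1)) Q c hk,
    ← glueArcs_apply hI (Z := fun k => M k × M (k + 1)) Q c hk1] at this

theorem restrict_mem_fiberProduct {K K' : Set (ZMod (r + 1))} (hK : K' ⊆ K)
    {q : ∀ k : K, M k × M (k + 1)} (hq : q ∈ fiberProduct K I Λ Γ) :
    (fun k : K' => q ⟨k, hK k.2⟩) ∈ fiberProduct K' I Λ Γ :=
  ⟨fun k => hq.1 ⟨k, hK k.2⟩, fun k hk hk' hkI => hq.2 k (hK hk) (hK hk') hkI⟩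

theorem bijOn_splitArcs (hI : I ≠ univ) :
    BijOn (splitArcs I) (fiberProduct univ I Λ Γ)
      (Set.pi univ fun c => fiberProduct (arc c.1.1 c.1.2) I Λ Γ) := by
  refine ⟨fun q hq c _ => restrict_mem_fiberProduct (subset_univ _) hq,
    fun q _ q' _ h => ?_, fun Q hQ => ?_⟩
  · funext ⟨k, _⟩
    obtain ⟨c, hk⟩ := exists_isConsecutive hI k
    exact congrFun (congrFun h c) ⟨k, hk⟩
  · refine ⟨fun k => glueArcs hI (Z := fun k => M k × M (k + 1)) Q k,
      ⟨glueArcs_mem_prodSet hI fun c => (hQ c (mem_univ _)).1,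
        glueArcs_mem_seamSet hI fun c => (hQ c (mem_univ _)).2⟩, ?_⟩
    funext c k
    exact glueArcs_apply hI (Z := fun k => M k × M (k + 1)) Q c k.2

end Sets

/-! ### Gluing tangent vectors and transversality along the arcs. -/

section Tangent

variable {E M : ZMod (r + 1) → Type*} [∀ j, NormedAddCommGroup (E j)]
  [∀ j, NormedSpace ℝ (E j)] [∀ j, TopologicalSpace (M j)] [∀ j, ChartedSpace (E j) (M j)]
  {Λ : ∀ k, Set (M k × M (k + 1))} {Γ : ∀ i, Set (M i × M i)} {I : Set (ZMod (r + 1))}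

theorem glueArcs_mem_piTangentSet (hI : I ≠ univ)
    {S : ∀ c : {c : ZMod (r + 1) × ZMod (r + 1) // IsConsecutive I c.1 c.2},
      Set (∀ k : arc c.1.1 c.1.2, M k × M (k + 1))}
    {S' : Set (∀ k : (univ : Set (ZMod (r + 1))), M k × M (k + 1))}
    (hS : ∀ Q, (∀ c, Q c ∈ S c) → (fun k : (univ : Set (ZMod (r + 1))) =>
      glueArcs hI (Z := fun k => M k × M (k + 1)) Q k) ∈ S')
    {q : ∀ k : (univ : Set (ZMod (r + 1))), M k × M (k + 1)}
    {v : ∀ c : {c : ZMod (r + 1) × ZMod (r + 1) // IsConsecutive I c.1 c.2},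
      ∀ k : arc c.1.1 c.1.2, TangentSpace (slotModel E (arc c.1.1 c.1.2) k) (splitArcs I q c k)}
    (hv : ∀ c, v c ∈ piTangentSet (slotModel E (arc c.1.1 c.1.2)) (S c) (splitArcs I q c)) :
    (fun k : (univ : Set (ZMod (r + 1))) => glueArcs hI (Z := fun k => E k × E (k + 1)) v k :
      ∀ k : (univ : Set (ZMod (r + 1))), TangentSpace (slotModel E univ k) (q k)) ∈
      piTangentSet (slotModel E univ) S' q := by
  choose γ h0 hγ hγv hγS using hv
  refine ⟨fun t k => glueArcs hI (Z := fun k => M k × M (k + 1)) (fun c => γ c t) k,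
    ?_, fun k => ?_, fun k => ?_, ?_⟩
  · funext k
    change γ _ 0 _ = _
    rw [h0]
    rfl
  · exact hγ _ ⟨k, _⟩
  · exact hγv _ ⟨k, _⟩
  · filter_upwards [Filter.eventually_all.2 hγS] with t ht using hS _ ht

/-- Transversality is given arc by arc; a vector is split on each arc and the summands are glued
through their representing curves. -/
theorem isTransversalFiberProduct_univ (hI : I ≠ univ)
    (hT : ∀ j ℓ, IsConsecutive I j ℓ → IsTransversalFiberProduct E (arc j ℓ) I Λ Γ) :
    IsTransversalFiberProduct E univ I Λ Γ := by
  intro q hq w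
  choose a ha b hb hab using fun c : {c : ZMod (r + 1) × ZMod (r + 1) //
      IsConsecutive I c.1 c.2} => hT c.1.1 c.1.2 c.2 (splitArcs I q c)
        (restrict_mem_fiberProduct (subset_univ _) hq) fun k => w ⟨k, mem_univ _⟩
  refine ⟨_, glueArcs_mem_piTangentSet hI (fun Q hQ => glueArcs_mem_prodSet hI hQ) ha,
    _, glueArcs_mem_piTangentSet hI (fun Q hQ => glueArcs_mem_seamSet hI hQ) hb, ?_⟩
  funext k
  exact congrFun (hab _) ⟨k, _⟩

end Tangent

end Arcs

end Quilt

end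

noncomputable section


namespace Quilt

/-! ### Regular level sets -/

section Regular

variable {V Y : Type*} [NormedAddCommGroup V] [NormedSpace ℝ V] [FiniteDimensional ℝ V]
  [NormedAddCommGroup Y] [NormedSpace ℝ Y] [FiniteDimensional ℝ Y]

/-- A surjective linear map onto `Y` is completed by coordinates on its kernel. -/
theorem exists_complement_equiv {d : ℕ} (hd : Module.finrank ℝ V = Module.finrank ℝ Y + d)
    (A : V →L[ℝ] Y) (hA : Function.Surjective A) :
    ∃ (π : V →L[ℝ] EuclideanSpace ℝ (Fin d)) (T : V ≃L[ℝ] Y × EuclideanSpace ℝ (Fin d)),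
      (T : V →L[ℝ] Y × EuclideanSpace ℝ (Fin d)) = A.prod π := by
  have hk : Module.finrank ℝ (LinearMap.ker A.toLinearMap) =
      Module.finrank ℝ (EuclideanSpace ℝ (Fin d)) := by
    have h1 := A.toLinearMap.finrank_range_add_finrank_ker
    rw [LinearMap.range_eq_top.2 hA, finrank_top] at h1
    rw [finrank_euclideanSpace_fin]
    omega
  let e := LinearEquiv.ofFinrankEq _ _ hk
  obtain ⟨p, hp⟩ := (LinearMap.ker A.toLinearMap).subtype.exists_leftInverse_of_injective
    (Submodule.ker_subtype _)
  let π : V →L[ℝ] EuclideanSpace ℝ (Fin d) := LinearMap.toContinuousLinearMap (e.toLinearMap ∘ₗ p)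
  have hinj : Function.Injective (A.prod π).toLinearMap := by
    rw [← LinearMap.ker_eq_bot, LinearMap.ker_eq_bot']
    intro v hv
    have hv1 : A v = 0 := congrArg Prod.fst hv
    have hv2 : e (p v) = 0 := congrArg Prod.snd hv
    have h3 : p v = ⟨v, hv1⟩ := LinearMap.congr_fun hp ⟨v, hv1⟩
    rw [h3, map_eq_zero_iff _ e.injective] at hv2
    exact congrArg Subtype.val hv2
  have hdim : Module.finrank ℝ V = Module.finrank ℝ (Y × EuclideanSpace ℝ (Fin d)) := by
    rw [Module.finrank_prod, finrank_euclideanSpace_fin, hd]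
  refine ⟨π, (LinearEquiv.ofInjectiveOfFinrankEq (A.prod π).toLinearMap hinj
    hdim).toContinuousLinearEquiv, ?_⟩
  ext v <;> rfl

/-- Local parametrization of a regular level set. -/
theorem exists_param_levelSet {d : ℕ} (hd : Module.finrank ℝ V = Module.finrank ℝ Y + d)
    {O : Set V} (hO : IsOpen O) {R : V → Y} (hR : ContDiffOn ℝ ∞ R O) {u₀ : V} (hu₀ : u₀ ∈ O)
    (hsurj : Function.Surjective (fderiv ℝ R u₀)) :
    ∃ (O' : Set V) (W : Set (EuclideanSpace ℝ (Fin d))) (γ : EuclideanSpace ℝ (Fin d) → V)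
      (π : V →L[ℝ] EuclideanSpace ℝ (Fin d)), IsOpen O' ∧ u₀ ∈ O' ∧ O' ⊆ O ∧ IsOpen W ∧
      ContDiffOn ℝ ∞ γ W ∧ γ '' W = {u ∈ O' | R u = 0} ∧ LeftInvOn π γ W := by
  obtain ⟨π, T, hT⟩ := exists_complement_equiv hd _ hsurj
  -- Adjoining kernel coordinates makes `Φ` a local diffeomorphism that straightens the level set to
  -- `0 × ℝ^d`.
  let Φ : V → Y × EuclideanSpace ℝ (Fin d) := fun u => (R u, π u)
  have hΦ : ∀ u ∈ O, ContDiffAt ℝ ∞ Φ u := fun u hu =>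
    (hR.contDiffAt (hO.mem_nhds hu)).prodMk π.contDiff.contDiffAt
  have hΦ' : HasFDerivAt Φ (T : V →L[ℝ] Y × EuclideanSpace ℝ (Fin d)) u₀ := by
    rw [hT]
    exact (((hR.contDiffAt (hO.mem_nhds hu₀)).differentiableAt (by simp)).hasFDerivAt).prodMk
      π.hasFDerivAt
  let e := (hΦ u₀ hu₀).toOpenPartialHomeomorph Φ hΦ' (by simp)
  -- The inverse is shown smooth only at points where the derivative of `Φ` is invertible, so the
  -- source is shrunk to this open set.
  have hinv : IsOpen {u ∈ O | fderiv ℝ Φ u ∈ range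
      ((↑) : (V ≃L[ℝ] Y × EuclideanSpace ℝ (Fin d)) → V →L[ℝ] Y × EuclideanSpace ℝ (Fin d))} := by
    have : ContinuousOn (fderiv ℝ Φ) O := (ContDiffOn.continuousOn_fderiv_of_isOpen
      (fun u hu => (hΦ u hu).contDiffWithinAt) hO (by simp))
    exact this.isOpen_inter_preimage hO ContinuousLinearEquiv.isOpen
  set O' := e.source ∩ {u ∈ O | fderiv ℝ Φ u ∈ range
      ((↑) : (V ≃L[ℝ] Y × EuclideanSpace ℝ (Fin d)) → V →L[ℝ] Y × EuclideanSpace ℝ (Fin d))}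
  have hO' : IsOpen O' := e.open_source.inter hinv
  have hW : IsOpen (e.target ∩ e.symm ⁻¹' O') := e.isOpen_inter_preimage_symm hO'
  have heΦ : ∀ u, e u = (R u, π u) := fun u => rfl
  refine ⟨O', (fun w => ((0 : Y), w)) ⁻¹' (e.target ∩ e.symm ⁻¹' O'), fun w => e.symm (0, w), π,
    hO', ⟨(hΦ u₀ hu₀).mem_toOpenPartialHomeomorph_source hΦ' (by simp), hu₀, T, hΦ'.fderiv.symm⟩,
    fun u hu => hu.2.1, hW.preimage (by fun_prop), ?_, ?_, ?_⟩
  · rintro w ⟨hw, hw'⟩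
    obtain ⟨T', hT'⟩ := hw'.2.2
    have h1 : ContDiffAt ℝ ∞ Φ (e.symm (0, w)) := hΦ _ hw'.2.1
    have h2 : ContDiffAt ℝ ∞ e.symm ((0 : Y), w) := by
      refine e.contDiffAt_symm hw (f₀' := T') ?_ h1
      rw [hT']
      exact (h1.differentiableAt (by simp)).hasFDerivAt
    exact (h2.comp w (contDiffAt_const.prodMk contDiffAt_id)).contDiffWithinAt
  · ext u
    constructor
    · rintro ⟨w, ⟨hw, hw'⟩, rfl⟩
      exact ⟨hw', congrArg Prod.fst ((heΦ _).symm.trans (e.right_inv hw))⟩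
    · rintro ⟨hu, hRu⟩
      have h1 : ((0 : Y), π u) = e u := by rw [heΦ, hRu]
      refine ⟨π u, ?_, ?_⟩
      · rw [mem_preimage, h1]
        exact ⟨e.map_source hu.1, by rw [mem_preimage, e.left_inv hu.1]; exact hu⟩
      · exact (congrArg e.symm h1).trans (e.left_inv hu.1)
  · rintro w ⟨hw, -⟩
    exact congrArg Prod.snd ((heΦ _).symm.trans (e.right_inv hw))

theorem fderiv_injective_of_leftInvOn {V' : Type*} [NormedAddCommGroup V'] [NormedSpace ℝ V']
    {W : Set V'} (hW : IsOpen W) {γ : V' → V} {π : V →L[ℝ] V'} (hγ : ContDiffOn ℝ ∞ γ W)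
    (h : LeftInvOn π γ W) {w : V'} (hw : w ∈ W) : Function.Injective (fderiv ℝ γ w) := by
  have h1 := ((hγ.contDiffAt (hW.mem_nhds hw)).differentiableAt (by simp)).hasFDerivAt
  have h2 : HasFDerivAt (π ∘ γ) (ContinuousLinearMap.id ℝ V') w :=
    (hasFDerivAt_id w).congr_of_eventuallyEq (by
      filter_upwards [hW.mem_nhds hw] with x hx using h hx)
  have h3 := (π.hasFDerivAt.comp w h1).unique h2
  exact Function.LeftInverse.injective fun v => congrArg (fun A : V' →L[ℝ] V' => A v) h3

end Regular

/-! ### Tangent vectors in a local parametrization -/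

section Param

variable {F B N : Type*} [NormedAddCommGroup F] [NormedSpace ℝ F] [FiniteDimensional ℝ F]
  [TopologicalSpace B] [TopologicalSpace N] [ChartedSpace B N] {I : ModelWithCorners ℝ F B}
  [IsManifold I ∞ N]

/-- The coordinate map `h` is merely continuous, so a curve in `S` does not at once have a
differentiable coordinate expression. A linear left inverse `Λ` of the differential of `χ ∘ g` makes
`Λ ∘ χ ∘ g` locally invertible, and its inverse expresses `h ∘ γ` through the smooth curve `Λ ∘ χ ∘
γ`. -/
theorem exists_mfderiv_param_eq {d : ℕ} {S V : Set N} {U : Set (EuclideanSpace ℝ (Fin d))}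
    {g : EuclideanSpace ℝ (Fin d) → N} {h : N → EuclideanSpace ℝ (Fin d)} (hU : IsOpen U)
    (hV : IsOpen V) (hgU : g '' U = S ∩ V)
    (hg : ContMDiffOn 𝓘(ℝ, EuclideanSpace ℝ (Fin d)) I ∞ g U)
    (hg' : ∀ u ∈ U, Function.Injective (mfderiv 𝓘(ℝ, EuclideanSpace ℝ (Fin d)) I g u))
    (hh : ContinuousOn h (S ∩ V)) (hhg : LeftInvOn h g U) {u : EuclideanSpace ℝ (Fin d)}
    (hu : u ∈ U) {p : N} (hup : g u = p) {v : TangentSpace I p} (hv : v ∈ tangentSet I S p) :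
    ∃ w : EuclideanSpace ℝ (Fin d), (mfderiv 𝓘(ℝ, EuclideanSpace ℝ (Fin d)) I g u w : F) = v := by
  subst hup
  obtain ⟨γ, h0, hγ, hγv, hS⟩ := hv
  have hmem : ∀ u ∈ U, g u ∈ S ∩ V := fun u hu => hgU ▸ mem_image_of_mem g hu
  have hgu : ContMDiffAt 𝓘(ℝ, EuclideanSpace ℝ (Fin d)) I ∞ g u := hg.contMDiffAt (hU.mem_nhds hu)
  have hSV : ∀ᶠ t in 𝓝 (0 : ℝ), γ t ∈ S ∩ V :=
    hS.and (hγ.continuousAt.eventually_mem (hV.mem_nhds (by rw [h0]; exact (hmem u hu).2)))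
  have hgh : ∀ x ∈ S ∩ V, h x ∈ U ∧ g (h x) = x := by
    rw [← hgU]
    rintro _ ⟨x, hx, rfl⟩
    rw [hhg hx]
    exact ⟨hx, rfl⟩
  have hc0 : h (γ 0) = u := by rw [h0, hhg hu]
  have hc : ContinuousAt (h ∘ γ) 0 := by
    have h1 : Filter.Tendsto γ (𝓝 0) (𝓝[S ∩ V] (g u)) :=
      tendsto_nhdsWithin_iff.2 ⟨by simpa [h0] using hγ.continuousAt.tendsto, hSV⟩
    have h2 := (hh (g u) (hmem u hu)).tendsto.comp h1
    rw [ContinuousAt, Function.comp_apply, h0]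
    exact h2
  -- the coordinate expression of `g` and a linear left inverse of its differential
  set χ := extChartAt I (g u)
  have hχ : ContMDiffAt I 𝓘(ℝ, F) ∞ χ (g u) := contMDiffAt_extChartAt
  have hgχ : ContDiffAt ℝ ∞ (χ ∘ g) u := contMDiffAt_iff_contDiffAt.1 (hχ.comp u hgu)
  have hinj : Function.Injective (fderiv ℝ (χ ∘ g) u) := by
    rw [← mfderiv_eq_fderiv, mfderiv_comp u (hχ.mdifferentiableAt (by simp))
      (hgu.mdifferentiableAt (by simp))]
    exact ((isInvertible_mfderiv_extChartAt (mem_extChartAt_source (g u))).injective).comp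
      (hg' u hu)
  obtain ⟨l, hl⟩ := (fderiv ℝ (χ ∘ g) u).toLinearMap.exists_leftInverse_of_injective
    (LinearMap.ker_eq_bot.2 hinj)
  let Λ : F →L[ℝ] EuclideanSpace ℝ (Fin d) := LinearMap.toContinuousLinearMap l
  have hf : ContDiffAt ℝ ∞ (Λ ∘ χ ∘ g) u := Λ.contDiff.contDiffAt.comp u hgχ
  have hf' : HasStrictFDerivAt (Λ ∘ χ ∘ g)
      ((ContinuousLinearEquiv.refl ℝ (EuclideanSpace ℝ (Fin d)) :
        EuclideanSpace ℝ (Fin d) →L[ℝ] EuclideanSpace ℝ (Fin d))) u := by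
    refine hf.hasStrictFDerivAt' ?_ (by simp)
    have h1 := Λ.hasFDerivAt.comp u (hgχ.differentiableAt (by simp)).hasFDerivAt
    convert h1 using 1
    ext1 w
    exact (LinearMap.congr_fun hl w).symm
  -- hence `h ∘ γ` is differentiable
  have hcd : DifferentiableAt ℝ (h ∘ γ) 0 := by
    have h1 : DifferentiableAt ℝ (Λ ∘ χ ∘ γ) 0 := by
      have hχ' : ContMDiffAt I 𝓘(ℝ, F) ∞ χ (γ 0) := by rwa [h0]
      exact Λ.differentiableAt.comp 0
        ((contMDiffAt_iff_contDiffAt.1 (hχ'.comp 0 hγ)).differentiableAt (by simp))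
    have h2 : DifferentiableAt ℝ (hf'.localInverse) ((Λ ∘ χ ∘ γ) 0) := by
      have := hf'.to_localInverse.hasFDerivAt.differentiableAt
      simpa [h0] using this
    refine (h2.comp 0 h1).congr_of_eventuallyEq ?_
    have h3 : Filter.Tendsto (h ∘ γ) (𝓝 0) (𝓝 u) := by
      have := hc.tendsto
      rwa [Function.comp_apply, hc0] at this
    filter_upwards [h3.eventually hf'.eventually_left_inverse, hSV] with t ht ht'
    simp only [Function.comp_apply] at ht ⊢
    rw [(hgh _ ht').2] at ht
    exact ht.symm
  refine ⟨fderiv ℝ (h ∘ γ) 0 (1 : ℝ), ?_⟩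
  have h1 : γ =ᶠ[𝓝 0] g ∘ (h ∘ γ) := by
    filter_upwards [hSV] with t ht using ((hgh _ ht).2).symm
  have h2 := mfderiv_comp_curve (p := u) hc0 (hgu.mdifferentiableAt (by simp))
    hcd.mdifferentiableAt
  rw [mfderiv_eq_fderiv] at h2
  refine h2.symm.trans (Eq.trans ?_ hγv)
  exact congrArg (fun A : ℝ →L[ℝ] F => A 1) h1.mfderiv_eq.symm

end Param

/-! ### Regular fiber products of submanifolds -/

section RegularFiberProduct

variable {ι : Type*} [Fintype ι] {F B N : ι → Type*} [∀ i, NormedAddCommGroup (F i)]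
  [∀ i, NormedSpace ℝ (F i)] [∀ i, FiniteDimensional ℝ (F i)] [∀ i, TopologicalSpace (B i)]
  [∀ i, TopologicalSpace (N i)] [∀ i, ChartedSpace (B i) (N i)]
  {I : ∀ i, ModelWithCorners ℝ (F i) (B i)} [∀ i, IsManifold (I i) ∞ (N i)]
  {τ : Type*} [Fintype τ] {Y : τ → Type*} [∀ s, NormedAddCommGroup (Y s)]
  [∀ s, NormedSpace ℝ (Y s)] [∀ s, FiniteDimensional ℝ (Y s)]

/-- In product coordinates the set is the zero set of the differences `f s - g s`. The hypothesis
`hreg` is surjectivity of their derivative on tangent vectors of the factors, so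
`exists_param_levelSet` applies. -/
theorem exists_param_fiberProduct {S : ∀ i, Set (N i)} {d : ι → ℕ}
    (hS : ∀ i, IsSubmanifold (I i) (d i) (S i)) {X : Set (∀ i, N i)} {q : ∀ i, N i} (hq : q ∈ X)
    {a b : τ → ι} {f : ∀ s, N (a s) → Y s} {g : ∀ s, N (b s) → Y s}
    (hf : ∀ s, ∀ᶠ x in 𝓝 (q (a s)), ContMDiffAt (I (a s)) 𝓘(ℝ, Y s) ∞ (f s) x)
    (hg : ∀ s, ∀ᶠ x in 𝓝 (q (b s)), ContMDiffAt (I (b s)) 𝓘(ℝ, Y s) ∞ (g s) x)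
    (hX : ∀ᶠ x in 𝓝 q, x ∈ X ↔ (∀ i, x i ∈ S i) ∧ ∀ s, f s (x (a s)) = g s (x (b s)))
    (hreg : ∀ y : ∀ s, Y s, ∃ w : ∀ i, TangentSpace (I i) (q i),
      (∀ i, w i ∈ tangentSet (I i) (S i) (q i)) ∧
      ∀ s, ∃ z : Y s, (mfderiv (I (a s)) 𝓘(ℝ, Y s) (f s) (q (a s)) (w (a s)) : Y s) = z + y s ∧
        (mfderiv (I (b s)) 𝓘(ℝ, Y s) (g s) (q (b s)) (w (b s)) : Y s) = z)
    {e : ℕ} (he : ∑ i, d i = ∑ s, Module.finrank ℝ (Y s) + e) :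
    ∃ (U : Set (EuclideanSpace ℝ (Fin e))) (V : Set (∀ i, N i))
      (G : EuclideanSpace ℝ (Fin e) → ∀ i, N i) (h : (∀ i, N i) → EuclideanSpace ℝ (Fin e)),
      IsOpen U ∧ IsOpen V ∧ q ∈ V ∧ G '' U = X ∩ V ∧
      (∀ i, ContMDiffOn 𝓘(ℝ, EuclideanSpace ℝ (Fin e)) (I i) ∞ (fun u => G u i) U) ∧
      (∀ u ∈ U, Function.Injective fun w : EuclideanSpace ℝ (Fin e) =>
        fun i => (mfderiv 𝓘(ℝ, EuclideanSpace ℝ (Fin e)) (I i) (fun u' => G u' i) u w : F i)) ∧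
      ContinuousOn h (X ∩ V) ∧ LeftInvOn h G U := by
  obtain ⟨hqS, hqfg⟩ := hX.self_of_nhds.1 hq
  choose U V G h hU hV hqV hGU hG hG' hh hhG using fun i => hS i (q i) (hqS i)
  have hGm : ∀ i, ∀ u ∈ U i, G i u ∈ S i ∩ V i := fun i u hu => hGU i ▸ mem_image_of_mem _ hu
  have hGh : ∀ i, ∀ x ∈ S i ∩ V i, h i x ∈ U i ∧ G i (h i x) = x := by
    intro i
    rw [← hGU i]
    rintro _ ⟨x, hx, rfl⟩
    rw [hhG i hx]
    exact ⟨hx, rfl⟩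
  have hGc : ∀ i, ContinuousOn (G i) (U i) := fun i => (hG i).continuousOn
  -- an open neighbourhood on which everything is defined
  have hcont : ∀ i, ContinuousAt (fun x : ∀ i, N i => x i) q := fun i =>
    (continuous_apply i).continuousAt
  have hall := hX.and (((Filter.eventually_all.2 fun s => (hcont (a s)).eventually (hf s)).and
    (Filter.eventually_all.2 fun s => (hcont (b s)).eventually (hg s))))
  obtain ⟨A, hA, hAo, hqA⟩ := eventually_nhds_iff.1 hall
  let GG : (∀ i, EuclideanSpace ℝ (Fin (d i))) → ∀ i, N i := fun u i => G i (u i)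
  have hpi : IsOpen (Set.pi univ U) := isOpen_set_pi finite_univ fun i _ => hU i
  have hGGc : ContinuousOn GG (Set.pi univ U) := continuousOn_pi.2 fun i =>
    (hGc i).comp (continuous_apply i).continuousOn fun u hu => hu i (mem_univ i)
  let O : Set (∀ i, EuclideanSpace ℝ (Fin (d i))) := Set.pi univ U ∩ GG ⁻¹' A
  have hO : IsOpen O := hGGc.isOpen_inter_preimage hpi hAo
  let u₀ : ∀ i, EuclideanSpace ℝ (Fin (d i)) := fun i => h i (q i)
  have hu₀q : GG u₀ = q := funext fun i => (hGh i (q i) ⟨hqS i, hqV i⟩).2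
  have hu₀ : u₀ ∈ O := ⟨fun i _ => (hGh i (q i) ⟨hqS i, hqV i⟩).1, by
    rw [mem_preimage, hu₀q]; exact hqA⟩
  let R : (∀ i, EuclideanSpace ℝ (Fin (d i))) → ∀ s, Y s := fun u s =>
    f s (G (a s) (u (a s))) - g s (G (b s) (u (b s)))
  have hfG : ∀ u ∈ O, ∀ s, ContDiffAt ℝ ∞ (f s ∘ G (a s)) (u (a s)) := fun u hu s =>
    contMDiffAt_iff_contDiffAt.1 (((hA _ hu.2).2.1 s).comp _
      ((hG (a s)).contMDiffAt ((hU _).mem_nhds (hu.1 _ (mem_univ _)))))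
  have hgG : ∀ u ∈ O, ∀ s, ContDiffAt ℝ ∞ (g s ∘ G (b s)) (u (b s)) := fun u hu s =>
    contMDiffAt_iff_contDiffAt.1 (((hA _ hu.2).2.2 s).comp _
      ((hG (b s)).contMDiffAt ((hU _).mem_nhds (hu.1 _ (mem_univ _)))))
  have hR : ContDiffOn ℝ ∞ R O := contDiffOn_pi.2 fun s u hu =>
    ((ContDiffAt.comp u (f := fun u : ∀ i, EuclideanSpace ℝ (Fin (d i)) => u (a s)) (hfG u hu s)
      (contDiffAt_pi.1 contDiffAt_id (a s))).sub
      (ContDiffAt.comp u (f := fun u : ∀ i, EuclideanSpace ℝ (Fin (d i)) => u (b s)) (hgG u hu s)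
        (contDiffAt_pi.1 contDiffAt_id (b s)))).contDiffWithinAt
  have hsurj : Function.Surjective (fderiv ℝ R u₀) := by
    intro y
    obtain ⟨w, hw, hwy⟩ := hreg y
    -- Regularity is given on velocities of curves; here these become coordinate vectors, on which
    -- the derivative of `R` acts.
    choose w' hw' using fun i => exists_mfderiv_param_eq (hU i) (hV i) (hGU i) (hG i) (hG' i)
      (hh i) (hhG i) (hu₀.1 i (mem_univ i)) (congrFun hu₀q i) (hw i)
    have hGd : ∀ i, MDifferentiableAt 𝓘(ℝ, EuclideanSpace ℝ (Fin (d i))) (I i) (G i) (u₀ i) :=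
      fun i => ((hG i).contMDiffAt ((hU i).mem_nhds (hu₀.1 i (mem_univ i)))).mdifferentiableAt
        (by simp)
    have key : ∀ (i : ι) {Z : Type _} [NormedAddCommGroup Z] [NormedSpace ℝ Z] (k : N i → Z),
        MDifferentiableAt (I i) 𝓘(ℝ, Z) k (q i) → ∃ T : EuclideanSpace ℝ (Fin (d i)) →L[ℝ] Z,
          HasFDerivAt (k ∘ G i) T (u₀ i) ∧
          T (w' i) = (mfderiv (I i) 𝓘(ℝ, Z) k (q i) (w i) : Z) := by
      intro i Z _ _ k hk
      have h1 : G i (u₀ i) = q i := congrFun hu₀q i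
      have hk' : MDifferentiableAt (I i) 𝓘(ℝ, Z) k (G i (u₀ i)) := by rwa [h1]
      refine ⟨_, (hk'.hasMFDerivAt.comp (u₀ i) (hGd i).hasMFDerivAt).hasFDerivAt, ?_⟩
      refine (congrArg (mfderiv (I i) 𝓘(ℝ, Z) k (G i (u₀ i))) (hw' i)).trans ?_
      rw [h1]
    have h1 : HasFDerivAt R (fderiv ℝ R u₀) u₀ :=
      ((hR.contDiffAt (hO.mem_nhds hu₀)).differentiableAt (by simp)).hasFDerivAt
    refine ⟨w', funext fun s => ?_⟩
    obtain ⟨T₁, hT₁, hT₁w⟩ := key (a s) (f s) (((hf s).self_of_nhds).mdifferentiableAt (by simp))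
    obtain ⟨T₂, hT₂, hT₂w⟩ := key (b s) (g s) (((hg s).self_of_nhds).mdifferentiableAt (by simp))
    have h2 := (HasFDerivAt.comp u₀ (f := fun u : ∀ i, EuclideanSpace ℝ (Fin (d i)) => u (a s))
      hT₁ (hasFDerivAt_apply (a s) u₀)).sub
      (HasFDerivAt.comp u₀ (f := fun u : ∀ i, EuclideanSpace ℝ (Fin (d i)) => u (b s))
      hT₂ (hasFDerivAt_apply (b s) u₀))
    have h3 := (hasFDerivAt_pi'.1 h1 s).unique h2
    refine (congrArg (fun A : (∀ i, EuclideanSpace ℝ (Fin (d i))) →L[ℝ] Y s => A w') h3).trans ?_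
    change T₁ (w' (a s)) - T₂ (w' (b s)) = y s
    obtain ⟨z, hz₁, hz₂⟩ := hwy s
    rw [hT₁w, hT₂w, hz₁, hz₂, add_sub_cancel_left]
  have hdim : Module.finrank ℝ (∀ i, EuclideanSpace ℝ (Fin (d i))) =
      Module.finrank ℝ (∀ s, Y s) + e := by
    rw [Module.finrank_pi_fintype, Module.finrank_pi_fintype, ← he]
    simp
  obtain ⟨O', W, γ, π, hO', hu₀O', hO'O, hW, hγ, hγW, hπγ⟩ :=
    exists_param_levelSet hdim hO hR hu₀ hsurj
  have hγm : ∀ w ∈ W, γ w ∈ O' ∧ R (γ w) = 0 := fun w hw => by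
    have : γ w ∈ {u ∈ O' | R u = 0} := hγW ▸ mem_image_of_mem γ hw
    exact this
  let h' : (∀ i, N i) → ∀ i, EuclideanSpace ℝ (Fin (d i)) := fun x i => h i (x i)
  let Z : Set (∀ i, N i) := Set.pi univ fun i => S i ∩ V i
  have hh' : ContinuousOn h' Z := continuousOn_pi.2 fun i =>
    (hh i).comp (continuous_apply i).continuousOn fun u hu => hu i (mem_univ i)
  -- The preimage of `O'` is only relatively open in `Z`; `V₀` is an open set of the ambient product
  -- with the same trace.
  obtain ⟨V₀, hV₀, hV₀'⟩ := continuousOn_iff'.1 hh' O' hO'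
  have hhGG : ∀ u ∈ Set.pi univ U, h' (GG u) = u := fun u hu =>
    funext fun i => hhG i (hu i (mem_univ i))
  have hGGZ : ∀ u ∈ Set.pi univ U, GG u ∈ Z := fun u hu i _ => hGm i _ (hu i (mem_univ i))
  have hXZ : ∀ x ∈ X ∩ (A ∩ Set.pi univ V ∩ V₀), x ∈ Z ∧ h' x ∈ O' ∧ GG (h' x) = x ∧
      R (h' x) = 0 := by
    rintro x ⟨hx, ⟨hxA, hxV⟩, hxV₀⟩
    have h1 := (hA x hxA).1.1 hx
    have hxZ : x ∈ Z := fun i _ => ⟨h1.1 i, hxV i (mem_univ i)⟩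
    have h2 : GG (h' x) = x := funext fun i => (hGh i _ (hxZ i (mem_univ i))).2
    have h3 : x ∈ h' ⁻¹' O' ∩ Z := hV₀' ▸ ⟨hxV₀, hxZ⟩
    refine ⟨hxZ, h3.1, h2, funext fun s => sub_eq_zero.2 ?_⟩
    change f s (GG (h' x) (a s)) = g s (GG (h' x) (b s))
    rw [h2]
    exact h1.2 s
  refine ⟨W, A ∩ Set.pi univ V ∩ V₀, GG ∘ γ, π ∘ h', hW,
    (hAo.inter (isOpen_set_pi finite_univ fun i _ => hV i)).inter hV₀,
    ⟨⟨hqA, fun i _ => hqV i⟩, ?_⟩, ?_, fun i => ?_, fun w hw => ?_, ?_, ?_⟩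
  · have h1 : q ∈ h' ⁻¹' O' ∩ Z := ⟨hu₀O', fun i _ => ⟨hqS i, hqV i⟩⟩
    rw [hV₀'] at h1
    exact h1.1
  · ext x
    constructor
    · rintro ⟨w, hw, rfl⟩
      obtain ⟨h1, h2⟩ := hγm w hw
      have h3 := hO'O h1
      have h4 := hGGZ _ h3.1
      refine ⟨(hA _ h3.2).1.2 ⟨fun i => (h4 i (mem_univ i)).1,
        fun s => sub_eq_zero.1 (congrFun h2 s)⟩, ⟨h3.2, fun i _ => (h4 i (mem_univ i)).2⟩, ?_⟩
      have h5 : GG (γ w) ∈ h' ⁻¹' O' ∩ Z := ⟨by rw [mem_preimage, hhGG _ h3.1]; exact h1, h4⟩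
      rw [hV₀'] at h5
      exact h5.1
    · intro hx
      obtain ⟨h1, h2, h3, h4⟩ := hXZ x hx
      have h5 : h' x ∈ γ '' W := hγW ▸ ⟨h2, h4⟩
      obtain ⟨w, hw, hwx⟩ := h5
      exact ⟨w, hw, by rw [Function.comp_apply, hwx, h3]⟩
  · intro w hw
    have h1 := (contDiffOn_pi.1 hγ i).contDiffAt (hW.mem_nhds hw)
    exact (((hG i).contMDiffAt ((hU i).mem_nhds ((hO'O (hγm w hw).1).1 i (mem_univ i)))).comp w
      (contMDiffAt_iff_contDiffAt.2 h1)).contMDiffWithinAt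
  · intro v v' hvv'
    apply fderiv_injective_of_leftInvOn hW hγ hπγ hw
    have h1 := ((hγ.contDiffAt (hW.mem_nhds hw)).differentiableAt (by simp)).hasFDerivAt
    funext i
    have h2 := (hasFDerivAt_pi'.1 h1 i)
    have h3 : MDifferentiableAt 𝓘(ℝ, EuclideanSpace ℝ (Fin (d i))) (I i) (G i) (γ w i) :=
      ((hG i).contMDiffAt ((hU i).mem_nhds ((hO'O (hγm w hw).1).1 i
        (mem_univ i)))).mdifferentiableAt (by simp)
    have h4 := (h3.hasMFDerivAt.comp w h2.hasMFDerivAt).mfderiv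
    refine hG' i _ ((hO'O (hγm w hw).1).1 i (mem_univ i)) ?_
    have h5 : ∀ v, (mfderiv 𝓘(ℝ, EuclideanSpace ℝ (Fin e)) (I i) (fun u' => (GG ∘ γ) u' i) w v :
        F i) = mfderiv 𝓘(ℝ, EuclideanSpace ℝ (Fin (d i))) (I i) (G i) (γ w i)
          (fderiv ℝ γ w v i) := fun v =>
      congrArg (fun T : EuclideanSpace ℝ (Fin e) →L[ℝ] F i => T v) h4
    exact (h5 v).symm.trans ((congrFun hvv' i).trans (h5 v'))
  · exact π.continuous.comp_continuousOn (hh'.mono fun x hx => (hXZ x hx).1)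
  · intro w hw
    rw [Function.comp_apply, Function.comp_apply, hhGG _ (hO'O (hγm w hw).1).1, hπγ hw]

end RegularFiberProduct

end Quilt

end

noncomputable section


namespace Quilt

/-! ### Fiber products over an arc -/

section ArcSums

variable {r : ℕ} {j ℓ : ZMod (r + 1)}

theorem sub_one_mem_arc {k : ZMod (r + 1)} (hk : k ∈ arc j ℓ) (hkj : k ≠ j) :
    k - 1 ∈ arc j ℓ ∧ k - 1 ≠ ℓ := by
  have h1 := val_add_one_sub (j := j) (k := k - 1) (by rwa [sub_add_cancel])
  rw [sub_add_cancel] at h1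
  have h2 : (k - j).val ≤ (ℓ - j).val := hk
  refine ⟨?_, ?_⟩
  · change (k - 1 - j).val ≤ (ℓ - j).val
    omega
  · intro h
    rw [h] at h1
    omega

/-- The seams of an arc: the indices `k` such that both `k` and `k + 1` occur, in this order. -/
abbrev Seam (j ℓ : ZMod (r + 1)) := {k : ZMod (r + 1) // k ∈ arc j ℓ ∧ k ≠ ℓ}

/-- The factor before a seam. -/
abbrev Seam.left (s : Seam j ℓ) : arc j ℓ := ⟨s.1, s.2.1⟩

/-- The factor after a seam. -/
abbrev Seam.right (s : Seam j ℓ) : arc j ℓ := ⟨s.1 + 1, (add_one_mem_arc s.2.1 s.2.2).1⟩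

/-- If the arc is the whole cycle, factor `ℓ` is also followed by a factor of the arc, namely `j`;
no condition arises there because `ℓ + 1 ∉ I`. -/
theorem mem_seamSet_arc_iff {M : ZMod (r + 1) → Type*} {I : Set (ZMod (r + 1))}
    (hc : IsConsecutive I j ℓ) {Γ : ∀ i, Set (M i × M i)}
    {q : ∀ k : arc j ℓ, M k × M (k + 1)} : q ∈ seamSet (arc j ℓ) I Γ ↔
      ∀ s : Seam j ℓ, ((q s.left).2, (q s.right).1) ∈ Γ (s.1 + 1) := by
  refine ⟨fun h s => h s.1 s.2.1 s.right.2 (hc.2.2 _ s.2.1 s.2.2), fun h k hk hk' hkI => ?_⟩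
  exact h ⟨k, hk, fun hkℓ => hc.2.1 (hkℓ ▸ hkI)⟩

variable {G : Type*} [AddCommMonoid G] [Fintype (arc j ℓ)] [Fintype (Seam j ℓ)]

/-- Every factor but the last precedes exactly one seam. With its counterpart for following factors,
this makes sums over the arc telescope, both for dimensions and for symplectic pairings. -/
theorem sum_arc_eq_left (f : arc j ℓ → G) :
    ∑ k, f k = f ⟨ℓ, right_mem_arc j ℓ⟩ + ∑ s : Seam j ℓ, f s.left := by
  classical
  rw [Fintype.sum_eq_add_sum_subtype_ne f ⟨ℓ, right_mem_arc j ℓ⟩]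
  congr 1
  refine (Fintype.sum_bijective (fun s : Seam j ℓ => (⟨s.left, fun h => s.2.2
    (congrArg Subtype.val h)⟩ : {k : arc j ℓ // k ≠ ⟨ℓ, right_mem_arc j ℓ⟩})) ⟨?_, ?_⟩ _ _
      fun _ => rfl).symm
  · intro s s' h
    exact Subtype.ext (congrArg (fun k => (k.1.1 : ZMod (r + 1))) h)
  · rintro ⟨⟨k, hk⟩, hk'⟩
    exact ⟨⟨k, hk, fun h => hk' (Subtype.ext h)⟩, rfl⟩

theorem sum_arc_eq_right (f : arc j ℓ → G) :
    ∑ k, f k = f ⟨j, left_mem_arc j ℓ⟩ + ∑ s : Seam j ℓ, f s.right := by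
  classical
  rw [Fintype.sum_eq_add_sum_subtype_ne f ⟨j, left_mem_arc j ℓ⟩]
  congr 1
  refine (Fintype.sum_bijective (fun s : Seam j ℓ => (⟨s.right, fun h =>
    (add_one_mem_arc s.2.1 s.2.2).2 (congrArg Subtype.val h)⟩ :
      {k : arc j ℓ // k ≠ ⟨j, left_mem_arc j ℓ⟩})) ⟨?_, ?_⟩ _ _ fun _ => rfl).symm
  · intro s s' h
    exact Subtype.ext (add_right_cancel (congrArg (fun k => (k.1.1 : ZMod (r + 1))) h))
  · rintro ⟨⟨k, hk⟩, hk'⟩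
    have h := sub_one_mem_arc hk fun h => hk' (Subtype.ext h)
    exact ⟨⟨k - 1, h⟩, Subtype.ext (Subtype.ext (sub_add_cancel k 1))⟩

end ArcSums

/-! ### Derivatives of components in a product manifold. -/

section ProdCurve

variable {F B N F' B' N' : Type*} [NormedAddCommGroup F] [NormedSpace ℝ F] [TopologicalSpace B]
  [TopologicalSpace N] [ChartedSpace B N] [NormedAddCommGroup F'] [NormedSpace ℝ F']
  [TopologicalSpace B'] [TopologicalSpace N'] [ChartedSpace B' N']
  {I : ModelWithCorners ℝ F B} {I' : ModelWithCorners ℝ F' B'}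

theorem mfderiv_curve_fst {γ : ℝ → N × N'} (hγ : MDifferentiableAt 𝓘(ℝ, ℝ) (I.prod I') γ 0) :
    (mfderiv 𝓘(ℝ, ℝ) I (fun t => (γ t).1) 0 (1 : ℝ) : F) =
      (mfderiv 𝓘(ℝ, ℝ) (I.prod I') γ 0 (1 : ℝ) : F × F').1 :=
  congrArg (fun A : ℝ →L[ℝ] F => A 1) ((hasMFDerivAt_fst (γ 0)).comp (0 : ℝ) hγ.hasMFDerivAt).mfderiv

theorem mfderiv_curve_snd {γ : ℝ → N × N'} (hγ : MDifferentiableAt 𝓘(ℝ, ℝ) (I.prod I') γ 0) :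
    (mfderiv 𝓘(ℝ, ℝ) I' (fun t => (γ t).2) 0 (1 : ℝ) : F') =
      (mfderiv 𝓘(ℝ, ℝ) (I.prod I') γ 0 (1 : ℝ) : F × F').2 :=
  congrArg (fun A : ℝ →L[ℝ] F' => A 1) ((hasMFDerivAt_snd (γ 0)).comp (0 : ℝ) hγ.hasMFDerivAt).mfderiv

variable {Z : Type*} [NormedAddCommGroup Z] [NormedSpace ℝ Z]

theorem mfderiv_comp_fst_apply {χ : N → Z} {p : N × N'} (hχ : MDifferentiableAt I 𝓘(ℝ, Z) χ p.1)
    (v : F × F') :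
    (mfderiv (I.prod I') 𝓘(ℝ, Z) (fun x : N × N' => χ x.1) p v : Z) =
      mfderiv I 𝓘(ℝ, Z) χ p.1 v.1 :=
  congrArg (fun A : F × F' →L[ℝ] Z => A v)
    (HasMFDerivAt.comp p hχ.hasMFDerivAt (hasMFDerivAt_fst p)).mfderiv

theorem mfderiv_comp_snd_apply {χ : N' → Z} {p : N × N'} (hχ : MDifferentiableAt I' 𝓘(ℝ, Z) χ p.2)
    (v : F × F') :
    (mfderiv (I.prod I') 𝓘(ℝ, Z) (fun x : N × N' => χ x.2) p v : Z) =
      mfderiv I' 𝓘(ℝ, Z) χ p.2 v.2 :=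
  congrArg (fun A : F × F' →L[ℝ] Z => A v)
    (HasMFDerivAt.comp p hχ.hasMFDerivAt (hasMFDerivAt_snd p)).mfderiv

end ProdCurve

/-! ### Transversal fiber products over an arc as submanifolds. -/

section ArcFiberProduct

variable {r : ℕ} {E M : ZMod (r + 1) → Type*} [∀ j, NormedAddCommGroup (E j)]
  [∀ j, NormedSpace ℝ (E j)] [∀ j, TopologicalSpace (M j)]
  [∀ j, ChartedSpace (E j) (M j)]
  {Λ : ∀ k, Set (M k × M (k + 1))} {I K : Set (ZMod (r + 1))} {j ℓ : ZMod (r + 1)}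

theorem mem_tangentSet_of_mem_prodSet {q : ∀ k : K, M k × M (k + 1)}
    {v : ∀ k : K, TangentSpace (slotModel E K k) (q k)}
    (hv : v ∈ piTangentSet (slotModel E K) (prodSet K Λ) q) (k : K) :
    v k ∈ tangentSet (slotModel E K k) (Λ k) (q k) := by
  obtain ⟨γ, h0, hγ, hγv, hS⟩ := hv
  exact ⟨fun t => γ t k, congrFun h0 k, hγ k, hγv k, hS.mono fun t ht => ht k⟩

theorem piTangentSet_mono {S S' : Set (∀ k : K, M k × M (k + 1))} (h : S ⊆ S')
    {q : ∀ k : K, M k × M (k + 1)} :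
    piTangentSet (slotModel E K) S q ⊆ piTangentSet (slotModel E K) S' q := by
  rintro v ⟨γ, h0, hγ, hγv, hS⟩
  exact ⟨γ, h0, hγ, hγv, hS.mono fun t ht => h ht⟩

/-- The two components agree along a representing curve, hence so do their velocities. -/
theorem snd_eq_fst_of_mem_seamSet {q : ∀ k : K, M k × M (k + 1)} {v : ∀ k : K, E k × E (k + 1)}
    (hv : (fun k => v k : ∀ k : K, TangentSpace (slotModel E K k) (q k)) ∈
      piTangentSet (slotModel E K) (seamSet K I diagonals) q)
    {k : ZMod (r + 1)} (hk : k ∈ K) (hk' : k + 1 ∈ K) (hkI : k + 1 ∈ I) :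
    (v ⟨k, hk⟩).2 = (v ⟨k + 1, hk'⟩).1 := by
  obtain ⟨γ, h0, hγ, hγv, hS⟩ := hv
  have h1 : (fun t => (γ t ⟨k, hk⟩).2) =ᶠ[𝓝 0] fun t => (γ t ⟨k + 1, hk'⟩).1 :=
    hS.mono fun t ht => ht k hk hk' hkI
  have h2 := mfderiv_curve_snd ((hγ ⟨k, hk⟩).mdifferentiableAt (by simp))
  have h3 := mfderiv_curve_fst ((hγ ⟨k + 1, hk'⟩).mdifferentiableAt (by simp))
  have h4 : (mfderiv 𝓘(ℝ, ℝ) 𝓘(ℝ, E (k + 1)) (fun t => (γ t ⟨k, hk⟩).2) 0 (1 : ℝ) : E (k + 1)) =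
      mfderiv 𝓘(ℝ, ℝ) 𝓘(ℝ, E (k + 1)) (fun t => (γ t ⟨k + 1, hk'⟩).1) 0 (1 : ℝ) :=
    congrArg (fun A : ℝ →L[ℝ] E (k + 1) => A 1) h1.mfderiv_eq
  refine (congrArg Prod.snd (hγv ⟨k, hk⟩)).symm.trans (h2.symm.trans (h4.trans (h3.trans ?_)))
  exact congrArg Prod.fst (hγv ⟨k + 1, hk'⟩)

variable [∀ j, FiniteDimensional ℝ (E j)] [∀ j, IsManifold 𝓘(ℝ, E j) ∞ (M j)]

/-- The dimension of the fiber product over an arc. -/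
theorem exists_dim_fiberProduct {d : ZMod (r + 1) → ℕ}
    (hd : ∀ k, 2 * d k = Module.finrank ℝ (E k) + Module.finrank ℝ (E (k + 1)))
    [Fintype (arc j ℓ)] [Fintype (Seam j ℓ)] :
    ∃ e : ℕ, ∑ k : arc j ℓ, d k = ∑ s : Seam j ℓ, Module.finrank ℝ (E (s.1 + 1)) + e ∧
      2 * e = Module.finrank ℝ (E j) + Module.finrank ℝ (E (ℓ + 1)) := by
  have h1 : 2 * ∑ k : arc j ℓ, d k = ∑ k : arc j ℓ, Module.finrank ℝ (E k) +
      ∑ k : arc j ℓ, Module.finrank ℝ (E (k + 1)) := by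
    rw [Finset.mul_sum, ← Finset.sum_add_distrib]
    exact Finset.sum_congr rfl fun k _ => hd k
  have h2 : ∑ k : arc j ℓ, Module.finrank ℝ (E k) = Module.finrank ℝ (E j) +
      ∑ s : Seam j ℓ, Module.finrank ℝ (E (s.1 + 1)) := sum_arc_eq_right _
  have h3 : ∑ k : arc j ℓ, Module.finrank ℝ (E (k + 1)) = Module.finrank ℝ (E (ℓ + 1)) +
      ∑ s : Seam j ℓ, Module.finrank ℝ (E (s.1 + 1)) := sum_arc_eq_left _
  -- Each seam dimension occurs in both `h2` and `h3`, so this natural subtraction does not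
  -- truncate.
  exact ⟨∑ k : arc j ℓ, d k - ∑ s : Seam j ℓ, Module.finrank ℝ (E (s.1 + 1)), by omega, by omega⟩

/-- Each diagonal condition becomes a vector equation in one chart around the common seam point, and
transversality provides the regularity required by `exists_param_fiberProduct`. -/
theorem isPiSubmanifold_fiberProduct (hc : IsConsecutive I j ℓ) {d : ZMod (r + 1) → ℕ}
    (hΛ : ∀ k, IsSubmanifold (𝓘(ℝ, E k).prod 𝓘(ℝ, E (k + 1))) (d k) (Λ k))
    (hT : IsTransversalFiberProduct E (arc j ℓ) I Λ diagonals) [Fintype (arc j ℓ)]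
    [Fintype (Seam j ℓ)] {e : ℕ}
    (he : ∑ k : arc j ℓ, d k = ∑ s : Seam j ℓ, Module.finrank ℝ (E (s.1 + 1)) + e) :
    IsPiSubmanifold (slotModel E (arc j ℓ)) e (fiberProduct (arc j ℓ) I Λ diagonals) := by
  classical
  intro q hq
  have hqs : ∀ s : Seam j ℓ, (q s.left).2 = (q s.right).1 := (mem_seamSet_arc_iff hc).1 hq.2
  let χ : ∀ s : Seam j ℓ, M (s.1 + 1) → E (s.1 + 1) := fun s =>
    extChartAt 𝓘(ℝ, E (s.1 + 1)) (q s.left).2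
  have hO : ∀ s : Seam j ℓ, IsOpen (extChartAt 𝓘(ℝ, E (s.1 + 1)) (q s.left).2).source :=
    fun s => isOpen_extChartAt_source _
  have hq1 : ∀ s : Seam j ℓ, (q s.left).2 ∈ (extChartAt 𝓘(ℝ, E (s.1 + 1)) (q s.left).2).source :=
    fun s => mem_extChartAt_source _
  have hq2 : ∀ s : Seam j ℓ, (q s.right).1 ∈ (extChartAt 𝓘(ℝ, E (s.1 + 1)) (q s.left).2).source :=
    fun s => hqs s ▸ hq1 s
  have hχ : ∀ s : Seam j ℓ, ∀ x ∈ (extChartAt 𝓘(ℝ, E (s.1 + 1)) (q s.left).2).source,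
      ContMDiffAt 𝓘(ℝ, E (s.1 + 1)) 𝓘(ℝ, E (s.1 + 1)) ∞ (χ s) x := fun s x hx =>
    contMDiffAt_extChartAt' (by rwa [extChartAt_source] at hx)
  have e1 : ∀ s : Seam j ℓ, ∀ᶠ x : M s.1 × M (s.1 + 1) in 𝓝 (q s.left),
      x.2 ∈ (extChartAt 𝓘(ℝ, E (s.1 + 1)) (q s.left).2).source := fun s =>
    continuousAt_snd.eventually_mem ((hO s).mem_nhds (hq1 s))
  have e2 : ∀ s : Seam j ℓ, ∀ᶠ x : M (s.1 + 1) × M (s.1 + 1 + 1) in 𝓝 (q s.right),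
      x.1 ∈ (extChartAt 𝓘(ℝ, E (s.1 + 1)) (q s.left).2).source := fun s =>
    continuousAt_fst.eventually_mem ((hO s).mem_nhds (hq2 s))
  refine exists_param_fiberProduct (S := fun k : arc j ℓ => Λ k) (d := fun k => d k)
    (Y := fun s : Seam j ℓ => E (s.1 + 1)) (a := Seam.left) (b := Seam.right)
    (f := fun s x => χ s x.2) (g := fun s x => χ s x.1) (fun k => hΛ k) hq
    (fun s => (e1 s).mono fun x hx => (hχ s _ hx).comp x contMDiffAt_snd)
    (fun s => (e2 s).mono fun x hx => (hχ s _ hx).comp x contMDiffAt_fst) ?_ ?_ he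
  · have h1 : ∀ᶠ x in 𝓝 q, ∀ s : Seam j ℓ,
        (x s.left).2 ∈ (extChartAt 𝓘(ℝ, E (s.1 + 1)) (q s.left).2).source :=
      Filter.eventually_all.2 fun s => (continuous_apply s.left).continuousAt.eventually (e1 s)
    have h2 : ∀ᶠ x in 𝓝 q, ∀ s : Seam j ℓ,
        (x s.right).1 ∈ (extChartAt 𝓘(ℝ, E (s.1 + 1)) (q s.left).2).source :=
      Filter.eventually_all.2 fun s => (continuous_apply s.right).continuousAt.eventually (e2 s)
    filter_upwards [h1, h2] with x hx1 hx2
    refine and_congr Iff.rfl ((mem_seamSet_arc_iff hc).trans (forall_congr' fun s => ?_))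
    exact ⟨fun h => congrArg (χ s) h, fun h => (extChartAt _ _).injOn (hx1 s) (hx2 s) h⟩
  · intro y
    have hA : ∀ s : Seam j ℓ, ∃ y' : E (s.1 + 1),
        (mfderiv 𝓘(ℝ, E (s.1 + 1)) 𝓘(ℝ, E (s.1 + 1)) (χ s) (q s.left).2 y' : E (s.1 + 1)) = y s :=
      fun s => (isInvertible_mfderiv_extChartAt (hq1 s)).surjective (y s)
    choose y' hy' using hA
    -- The vector to be split has the prescribed jump in the second component before each seam and 0
    -- elsewhere. Since `b` has no jumps, those of `a` are the prescribed ones.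
    obtain ⟨a, ha, b, hb, hab⟩ := hT q hq fun k =>
      ((0, if h : k.1 ≠ ℓ then y' ⟨k.1, k.2, h⟩ else 0) : E k × E (k + 1))
    refine ⟨a, mem_tangentSet_of_mem_prodSet ha, fun s => ?_⟩
    have hb' := snd_eq_fst_of_mem_seamSet (v := b) hb s.2.1 s.right.2 (hc.2.2 _ s.2.1 s.2.2)
    let a' : ∀ k : arc j ℓ, E k × E (k + 1) := a
    let b' : ∀ k : arc j ℓ, E k × E (k + 1) := b
    have hab' : ∀ k, a' k + b' k = ((0, if h : k.1 ≠ ℓ then y' ⟨k.1, k.2, h⟩ else 0) :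
      E k × E (k + 1)) := fun k => congrFun hab k
    have h1 : (a' s.left).2 + (b' s.left).2 = y' s :=
      (congrArg Prod.snd (hab' s.left)).trans (dif_pos s.2.2)
    have h2 : (a' s.right).1 + (b' s.right).1 = 0 := congrArg Prod.fst (hab' s.right)
    have h3 : (b' s.left).2 = (b' s.right).1 := hb'
    have h4 : (a' s.left).2 = (a' s.right).1 + y' s := by
      rw [← h1, h3, add_comm (a' s.left).2, ← add_assoc, h2, zero_add]
    let D : E (s.1 + 1) →L[ℝ] E (s.1 + 1) :=
      mfderiv 𝓘(ℝ, E (s.1 + 1)) 𝓘(ℝ, E (s.1 + 1)) (χ s) (q s.left).2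
    refine ⟨D (a' s.right).1, ?_, ?_⟩
    · refine (mfderiv_comp_snd_apply ((hχ s _ (hq1 s)).mdifferentiableAt (by simp)) _).trans ?_
      refine (congrArg D h4).trans ((map_add D _ _).trans ?_)
      exact congrArg (fun z => D (a' s.right).1 + z) (hy' s)
    · refine (mfderiv_comp_fst_apply ((hχ s _ (hq2 s)).mdifferentiableAt (by simp)) _).trans ?_
      change (mfderiv 𝓘(ℝ, E (s.1 + 1)) 𝓘(ℝ, E (s.1 + 1)) (χ s) (q s.right).1 (a' s.right).1 :
        E (s.1 + 1)) = D (a' s.right).1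
      rw [← hqs s]
      rfl

end ArcFiberProduct

end Quilt

end

noncomputable section


namespace Quilt

/-! ### The projection to the outer components -/

section Outer

variable {r : ℕ} {E M : ZMod (r + 1) → Type*} [∀ j, NormedAddCommGroup (E j)]
  [∀ j, NormedSpace ℝ (E j)] [∀ j, TopologicalSpace (M j)]
  [∀ j, ChartedSpace (E j) (M j)]
  {Λ : ∀ k, Set (M k × M (k + 1))} {I : Set (ZMod (r + 1))} {j ℓ : ZMod (r + 1)}

/-- The outer projection of a transversal fiber product of isotropic correspondences is an
immersion. -/
theorem injOn_outerProj (σ : ∀ j, SymplecticForm (E j) (M j)) (hc : IsConsecutive I j ℓ)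
    (hiso : ∀ k, ∀ p ∈ Λ k, ∀ v ∈ tangentSet (𝓘(ℝ, E k).prod 𝓘(ℝ, E (k + 1))) (Λ k) p,
      ∀ w ∈ tangentSet (𝓘(ℝ, E k).prod 𝓘(ℝ, E (k + 1))) (Λ k) p,
        -(σ k).form p.1 ![v.1, w.1] + (σ (k + 1)).form p.2 ![v.2, w.2] = 0)
    (hT : IsTransversalFiberProduct E (arc j ℓ) I Λ diagonals)
    {q : ∀ k : arc j ℓ, M k × M (k + 1)} (hq : q ∈ fiberProduct (arc j ℓ) I Λ diagonals) :
    InjOn (outerProj (M := E) j ℓ)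
      (piTangentSet (slotModel E (arc j ℓ)) (fiberProduct (arc j ℓ) I Λ diagonals) q) := by
  classical
  let B : ∀ i (m : M i), E i →L[ℝ] E i →L[ℝ] ℝ := fun i m => bilin ((σ i).form m)
  have hB : ∀ i m (x y : E i), B i m x y = (σ i).form m ![x, y] := fun i m x y =>
    bilin_apply (E := E i) ((σ i).form m) x y
  have hBnd : ∀ i m (x : E i), (∀ y, B i m x y = 0) → x = 0 := fun i m x h =>
    (σ i).nondegenerate m x fun y => (hB i m x y).symm.trans (h y)
  let S : ∀ k : arc j ℓ, E k × E (k + 1) → E k × E (k + 1) → ℝ := fun k x y =>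
    -B k (q k).1 x.1 y.1 + B (k + 1) (q k).2 x.2 y.2
  have hS : ∀ k x y y', S k x (y + y') = S k x y + S k x y' := by
    intro k x y y'
    simp only [S, Prod.fst_add, Prod.snd_add, map_add]
    ring
  have hS0 : ∀ k x, S k x 0 = 0 := by
    intro k x
    simp [S]
  have hS' : ∀ k x x' y, S k (x - x') y = S k x y - S k x' y := by
    intro k x x' y
    simp only [S, Prod.fst_sub, Prod.snd_sub, map_sub, sub_apply]
    ring
  have hSiso : ∀ (x y : ∀ k : arc j ℓ, E k × E (k + 1)),
      x ∈ piTangentSet (slotModel E (arc j ℓ)) (prodSet (arc j ℓ) Λ) q →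
      y ∈ piTangentSet (slotModel E (arc j ℓ)) (prodSet (arc j ℓ) Λ) q →
      ∀ k, S k (x k) (y k) = 0 := by
    intro x y hx hy k
    have := hiso k (q k) (hq.1 k) _ (mem_tangentSet_of_mem_prodSet hx k) _
      (mem_tangentSet_of_mem_prodSet hy k)
    refine Eq.trans ?_ this
    change -B k (q k).1 (x k).1 (y k).1 + B (k + 1) (q k).2 (x k).2 (y k).2 = _
    rw [hB, hB]
  have hqs : ∀ s : Seam j ℓ, (q s.left).2 = (q s.right).1 := (mem_seamSet_arc_iff hc).1 hq.2
  intro (v : ∀ k : arc j ℓ, E k × E (k + 1)) hv (v' : ∀ k : arc j ℓ, E k × E (k + 1)) hv' hvv'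
  -- The sets of velocities are not known to be linear, so `u` need not be tangent; isotropy is
  -- applied to `v` and `v'` separately and the results subtracted.
  let u : ∀ k : arc j ℓ, E k × E (k + 1) := fun k => v k - v' k
  have hvj : (v ⟨j, left_mem_arc j ℓ⟩).1 = (v' ⟨j, left_mem_arc j ℓ⟩).1 :=
    (Prod.mk.inj hvv').1
  have hvℓ : (v ⟨ℓ, right_mem_arc j ℓ⟩).2 = (v' ⟨ℓ, right_mem_arc j ℓ⟩).2 :=
    (Prod.mk.inj hvv').2
  have huj : (u ⟨j, left_mem_arc j ℓ⟩).1 = 0 := sub_eq_zero.2 hvj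
  have huℓ : (u ⟨ℓ, right_mem_arc j ℓ⟩).2 = 0 := sub_eq_zero.2 hvℓ
  have hus : ∀ s : Seam j ℓ, (u s.left).2 = (u s.right).1 := by
    intro s
    have h1 := snd_eq_fst_of_mem_seamSet (v := v) (piTangentSet_mono inter_subset_right hv) s.2.1
      s.right.2 (hc.2.2 _ s.2.1 s.2.2)
    have h2 := snd_eq_fst_of_mem_seamSet (v := v') (piTangentSet_mono inter_subset_right hv') s.2.1
      s.right.2 (hc.2.2 _ s.2.1 s.2.2)
    change (v s.left).2 - (v' s.left).2 = (v s.right).1 - (v' s.right).1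
    rw [h1, h2]
  have : Fintype (arc j ℓ) := Fintype.ofFinite _
  have : Fintype (Seam j ℓ) := Fintype.ofFinite _
  -- Transversality splits `t` as `a + b`. Isotropy kills the pairing with `a`. In the pairing with
  -- `b` the outer terms vanish with the outer components of `u`, and the two terms at each seam
  -- cancel by the opposite signs.
  have hsum : ∀ t : ∀ k : arc j ℓ, E k × E (k + 1), ∑ k, S k (u k) (t k) = 0 := by
    intro t
    obtain ⟨a, ha, b, hb, hab⟩ := hT q hq t
    let a' : ∀ k : arc j ℓ, E k × E (k + 1) := a
    let b' : ∀ k : arc j ℓ, E k × E (k + 1) := b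
    have hab' : ∀ k, t k = a' k + b' k := fun k => (congrFun hab k).symm
    have h1 : ∀ k, S k (u k) (t k) =
        -B k (q k).1 (u k).1 (b' k).1 + B (k + 1) (q k).2 (u k).2 (b' k).2 := by
      intro k
      rw [hab', hS, hS', hSiso v a' (piTangentSet_mono inter_subset_left hv) ha,
        hSiso v' a' (piTangentSet_mono inter_subset_left hv') ha, sub_zero, zero_add]
    have h2 : ∀ s : Seam j ℓ, (b' s.left).2 = (b' s.right).1 := fun s =>
      snd_eq_fst_of_mem_seamSet (v := b') hb s.2.1 s.right.2 (hc.2.2 _ s.2.1 s.2.2)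
    have h3 : ∑ k : arc j ℓ, B k (q k).1 (u k).1 (b' k).1 =
        ∑ s : Seam j ℓ, B (s.1 + 1) (q s.right).1 (u s.right).1 (b' s.right).1 := by
      rw [sum_arc_eq_right, huj]
      simp
    have h4 : ∑ k : arc j ℓ, B (k + 1) (q k).2 (u k).2 (b' k).2 =
        ∑ s : Seam j ℓ, B (s.1 + 1) (q s.left).2 (u s.left).2 (b' s.left).2 := by
      rw [sum_arc_eq_left, huℓ]
      simp
    rw [Finset.sum_congr rfl fun k _ => h1 k, Finset.sum_add_distrib, Finset.sum_neg_distrib, h3,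
      h4, neg_add_eq_zero]
    exact Finset.sum_congr rfl fun s _ => by rw [hqs, hus, h2]
  -- Testing with `t` supported in one factor isolates each summand; nondegeneracy then gives `u =
  -- 0`.
  have hu : ∀ k y, S k (u k) y = 0 := by
    intro k y
    have h1 := hsum (Pi.single k y)
    rw [Finset.sum_eq_single k (fun k' _ hk' => by rw [Pi.single_eq_of_ne hk', hS0])
      (fun h => absurd (Finset.mem_univ k) h), Pi.single_eq_same] at h1
    exact h1
  funext k
  refine Prod.ext (sub_eq_zero.1 (hBnd _ (q k).1 (u k).1 fun y => ?_))
    (sub_eq_zero.1 (hBnd _ (q k).2 (u k).2 fun y => ?_))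
  · simpa [S] using hu k (y, 0)
  · simpa [S] using hu k (0, y)

end Outer

/-! ### Chains of relations and the geometric composition. -/

section Composition

variable {r : ℕ} {M : ZMod (r + 1) → Type*} {Λ : ∀ k, Set (M k × M (k + 1))}
  {I : Set (ZMod (r + 1))} {j ℓ : ZMod (r + 1)}

theorem chainRel_of_seams {q : ∀ k : arc j ℓ, M k × M (k + 1)} (hq : q ∈ prodSet (arc j ℓ) Λ)
    (hs : ∀ s : Seam j ℓ, (q s.left).2 = (q s.right).1) :
    ∀ k (hk : k ∈ arc j ℓ),
      ChainRel Λ j (k - j).val k (q ⟨j, left_mem_arc j ℓ⟩).1 (q ⟨k, hk⟩).2 := by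
  intro k hk
  refine arc_induction (p := fun k => ∀ hk : k ∈ arc j ℓ,
    ChainRel Λ j (k - j).val k (q ⟨j, left_mem_arc j ℓ⟩).1 (q ⟨k, hk⟩).2) ?_ ?_ k hk hk
  · intro _
    rw [sub_self, ZMod.val_zero]
    exact .single (hq ⟨j, left_mem_arc j ℓ⟩)
  · intro k hk hkℓ _ ih hk'
    rw [val_add_one_sub (add_one_mem_arc hk hkℓ).2]
    refine .step (ih hk) ?_
    have h1 := hs ⟨k, hk, hkℓ⟩
    change (q ⟨k, hk⟩).2 = (q ⟨k + 1, hk'⟩).1 at h1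
    rw [h1]
    exact hq ⟨k + 1, hk'⟩

theorem mem_arc_add_one_iff (h : ℓ + 1 ≠ j) {k : ZMod (r + 1)} :
    k ∈ arc j (ℓ + 1) ↔ k ∈ arc j ℓ ∨ k = ℓ + 1 := by
  have h1 := val_add_one_sub h
  change (k - j).val ≤ (ℓ + 1 - j).val ↔ (k - j).val ≤ (ℓ - j).val ∨ _
  rw [h1, Nat.le_succ_iff, ← Nat.add_one, ← h1]
  exact or_congr Iff.rfl ⟨fun h => sub_left_injective (ZMod.val_injective _ h), fun h => by rw [h]⟩

theorem add_one_notMem_arc (h : ℓ + 1 ≠ j) : ℓ + 1 ∉ arc j ℓ := by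
  change ¬ (ℓ + 1 - j).val ≤ (ℓ - j).val
  rw [val_add_one_sub h]
  omega

/-- The condition on `n` confines the chain to less than one full turn past `j`, so each factor is
used at most once and the links of the chain define a tuple. -/
theorem exists_seams_of_chainRel {n : ℕ} {a : M j} {c : M (ℓ + 1)} (h : ChainRel Λ j n ℓ a c)
    (hn : n = (ℓ - j).val) : ∃ q ∈ prodSet (arc j ℓ) Λ,
      (∀ s : Seam j ℓ, (q s.left).2 = (q s.right).1) ∧ outerProj j ℓ q = (a, c) := by
  classical
  induction h with
  | @single a b hab =>
    have hk : ∀ k : arc j j, k.1 = j := fun k => by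
      have h1 : (k.1 - j).val ≤ (j - j).val := k.2
      rw [sub_self, ZMod.val_zero, Nat.le_zero] at h1
      exact sub_val_eq_zero_iff.1 h1
    refine ⟨fun k => (hk k).symm ▸ (a, b), ?_, fun s => absurd (hk s.left) s.2.2, rfl⟩
    rintro ⟨k, hk'⟩
    obtain rfl : k = j := hk ⟨k, hk'⟩
    exact hab
  | @step n ℓ a b c hab hbc ih =>
    have hℓj : ℓ + 1 ≠ j := by
      intro h
      rw [h, sub_self, ZMod.val_zero] at hn
      omega
    obtain ⟨q, hq, hqs, hqo⟩ := ih (by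
      rw [val_add_one_sub hℓj] at hn
      omega)
    have hlast : ∀ k ∈ arc j (ℓ + 1), k ∉ arc j ℓ → ℓ + 1 = k := fun k hk hk' =>
      (((mem_arc_add_one_iff hℓj).1 hk).resolve_left hk').symm
    let q' : ∀ k : arc j (ℓ + 1), M k × M (k + 1) := fun k =>
      if h : k.1 ∈ arc j ℓ then q ⟨k.1, h⟩ else hlast k.1 k.2 h ▸ (b, c)
    have hq'1 : ∀ k (hk : k ∈ arc j (ℓ + 1)) (h : k ∈ arc j ℓ), q' ⟨k, hk⟩ = q ⟨k, h⟩ :=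
      fun k hk h => dif_pos h
    have hq'2 : ∀ hk : ℓ + 1 ∈ arc j (ℓ + 1), q' ⟨ℓ + 1, hk⟩ = (b, c) := fun hk =>
      dif_neg (add_one_notMem_arc hℓj)
    refine ⟨q', ?_, ?_, ?_⟩
    · rintro ⟨k, hk⟩
      rcases (mem_arc_add_one_iff hℓj).1 hk with h | rfl
      · rw [hq'1 k hk h]
        exact hq ⟨k, h⟩
      · rw [hq'2]
        exact hbc
    · rintro ⟨k, hk, hkℓ⟩
      have h := ((mem_arc_add_one_iff hℓj).1 hk).resolve_right hkℓ
      change (q' ⟨k, hk⟩).2 = (q' ⟨k + 1, _⟩).1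
      rw [hq'1 k hk h]
      by_cases hk' : k = ℓ
      · subst hk'
        rw [hq'2]
        exact congrArg Prod.snd hqo
      · rw [hq'1 (k + 1) _ (add_one_mem_arc h hk').1]
        exact hqs ⟨k, h, hk'⟩
    · change ((q' ⟨j, _⟩).1, (q' ⟨ℓ + 1, _⟩).2) = _
      rw [hq'1 j _ (left_mem_arc j ℓ), hq'2]
      have h1 : (q ⟨j, left_mem_arc j ℓ⟩).1 = a := congrArg Prod.fst hqo
      rw [h1]

/-- The projection of the fiber product is the geometric composition. -/
theorem image_outerProj (hc : IsConsecutive I j ℓ) :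
    outerProj j ℓ '' fiberProduct (arc j ℓ) I Λ diagonals = geometricComposition Λ j ℓ := by
  ext ⟨a, c⟩
  constructor
  · rintro ⟨q, ⟨hq, hqs⟩, h⟩
    have h1 := chainRel_of_seams hq ((mem_seamSet_arc_iff hc).1 hqs) ℓ (right_mem_arc j ℓ)
    obtain ⟨rfl, rfl⟩ := Prod.mk.inj h
    exact h1
  · intro h
    obtain ⟨q, hq, hqs, ho⟩ := exists_seams_of_chainRel h rfl
    exact ⟨q, ⟨hq, (mem_seamSet_arc_iff hc).2 hqs⟩, ho⟩

end Composition

end Quilt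

end

noncomputable section


namespace Quilt

/-! ### The perturbed correspondences -/

section Transport

variable {F B N F' B' N' : Type*} [NormedAddCommGroup F] [NormedSpace ℝ F] [TopologicalSpace B]
  [TopologicalSpace N] [ChartedSpace B N] [NormedAddCommGroup F'] [NormedSpace ℝ F']
  [TopologicalSpace B'] [TopologicalSpace N'] [ChartedSpace B' N']
  {I : ModelWithCorners ℝ F B} {I' : ModelWithCorners ℝ F' B'}

/-- Push the vector back by the inverse diffeomorphism; isotropy of the image then reduces to
isotropy of the original. -/
theorem IsDiffeoOn.exists_mem_tangentSet {P : N → N'} {Q : N' → N} {D : Set N} {D' : Set N'}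
    (hPQ : IsDiffeoOn I I' P Q D D') {S : Set N} (hS : S ⊆ D) {p : N} (hp : p ∈ D)
    {w : TangentSpace I' (P p)} (hw : w ∈ tangentSet I' (P '' S) (P p)) :
    ∃ v ∈ tangentSet I S p, (mfderiv I I' P p v : F') = w := by
  have h1 : mfderiv I' I Q (P p) w ∈ tangentSet I S (Q (P p)) :=
    mem_tangentSet_map hPQ.open_target (hPQ.mapsTo p hp)
      (hPQ.smooth_symm _ (hPQ.mapsTo p hp)) (by
        rintro _ ⟨x, hx, rfl⟩ _
        rwa [hPQ.left_inv x (hS hx)]) hw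
  have key : ∀ (p' : N) (u : F), p' = p → (u : TangentSpace I p') ∈ tangentSet I S p' →
      (u : TangentSpace I p) ∈ tangentSet I S p := by
    rintro _ u rfl h
    exact h
  exact ⟨_, key _ _ (hPQ.left_inv p hp) h1, hPQ.mfderiv_apply_symm hp w⟩

end Transport

section Lagrangian

variable {E M E' M' : Type*} [NormedAddCommGroup E] [NormedSpace ℝ E] [TopologicalSpace M]
  [ChartedSpace E M] [NormedAddCommGroup E'] [NormedSpace ℝ E'] [TopologicalSpace M']
  [ChartedSpace E' M']

theorem mfderiv_prodMap_id_apply {φ : M' → M'} {p : M × M'}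
    (hφ : MDifferentiableAt 𝓘(ℝ, E') 𝓘(ℝ, E') φ p.2) (v : E × E') :
    (mfderiv (𝓘(ℝ, E).prod 𝓘(ℝ, E')) (𝓘(ℝ, E).prod 𝓘(ℝ, E')) (Prod.map (id : M → M) φ) p v :
      E × E') = (v.1, mfderiv 𝓘(ℝ, E') 𝓘(ℝ, E') φ p.2 v.2) :=
  congrArg (fun A : E × E' →L[ℝ] E × E' => A v)
    (HasMFDerivAt.prodMap (hasMFDerivAt_id (I := 𝓘(ℝ, E)) p.1) hφ.hasMFDerivAt).mfderiv |>.trans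
      (by rw [mfderiv_id]; rfl)

/-- The image of a Lagrangian correspondence under a symplectic diffeomorphism of the target. -/
theorem IsLagrangianCorrespondence.image {σ : SymplecticForm E M} {σ' : SymplecticForm E' M'}
    {L : Set (M × M')} (hL : IsLagrangianCorrespondence σ σ' L) {φ : M' → M'}
    {Q : M × M' → M × M'} {D D' : Set (M × M')}
    (hφ : IsDiffeoOn (𝓘(ℝ, E).prod 𝓘(ℝ, E')) (𝓘(ℝ, E).prod 𝓘(ℝ, E')) (Prod.map id φ) Q D D')
    (hLD : L ⊆ D) (hφd : ∀ p ∈ L, MDifferentiableAt 𝓘(ℝ, E') 𝓘(ℝ, E') φ p.2)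
    (hφσ : ∀ p ∈ L, ∀ v w : TangentSpace 𝓘(ℝ, E') p.2, σ'.form (φ p.2)
        ![mfderiv 𝓘(ℝ, E') 𝓘(ℝ, E') φ p.2 v, mfderiv 𝓘(ℝ, E') 𝓘(ℝ, E') φ p.2 w] =
      σ'.form p.2 ![v, w]) :
    IsLagrangianCorrespondence σ σ' (Prod.map id φ '' L) := by
  obtain ⟨⟨d, hd, hLd⟩, hiso⟩ := hL
  refine ⟨⟨d, hd, hφ.isSubmanifold_image hLD hLd⟩, ?_⟩
  rintro _ ⟨p, hp, rfl⟩ v' hv' w' hw'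
  obtain ⟨v, hv, hvv'⟩ := hφ.exists_mem_tangentSet hLD (hLD hp) hv'
  obtain ⟨w, hw, hww'⟩ := hφ.exists_mem_tangentSet hLD (hLD hp) hw'
  replace hvv' := (mfderiv_prodMap_id_apply (hφd p hp) v).symm.trans hvv'
  replace hww' := (mfderiv_prodMap_id_apply (hφd p hp) w).symm.trans hww'
  subst hvv' hww'
  refine Eq.trans ?_ (hiso p hp v hv w hw)
  exact congrArg (fun c => -σ.form p.1 ![v.1, w.1] + c) (hφσ p hp v.2 w.2)

end Lagrangian

/-! ### Hamiltonian chords as intersection points. -/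

section Chords

variable {r : ℕ} {E M : ZMod (r + 1) → Type*} [∀ j, NormedAddCommGroup (E j)]
  [∀ j, NormedSpace ℝ (E j)] [∀ j, FiniteDimensional ℝ (E j)] [∀ j, TopologicalSpace (M j)]
  [∀ j, T2Space (M j)] [∀ j, ChartedSpace (E j) (M j)] [∀ j, IsManifold 𝓘(ℝ, E j) ∞ (M j)]
  {σ : ∀ j, SymplecticForm (E j) (M j)} {δ : ZMod (r + 1) → ℝ}
  {L : ∀ k, Set (M k × M (k + 1))} {H : ∀ j, ℝ → M j → ℝ}

/-- A chord is determined by its final value, which gives injectivity. Conversely, a point of the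
perturbed slot `k` comes from some `p ∈ L k`, the chord from `p.2` serves as the chord of index `k +
1`, and the diagonal conditions match the final values. -/
theorem bijOn_generators (hδ : ∀ j, 0 < δ j)
    (hH : ∀ j, ContMDiffOn (𝓘(ℝ, ℝ).prod 𝓘(ℝ, E j)) 𝓘(ℝ, ℝ) ∞ (fun p : ℝ × M j => H j p.1 p.2)
      (Icc 0 (δ j) ×ˢ univ))
    (hflow : ∀ k, ∀ p ∈ L k, FlowDefinedAt (σ (k + 1)) (H (k + 1)) (δ (k + 1)) p.2) :
    BijOn (fun (x : ∀ j, Icc (0 : ℝ) (δ j) → M j) (k : (univ : Set (ZMod (r + 1)))) =>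
        (x k ⟨δ k, right_mem_Icc.2 (hδ k).le⟩,
          x (k + 1) ⟨δ (k + 1), right_mem_Icc.2 (hδ (k + 1)).le⟩))
      (generators σ δ L H hδ) (fiberProduct univ univ (perturbed σ δ L H) diagonals) := by
  have hend : ∀ (x : ∀ j, Icc (0 : ℝ) (δ j) → M j) j, IccExtend (hδ j).le (x j) (δ j) =
      x j ⟨δ j, right_mem_Icc.2 (hδ j).le⟩ := fun x j => IccExtend_right _ _
  have hstart : ∀ (x : ∀ j, Icc (0 : ℝ) (δ j) → M j) j, IccExtend (hδ j).le (x j) 0 =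
      x j ⟨0, left_mem_Icc.2 (hδ j).le⟩ := fun x j => IccExtend_left _ _
  refine ⟨fun x hx => ⟨fun k => ?_, fun _ _ _ _ => rfl⟩, fun x hx x' hx' h => ?_, fun q hq => ?_⟩
  · refine ⟨_, hx.2 k, Prod.ext rfl ?_⟩
    have := (hx.1 (k + 1)).flowMap_eq (hδ _) (hH _)
    rwa [hend, hstart] at this
  · funext j t
    have h1 : x j ⟨δ j, right_mem_Icc.2 (hδ j).le⟩ = x' j ⟨δ j, right_mem_Icc.2 (hδ j).le⟩ :=
      congrArg Prod.fst (congrFun h ⟨j, mem_univ j⟩)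
    have h2 := (hx.1 j).eqOn (hδ j) (hH j) (hx'.1 j) (right_mem_Icc.2 (hδ j).le)
      (by rw [hend, hend, h1]) t.2
    rwa [IccExtend_of_mem _ _ t.2, IccExtend_of_mem _ _ t.2] at h2
  · have hseam : ∀ k : ZMod (r + 1), (q ⟨k, mem_univ k⟩).2 = (q ⟨k + 1, mem_univ _⟩).1 :=
      fun k => hq.2 k (mem_univ k) (mem_univ _) (mem_univ _)
    -- The chord of index `j` starts in slot `j - 1`; quantifying over `k` with `j = k + 1` confines
    -- the transport between fibers to one cast.
    have hex : ∀ j, ∃ y : ℝ → M j, IsHamChord (σ j) (H j) (δ j) y ∧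
        y (δ j) = (q ⟨j, mem_univ j⟩).1 ∧
        ∀ (k : ZMod (r + 1)) (h : j = k + 1),
          ((q ⟨k, mem_univ k⟩).1, (h ▸ y 0 : M (k + 1))) ∈ L k := by
      intro j
      obtain ⟨k, rfl⟩ : ∃ k, j = k + 1 := ⟨j - 1, (sub_add_cancel j 1).symm⟩
      obtain ⟨p, hp, hpq⟩ := hq.1 ⟨k, mem_univ k⟩
      obtain ⟨y, hy, hy0⟩ := hflow k p hp
      refine ⟨y, hy, ?_, fun k' h => ?_⟩
      · rw [← hseam, ← hpq, ← hy.flowMap_eq (hδ _) (hH _), hy0]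
        rfl
      · obtain rfl : k = k' := add_right_cancel h
        change ((q ⟨k, mem_univ k⟩).1, y 0) ∈ L k
        rw [← hpq, hy0]
        exact hp
    choose y hy hyδ hyL using hex
    have hyI : ∀ j, ∀ t ∈ Icc 0 (δ j), IccExtend (hδ j).le (fun t : Icc 0 (δ j) => y j t) t =
        y j t := fun j t ht => IccExtend_of_mem (hδ j).le (fun t : Icc 0 (δ j) => y j t) ht
    refine ⟨fun j t => y j t, ⟨fun j => isHamChord_iff.2 fun t ht =>
      (isHamChord_iff.1 (hy j) t ht).congr (hyI j) ht, fun k => ?_⟩, ?_⟩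
    · change (y k (δ k), y (k + 1) 0) ∈ L k
      rw [hyδ]
      exact hyL (k + 1) k rfl
    · funext ⟨k, hk⟩
      change (y k (δ k), y (k + 1) (δ (k + 1))) = _
      rw [hyδ, hyδ, ← hseam]

end Chords

end Quilt

end

/-! ### The flows as diffeomorphisms, and the theorem. -/

noncomputable section


namespace Quilt

section Flows

variable {r : ℕ} {E M : ZMod (r + 1) → Type*} [∀ j, NormedAddCommGroup (E j)]
  [∀ j, NormedSpace ℝ (E j)] [∀ j, FiniteDimensional ℝ (E j)] [∀ j, TopologicalSpace (M j)]
  [∀ j, T2Space (M j)] [∀ j, ChartedSpace (E j) (M j)] [∀ j, IsManifold 𝓘(ℝ, E j) ∞ (M j)]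
  {σ : ∀ j, SymplecticForm (E j) (M j)} {δ : ZMod (r + 1) → ℝ}
  {L : ∀ k, Set (M k × M (k + 1))} {H : ∀ j, ℝ → M j → ℝ}

/-- The Hamiltonian flow is a diffeomorphism between the sets where it and its reversal are
defined. -/
theorem isDiffeoOn_flowMap (hδ : ∀ j, 0 < δ j)
    (hH : ∀ j, ContMDiffOn (𝓘(ℝ, ℝ).prod 𝓘(ℝ, E j)) 𝓘(ℝ, ℝ) ∞ (fun p : ℝ × M j => H j p.1 p.2)
      (Icc 0 (δ j) ×ˢ univ)) (i : ZMod (r + 1)) :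
    IsDiffeoOn 𝓘(ℝ, E i) 𝓘(ℝ, E i) (flowMap (σ i) (H i) (δ i))
      (flowMap (σ i) (reverse (δ i) (H i)) (δ i)) {m | FlowDefinedAt (σ i) (H i) (δ i) m}
      {m | FlowDefinedAt (σ i) (reverse (δ i) (H i)) (δ i) m} := by
  have hR := contMDiffOn_reverse (hH i)
  -- Reversing twice returns `H`, so the left-inverse statement for the reversed flow is the
  -- right-inverse statement for the flow.
  have key : ∀ m, FlowDefinedAt (σ i) (reverse (δ i) (H i)) (δ i) m →
      FlowDefinedAt (σ i) (H i) (δ i) (flowMap (σ i) (reverse (δ i) (H i)) (δ i) m) ∧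
      flowMap (σ i) (H i) (δ i) (flowMap (σ i) (reverse (δ i) (H i)) (δ i) m) = m := by
    intro m hm
    have := FlowDefinedAt.reverse (hδ i) hR hm
    rwa [reverse_reverse] at this
  exact ⟨isOpen_flowDefinedAt (hδ i) (hH i), isOpen_flowDefinedAt (hδ i) hR,
    fun m hm => (FlowDefinedAt.reverse (hδ i) (hH i) hm).1, fun m hm => (key m hm).1,
    fun m hm => (FlowDefinedAt.reverse (hδ i) (hH i) hm).2, fun m hm => (key m hm).2,
    fun m hm => (FlowDefinedAt.local (hδ i) (hH i) hm).2.1,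
    fun m hm => (FlowDefinedAt.local (hδ i) hR hm).2.1⟩

theorem perturbIdentifies (hδ : ∀ j, 0 < δ j)
    (hH : ∀ j, ContMDiffOn (𝓘(ℝ, ℝ).prod 𝓘(ℝ, E j)) 𝓘(ℝ, ℝ) ∞ (fun p : ℝ × M j => H j p.1 p.2)
      (Icc 0 (δ j) ×ˢ univ))
    (hflow : ∀ k, ∀ p ∈ L k, FlowDefinedAt (σ (k + 1)) (H (k + 1)) (δ (k + 1)) p.2)
    (K I : Set (ZMod (r + 1))) : PerturbIdentifies σ δ L H K I := by
  have hφ := isDiffeoOn_flowMap (σ := σ) hδ hH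
  have hΓ : ∀ i (p : M i × M i), p ∈ flowGraphs σ δ H i ↔
      p.1 ∈ {m | FlowDefinedAt (σ i) (H i) (δ i) m} ∧ flowMap (σ i) (H i) (δ i) p.1 = p.2 :=
    fun i p => mem_flowGraph_iff (hδ i) (hH i)
  have hL : ∀ k, L k ⊆ univ ×ˢ {m | FlowDefinedAt (σ (k + 1)) (H (k + 1)) (δ (k + 1)) m} :=
    fun k p hp => ⟨mem_univ _, hflow k p hp⟩
  refine ⟨bijOn_slotMap hφ hΓ hL K I, fun q hq => ⟨fun k => ?_, ?_⟩⟩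
  · exact (isDiffeoOn_slot hφ k).smooth _ (hL k (hq.1 k))
  · exact bijOn_piTangentSet_slotMap hφ hΓ hL hq

end Flows

end Quilt

end

theorem corollary2p3 {r : ℕ} {E M : ZMod (r + 1) → Type*}
    [∀ j, NormedAddCommGroup (E j)] [∀ j, NormedSpace ℝ (E j)] [∀ j, FiniteDimensional ℝ (E j)]
    [∀ j, TopologicalSpace (M j)] [∀ j, T2Space (M j)] [∀ j, ChartedSpace (E j) (M j)]
    [∀ j, IsManifold 𝓘(ℝ, E j) ∞ (M j)]
    (σ : ∀ j, Quilt.SymplecticForm (E j) (M j))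
    (δ : ZMod (r + 1) → ℝ) (hδ : ∀ j, 0 < δ j)
    (L : ∀ k, Set (M k × M (k + 1)))
    (hL : ∀ k, Quilt.IsLagrangianCorrespondence (σ k) (σ (k + 1)) (L k))
    (hLc : ∀ k, IsCompact (L k))
    (H : ∀ j, ℝ → M j → ℝ) (hH : H ∈ Quilt.HamStar σ δ L)
    (hflow : ∀ k, ∀ p ∈ L k, Quilt.FlowDefinedAt (σ (k + 1)) (H (k + 1)) (δ (k + 1)) p.2) :
    -- the perturbed sets form again a compact cyclic Lagrangian correspondence
    (∀ k, Quilt.IsLagrangianCorrespondence (σ k) (σ (k + 1)) (Quilt.perturbed σ δ L H k) ∧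
      IsCompact (Quilt.perturbed σ δ L H k)) ∧
    -- the generalized intersection
    (Quilt.IsTransversalFiberProduct E univ univ (Quilt.perturbed σ δ L H) Quilt.diagonals ∧
      BijOn (fun (x : ∀ j, Icc (0 : ℝ) (δ j) → M j) (k : (univ : Set (ZMod (r + 1)))) =>
          (x k ⟨δ k, right_mem_Icc.2 (hδ k).le⟩,
            x (k + 1) ⟨δ (k + 1), right_mem_Icc.2 (hδ (k + 1)).le⟩))
        (Quilt.generators σ δ L H hδ)
        (Quilt.fiberProduct univ univ (Quilt.perturbed σ δ L H) Quilt.diagonals) ∧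
      Quilt.PerturbIdentifies σ δ L H univ univ) ∧
    -- the partial fiber products
    (∀ I : Set (ZMod (r + 1)), I ≠ univ →
      Quilt.IsTransversalFiberProduct E univ I (Quilt.perturbed σ δ L H) Quilt.diagonals ∧
      Quilt.PerturbIdentifies σ δ L H univ I ∧
      BijOn (Quilt.splitArcs I)
        (Quilt.fiberProduct univ I (Quilt.perturbed σ δ L H) Quilt.diagonals)
        (Set.pi univ fun c =>
          Quilt.fiberProduct (Quilt.arc c.1.1 c.1.2) I (Quilt.perturbed σ δ L H)
            Quilt.diagonals) ∧
      ∀ j ℓ, Quilt.IsConsecutive I j ℓ →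
        Quilt.IsTransversalFiberProduct E (Quilt.arc j ℓ) I (Quilt.perturbed σ δ L H)
          Quilt.diagonals ∧
        Quilt.fiberProduct (Quilt.arc j ℓ) I (Quilt.perturbed σ δ L H) Quilt.diagonals =
          Quilt.perturbMap σ δ H (Quilt.arc j ℓ) ''
            Quilt.fiberProduct (Quilt.arc j ℓ) I L (Quilt.flowGraphs σ δ H) ∧
        Quilt.PerturbIdentifies σ δ L H (Quilt.arc j ℓ) I ∧
        -- the projection to the outer components
        (∃ d : ℕ, 2 * d = Module.finrank ℝ (E j) + Module.finrank ℝ (E (ℓ + 1)) ∧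
          Quilt.IsPiSubmanifold (Quilt.slotModel E (Quilt.arc j ℓ)) d
            (Quilt.fiberProduct (Quilt.arc j ℓ) I (Quilt.perturbed σ δ L H)
              Quilt.diagonals)) ∧
        (∀ q ∈ Quilt.fiberProduct (Quilt.arc j ℓ) I (Quilt.perturbed σ δ L H) Quilt.diagonals,
          InjOn (Quilt.outerProj (M := E) j ℓ)
            (Quilt.piTangentSet (Quilt.slotModel E (Quilt.arc j ℓ))
              (Quilt.fiberProduct (Quilt.arc j ℓ) I (Quilt.perturbed σ δ L H)
                Quilt.diagonals) q)) ∧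
        Quilt.outerProj j ℓ ''
            Quilt.fiberProduct (Quilt.arc j ℓ) I (Quilt.perturbed σ δ L H) Quilt.diagonals =
          Quilt.geometricComposition (Quilt.perturbed σ δ L H) j ℓ) := by
  obtain ⟨hHs, hTu, hTI⟩ := hH
  have hφ := Quilt.isDiffeoOn_flowMap (σ := σ) hδ hHs
  have hΓ : ∀ i (p : M i × M i), p ∈ Quilt.flowGraphs σ δ H i ↔
      p.1 ∈ {m | Quilt.FlowDefinedAt (σ i) (H i) (δ i) m} ∧
        Quilt.flowMap (σ i) (H i) (δ i) p.1 = p.2 :=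
    fun i p => Quilt.mem_flowGraph_iff (hδ i) (hHs i)
  -- Existence of the flow on the projections puts each correspondence inside the open domain of its
  -- slot diffeomorphism, which is all that the transport lemmas need.
  have hLD : ∀ k, L k ⊆
      univ ×ˢ {m | Quilt.FlowDefinedAt (σ (k + 1)) (H (k + 1)) (δ (k + 1)) m} :=
    fun k p hp => ⟨mem_univ _, hflow k p hp⟩
  have hpert := Quilt.perturbIdentifies hδ hHs hflow
  have htrans : ∀ {K I : Set (ZMod (r + 1))},
      Quilt.IsTransversalFiberProduct E K I L (Quilt.flowGraphs σ δ H) →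
      Quilt.IsTransversalFiberProduct E K I (Quilt.perturbed σ δ L H) Quilt.diagonals :=
    fun hT => Quilt.isTransversalFiberProduct_slotImage hφ hΓ hLD hT
  have hlag : ∀ k, Quilt.IsLagrangianCorrespondence (σ k) (σ (k + 1))
      (Quilt.perturbed σ δ L H k) := fun k =>
    (hL k).image (Quilt.isDiffeoOn_slot hφ k) (hLD k)
      (fun p hp => (hφ (k + 1)).mdifferentiableAt (hflow k p hp))
      (fun p hp => (Quilt.FlowDefinedAt.local (hδ _) (hHs _) (hflow k p hp)).2.2)
  choose d hd hsub using fun k => (hlag k).1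
  refine ⟨fun k => ⟨hlag k, (hLc k).image_of_continuousOn fun p hp =>
      ((Quilt.isDiffeoOn_slot hφ k).smooth p (hLD k hp)).continuousAt.continuousWithinAt⟩,
    ⟨htrans hTu, Quilt.bijOn_generators hδ hHs hflow, hpert _ _⟩, fun I hI =>
    ⟨Quilt.isTransversalFiberProduct_univ hI fun j ℓ hc => htrans (hTI I hI j ℓ hc), hpert _ _,
      Quilt.bijOn_splitArcs hI, fun j ℓ hc => ?_⟩⟩
  have hT := htrans (hTI I hI j ℓ hc)
  have : Fintype (Quilt.arc j ℓ) := Fintype.ofFinite _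
  have : Fintype (Quilt.Seam j ℓ) := Fintype.ofFinite _
  obtain ⟨e, he, he'⟩ := Quilt.exists_dim_fiberProduct (j := j) (ℓ := ℓ) hd
  exact ⟨hT, Quilt.fiberProduct_slotImage hΓ hLD _ _, hpert _ _,
    ⟨e, he', Quilt.isPiSubmanifold_fiberProduct hc hsub hT he⟩,
    fun q hq => Quilt.injOn_outerProj σ hc (fun k => (hlag k).2) hT hq,
    Quilt.image_outerProj hc⟩
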